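/- **Setting.** Let $X$ be an integral regular projective curve over a finite field $k=\mathbb F_q$ with function field $F$. For a closed point $p$ let $F_p$ be the completion of $F$ at $p$, $\mathcal O_p$ its ring of integers, $\pi_p$ a local parameter, and $\deg p=[k(p):k]$; let $\mathbb A$ be the adele ring of $F$ and $\mathcal O=\prod_p\mathcal O_p$. Put $\gamma=1-\chi(X,\mathcal O_X)$, the (arithmetic) genus of $X$; it equals $\dim_k H^1(X,\mathcal O_X)$ when $k$ is the full constant field of $F$. Let $r\ge 1$. For $g=(g_p)\in \mathrm{GL}_r(\mathbb A)$ put $\deg g=\sum_p \mathrm{ord}_p(\det g_p)\deg p$, $$\mathbb A^r(g)=\{a\in\mathbb A^r: ga\in\mathcal O^r\},\qquad H^0(F,g)=\mathbb A^r(g)\cap F^r,\qquad H^1(F,g)=\mathbb A^r/(\mathbb A^r(g)+F^r),$$ and $h^i(F,g)=\dim_k H^i(F,g)$. The element $g$ is *semi-stable* if the locally free sheaf $\mathcal E(g)\colon U\mapsto F^r\cap\bigcap_{p\in U}g_p^{-1}\mathcal O_p^r$ on $X$ is (Mumford) semi-stable, i.e. $\deg \mathcal M/\operatorname{rank}\mathcal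 M\le \deg\mathcal E(g)/r$ for every proper nonzero coherent subsheaf $\mathcal M\subset\mathcal E(g)$. Let $D=p_1+\dots+p_n$ with distinct $k$-rational points $p_i$, and for a divisor $E$ let $\iota_E=(\pi_p^{\mathrm{ord}_p E})_p$ and $g(-E)=\iota_E^{-1}g$. The element $g$ is *$D$-balanced* if for every $i$ all elementary-divisor exponents of $g_{p_i}$ are $0$, i.e. there are $M,N\in\mathrm{GL}_r(\mathcal O_{p_i})$ with $Mg_{p_i}N=1$ (equivalently $g_{p_i}\in\mathrm{GL}_r(\mathcal O_{p_i})$). A rational (Weil) differential is a $k$-linear map $\omega\colon\mathbb A\to k$ vanishing on $F$ and on $\mathbb A(E)=\{a:\mathrm{ord}_p(a_p)+\mathrm{ord}_p(E)\ge 0\ \forall p\}$ for some divisor $E$; $\Omega_F$ is the space of these, $\omega_p\colon F_p\to k$ the local component of $\omega$ at $p$, $(f\omega)(a)=\omega(fa)$ for $f\in F$, and, for $\omega\neq0$, $\mathrm{ord}_p(\omega)$ is the largest $m$ such that $\omega_p(x)=0$ for all $x\in F_p$ with $\mathrm{ord}_p(x)\ge -m$. Fix a *$D$-special* differential: $0\ne\omega_0\in\Omega_F$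 with $\mathrm{ord}_{p_i}(\omega_0)=-1$ and $\omega_{0,p_i}(1)=1$ for all $i$. Put $$\Omega^r_F(g(-D))=\{(f_j\omega_0)_{j}\in\Omega_F^r:\ f=(f_j)\in F^r,\ \iota_{(\omega_0)+D}\,f\in {}^t g\,\mathcal O^r\},$$ where ${}^tg$ is the transpose of $g$. For $D$-balanced $g$ let $k_{D,g}$ and $k_{D,g}^\perp$ be the dimensions over $k$ of the codes $$C_{F,r}(D,g)=\{((f_j(p_1))_j,\dots,(f_j(p_n))_j): f\in H^0(F,g)\},$$ $$C_{\Omega,r}(D,g)=\{((\omega_{j,p_1}(1))_j,\dots,(\omega_{j,p_n}(1))_j): (\omega_j)\in\Omega^r_F(g(-D))\}.$$ **Statement.** Let $g\in\mathrm{GL}_r(\mathbb A)$ be $D$-balanced and semi-stable. 1. If $\deg g<r\deg D$, then $H^0(F,g)$ is finite dimensional and $k_{D,g}=h^0(F,g)\ge \deg g-r(\gamma-1)$. 2. If $\deg g>2r(\gamma-1)$, then $H^1(F,g(-D))$ is finite dimensional and $k_{D,g}^\perp=h^1(F,g(-D))\ge r(\deg D+\gamma-1)-\deg g$. 3. If $r\deg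 D>\deg g>2r(\gamma-1)$, then $k_{D,g}=\deg g-r(\gamma-1)$ and $k_{D,g}^\perp=r(\deg D+\gamma-1)-\deg g$. -/

import Mathlib

open scoped WithZero

noncomputable section

namespace AdelicCode

universe u v

/-- `F` is an algebraic function field of one variable over `k`: a finitely generated field
extension of transcendence degree one. -/
class IsFunctionField (k : Type u) (F : Type v) [Field k] [Field F] [Algebra k F] : Prop where
  essFiniteType : Algebra.EssFiniteType k F
  trdeg_eq_one : Algebra.trdeg k F = 1

/-- A place of `F / k`, i.e. a closed point of the regular projective curve `X` over `k` with
function field `F`: a normalized discrete valuation of `F` which is trivial on `k`. -/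
structure Place (k : Type u) (F : Type v) [Field k] [Field F] [Algebra k F] where
  val : Valuation F ℤᵐ⁰
  surjective : Function.Surjective val
  map_const : ∀ c : k, c ≠ 0 → val (algebraMap k F c) = 1

variable {k : Type u} {F : Type v} [Field k] [Field F] [Algebra k F]

namespace Place

theorem val_injective : Function.Injective (Place.val : Place k F → Valuation F ℤᵐ⁰) := by
  rintro ⟨v, _, _⟩ ⟨w, _, _⟩ h
  simpa using h

theorem val_const_le (p : Place k F) (c : k) : p.val (algebraMap k F c) ≤ 1 := by
  by_cases hc : c = 0
  · simp [hc]
  · exact (p.map_const c hc).le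

end Place

/-! ### Every function has only finitely many poles -/

section Finiteness

theorem val_le_one_of_isAlgebraic (p : Place k F) {f : F} (hf : IsAlgebraic k f) :
    p.val f ≤ 1 := by
  obtain ⟨P, hP, hr⟩ := hf.isIntegral
  by_contra! h
  have hf0 : p.val f ≠ 0 := (zero_lt_one.trans h).ne'
  rw [← Polynomial.aeval_def, Polynomial.aeval_eq_sum_range, Finset.sum_range_succ,
    hP.coeff_natDegree, one_smul] at hr
  have h1 : p.val (∑ i ∈ Finset.range P.natDegree, P.coeff i • f ^ i) < p.val f ^ P.natDegree := by
    refine p.val.map_sum_lt (pow_ne_zero _ hf0) fun i hi => ?_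
    rw [Algebra.smul_def, map_mul, map_pow]
    calc _ ≤ 1 * p.val f ^ i := mul_le_mul_left (p.val_const_le _) _
      _ < _ := by
        rw [one_mul]
        exact pow_lt_pow_right₀ h (Finset.mem_range.1 hi)
  have h2 : p.val (∑ i ∈ Finset.range P.natDegree, P.coeff i • f ^ i) = p.val f ^ P.natDegree := by
    rw [eq_neg_of_add_eq_zero_left hr, Valuation.map_neg, map_pow]
  exact h1.ne h2

/-- The absolute value attached to a place. -/
def Place.abv (p : Place k F) : AbsoluteValue F ℝ where
  toFun x := (WithZeroMulInt.toNNReal (two_ne_zero : (2 : NNReal) ≠ 0) (p.val x) : ℝ)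
  map_mul' x y := by simp
  nonneg' x := NNReal.coe_nonneg _
  eq_zero' x := by simp
  add_le' x y := by
    have hm := (WithZeroMulInt.toNNReal_strictMono (e := 2) one_lt_two).monotone
    rcases le_max_iff.1 (p.val.map_add x y) with h | h
    · exact (NNReal.coe_le_coe.2 (hm h)).trans (le_add_of_nonneg_right (NNReal.coe_nonneg _))
    · exact (NNReal.coe_le_coe.2 (hm h)).trans (le_add_of_nonneg_left (NNReal.coe_nonneg _))

theorem Place.abv_le_iff (p : Place k F) (x y : F) : p.abv x ≤ p.abv y ↔ p.val x ≤ p.val y :=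
  NNReal.coe_le_coe.trans (WithZeroMulInt.toNNReal_strictMono (e := 2) one_lt_two).le_iff_le

theorem Place.eq_of_abv_isEquiv {p q : Place k F} (h : p.abv.IsEquiv q.abv) : p = q := by
  have h' (x y : F) : p.val x ≤ p.val y ↔ q.val x ≤ q.val y := by
    rw [← p.abv_le_iff, ← q.abv_le_iff]; exact h x y
  have heq (x y : F) : p.val x = p.val y ↔ q.val x = q.val y := by
    simp only [le_antisymm_iff, h']
  have hlt (x y : F) : p.val x < p.val y ↔ q.val x < q.val y := by
    simp only [← not_le, h']
  obtain ⟨a, ha⟩ := p.surjective (WithZero.exp 1)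
  obtain ⟨b, hb⟩ := q.surjective (WithZero.exp 1)
  have key (r : Place k F) (x : F) : r.val x ≤ WithZero.exp 0 ∨ WithZero.exp 1 ≤ r.val x := by
    by_cases hx : r.val x = 0
    · simp [hx]
    · rw [← WithZero.exp_log hx, WithZero.exp_le_exp, WithZero.exp_le_exp]
      omega
  have hqa : q.val a = WithZero.exp 1 := by
    apply le_antisymm
    · rw [← hb, ← h', ha]
      refine (key p b).resolve_left fun hle => ?_
      have h1 : q.val b ≤ q.val 1 := (h' _ _).1 (by simpa using hle)
      rw [hb, map_one, ← WithZero.exp_zero, WithZero.exp_le_exp] at h1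
      omega
    · refine (key q a).resolve_left fun hle => ?_
      have h1 : p.val a ≤ p.val 1 := (h' _ _).2 (by simpa using hle)
      rw [ha, map_one, ← WithZero.exp_zero, WithZero.exp_le_exp] at h1
      omega
  apply Place.val_injective
  ext x
  by_cases hx : x = 0
  · simp [hx]
  have hx' : p.val x ≠ 0 := by simpa using hx
  have e1 : p.val x = p.val (a ^ (WithZero.log (p.val x))) := by
    rw [map_zpow₀, ha, ← WithZero.exp_zsmul]
    simp [WithZero.exp_log hx']
  rw [e1, (heq _ _).1 e1, map_zpow₀, map_zpow₀, ha, hqa]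

theorem Place.abv_isNontrivial (p : Place k F) : p.abv.IsNontrivial := by
  obtain ⟨a, ha⟩ := p.surjective (WithZero.exp 1)
  have h0 : a ≠ 0 := by rintro rfl; rw [map_zero] at ha; exact WithZero.exp_ne_zero ha.symm
  refine ⟨a, h0, fun h1 => ?_⟩
  have := (p.abv_le_iff a 1).1 (by simp [h1])
  rw [ha, map_one, ← WithZero.exp_zero, WithZero.exp_le_exp] at this
  omega

theorem val_aeval (p : Place k F) {t : F} (ht : p.val t < 1) {P : Polynomial k} (hP : P ≠ 0) :
    p.val (Polynomial.aeval t P) = p.val t ^ P.natTrailingDegree := by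
  obtain ⟨Q, hQ⟩ : Polynomial.X ^ P.natTrailingDegree ∣ P :=
    Polynomial.X_pow_dvd_iff.2 fun d hd => Polynomial.coeff_eq_zero_of_lt_natTrailingDegree hd
  have hQ0 : Q.coeff 0 ≠ 0 := by
    have h1 : P.coeff P.natTrailingDegree ≠ 0 := by
      simpa [Polynomial.trailingCoeff] using
        (Polynomial.trailingCoeff_nonzero_iff_nonzero (p := P)).2 hP
    intro h0
    apply h1
    generalize P.natTrailingDegree = m at hQ
    have := Polynomial.coeff_X_pow_mul Q m 0
    rw [zero_add] at this
    rw [hQ, this, h0]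
  have h1 : p.val (Polynomial.aeval t Q) = 1 := by
    conv_lhs => rw [← Polynomial.X_mul_divX_add Q]
    rw [map_add, map_mul, Polynomial.aeval_X, Polynomial.aeval_C]
    have h2 : p.val (Polynomial.aeval t Q.divX) ≤ 1 := by
      rw [Polynomial.aeval_eq_sum_range]
      refine p.val.map_sum_le fun i _ => ?_
      rw [Algebra.smul_def, map_mul, map_pow]
      exact mul_le_one' (p.val_const_le _) (pow_le_one' ht.le _)
    have h3 : p.val (t * Polynomial.aeval t Q.divX) < p.val (algebraMap k F (Q.coeff 0)) := by
      rw [p.map_const _ hQ0, map_mul]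
      exact mul_lt_one_of_lt_of_le ht h2
    rw [Valuation.map_add_eq_of_lt_right p.val h3, p.map_const _ hQ0]
  conv_lhs => rw [hQ]
  rw [map_mul, map_pow, Polynomial.aeval_X, map_mul, map_pow, h1, mul_one]

theorem finite_extension [IsFunctionField k F] {t : F} (ht : Transcendental k t) :
    Module.Finite (IntermediateField.adjoin k {t}) F := by
  have : Algebra.EssFiniteType k F := IsFunctionField.essFiniteType
  have hind : AlgebraicIndependent k (fun _ : PUnit.{v + 1} => t) :=
    algebraicIndependent_unique_type_iff.2 ht
  have hb := hind.isTranscendenceBasis_of_trdeg_le_of_finite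
    (by rw [IsFunctionField.trdeg_eq_one (k := k) (F := F)]; simp)
  have halg := hb.isAlgebraic_field
  rw [Set.range_const] at halg
  have : Algebra.EssFiniteType (IntermediateField.adjoin k {t}) F :=
    Algebra.EssFiniteType.of_comp k _ F
  exact Algebra.finite_of_essFiniteType_of_isAlgebraic

open scoped IntermediateField.algebraAdjoinAdjoin in
theorem finite_zeros [IsFunctionField k F] {t : F} (ht : Transcendental k t) :
    {p : Place k F | p.val t < 1}.Finite := by
  classical
  have hfin := finite_extension ht
  by_contra hinf
  obtain ⟨s, hs, hcard⟩ := Set.Infinite.exists_subset_card_eq hinf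
    (Module.finrank (IntermediateField.adjoin k {t}) F + 1)
  choose x hx1 hx2 using AbsoluteValue.exists_one_lt_lt_one_pi_of_not_isEquiv
    (v := fun p : s => p.1.abv) (fun p => p.1.abv_isNontrivial)
    (fun p q hpq h => hpq (Subtype.ext (Place.eq_of_abv_isEquiv h)))
  have hx1' (p : s) : 1 < p.1.val (x p) := by
    rw [← not_le, ← map_one p.1.val, ← p.1.abv_le_iff, map_one, not_le]; exact hx1 p
  have hx2' (p q : s) (h : q ≠ p) : q.1.val (x p) < 1 := by
    rw [← not_le, ← map_one q.1.val, ← q.1.abv_le_iff, map_one, not_le]; exact hx2 p q h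
  have hli : LinearIndependent (Algebra.adjoin k {t}) x := by
    rw [Fintype.linearIndependent_iff]
    intro c hc
    have hex (p : s) : ∃ P : Polynomial k, Polynomial.aeval t P = (c p : F) := by
      have h1 : (c p : F) ∈ (Polynomial.aeval t : Polynomial k →ₐ[k] F).range :=
        Algebra.adjoin_singleton_eq_range_aeval k t ▸ (c p).2
      exact h1
    choose P hP using hex
    by_contra! hne
    obtain ⟨i, hi⟩ := hne
    have hcP (j : s) (hj : P j = 0) : c j = 0 := by
      apply Subtype.ext; rw [← hP j, hj]; simp
    have hi' : i ∈ Finset.univ.filter (fun j => P j ≠ 0) := by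
      simpa using fun h => hi (hcP i h)
    obtain ⟨m, hm, hmin⟩ := Finset.exists_min_image _ (fun j => (P j).natTrailingDegree) ⟨i, hi'⟩
    have hm0 : P m ≠ 0 := (Finset.mem_filter.1 hm).2
    have htm : m.1.val t < 1 := hs m.2
    have ht0 : m.1.val t ≠ 0 := by
      rw [Ne, map_eq_zero]
      rintro rfl
      exact ht (isAlgebraic_zero)
    have hsum : (Finset.univ.erase m).sum (fun j => c j • x j) = - (c m • x m) := by
      have h1 := Finset.add_sum_erase Finset.univ (fun j => c j • x j) (Finset.mem_univ m)
      rw [hc] at h1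
      exact eq_neg_of_add_eq_zero_right h1
    have hv (j : s) : m.1.val (c j • x j) = m.1.val (Polynomial.aeval t (P j)) * m.1.val (x j) := by
      rw [hP, ← map_mul]; rfl
    have hlt : m.1.val ((Finset.univ.erase m).sum (fun j => c j • x j)) <
        m.1.val t ^ (P m).natTrailingDegree := by
      refine m.1.val.map_sum_lt (pow_ne_zero _ ht0) fun j hj => ?_
      rw [hv]
      by_cases hj0 : P j = 0
      · rw [hj0]; simpa using zero_lt_iff.2 (pow_ne_zero _ ht0)
      · rw [val_aeval _ htm hj0]
        calc _ < m.1.val t ^ (P j).natTrailingDegree * 1 :=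
              (mul_lt_mul_iff_right₀ (zero_lt_iff.2 (pow_ne_zero _ ht0))).2
                (hx2' j m (Finset.ne_of_mem_erase hj).symm)
          _ ≤ _ := by
            rw [mul_one]
            exact pow_le_pow_right_of_le_one' htm.le (hmin j (by simpa using hj0))
    rw [hsum, Valuation.map_neg, hv, val_aeval _ htm hm0] at hlt
    exact absurd hlt (not_lt.2 (le_mul_of_one_le_right' (hx1' m).le))
  have hli' : LinearIndependent (IntermediateField.adjoin k {t}) x :=
    (LinearIndependent.iff_fractionRing (Algebra.adjoin k {t}) _).1 hli
  have := hli'.fintype_card_le_finrank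
  simp [hcard] at this

theorem finite_poles [IsFunctionField k F] (f : F) : {p : Place k F | 1 < p.val f}.Finite := by
  by_cases hf : IsAlgebraic k f
  · convert Set.finite_empty
    ext p
    simpa using val_le_one_of_isAlgebraic p hf
  · refine (finite_zeros (t := f⁻¹) fun h => hf (by simpa using h.inv)).subset fun p hp => ?_
    have h0 : p.val f ≠ 0 := (zero_lt_one.trans hp).ne'
    simpa using inv_lt_one_of_one_lt₀ hp

end Finiteness

/-! ### Local fields and adeles -/

namespace Place

/-- The local field `F_p`: the completion of `F` at `p`. -/
def Compl (p : Place k F) : Type v := p.val.Completion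

instance (p : Place k F) : Field p.Compl := inferInstanceAs (Field p.val.Completion)

instance (p : Place k F) : Valued p.Compl ℤᵐ⁰ := inferInstanceAs (Valued p.val.Completion ℤᵐ⁰)

/-- The embedding of `F` into `F_p`. -/
def embed (p : Place k F) : F →+* p.Compl :=
  (UniformSpace.Completion.coeRingHom : WithVal p.val →+* p.val.Completion).comp
    (WithVal.equiv p.val).symm.toRingHom

instance (p : Place k F) : Algebra F p.Compl := p.embed.toAlgebra

theorem valued_algebraMap (p : Place k F) (f : F) :
    Valued.v (algebraMap F p.Compl f) = p.val f :=
  Valued.valuedCompletion_apply (WithVal.toVal p.val f)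

/-- The ring of integers `O_p` of the local field `F_p`. -/
def integers (p : Place k F) : Subring p.Compl := (Valued.v (R := p.Compl)).integer

theorem mem_integers {p : Place k F} {x : p.Compl} : x ∈ p.integers ↔ Valued.v x ≤ 1 := Iff.rfl

/-- The normalized order function of the local field `F_p` (with junk value `0` at `0`). -/
def ord (p : Place k F) (x : p.Compl) : ℤ := -WithZero.log (Valued.v x)

/-- The local ring of the curve at `p`, a subring of `F`. -/
abbrev localRing (p : Place k F) : Subring F := p.val.integer

/-- The functions regular at `p`, as a `k`-vector space. -/
def regular (p : Place k F) : Submodule k F where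
  carrier := {f | p.val f ≤ 1}
  zero_mem' := by simp
  add_mem' {a b} ha hb := (p.val.map_add a b).trans (max_le ha hb)
  smul_mem' c a ha := by
    rw [Set.mem_ofPred_eq, Algebra.smul_def, map_mul]
    exact mul_le_one' (p.val_const_le c) ha

/-- The functions vanishing at `p`, as a `k`-vector space. -/
def vanishing (p : Place k F) : Submodule k F where
  carrier := {f | p.val f < 1}
  zero_mem' := by simp
  add_mem' {a b} ha hb := (p.val.map_add a b).trans_lt (max_lt ha hb)
  smul_mem' c a ha := by
    rw [Set.mem_ofPred_eq, Algebra.smul_def, map_mul]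
    exact (mul_le_of_le_one_left' (p.val_const_le c)).trans_lt ha

/-- The degree of `p`: the dimension over `k` of the residue field at `p`. -/
def degree (p : Place k F) : ℕ :=
  Module.finrank k (p.regular ⧸ p.vanishing.comap p.regular.subtype)

/-- `f` is regular at `p` with value `f(p) = c ∈ k`. -/
def HasValue (p : Place k F) (f : F) (c : k) : Prop := p.val (f - algebraMap k F c) < 1

/-- A local parameter `π_p`. -/
def unif (p : Place k F) : F := (p.surjective (WithZero.exp (-1))).choose

theorem val_unif (p : Place k F) : p.val p.unif = WithZero.exp (-1) :=
  (p.surjective (WithZero.exp (-1))).choose_spec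

/-- The local parameter `π_p` as an element of the local field `F_p`. -/
def pi (p : Place k F) : p.Compl := algebraMap F p.Compl p.unif

theorem pi_ne_zero (p : Place k F) : p.pi ≠ 0 := by
  rw [pi, Ne, map_eq_zero]
  intro h
  have := p.val_unif
  rw [h, map_zero] at this
  exact WithZero.exp_ne_zero this.symm

end Place

variable (k F) in
/-- The adele ring `𝔸` of `F`: the restricted product of the local fields `F_p` with respect to
their rings of integers. -/
def Adele : Type v := RestrictedProduct (fun p : Place k F => p.Compl)
  (fun p : Place k F => (p.integers : Set p.Compl)) Filter.cofinite

namespace Adele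

instance : CommRing (Adele k F) := inferInstanceAs (CommRing
  (RestrictedProduct (fun p : Place k F => p.Compl)
    (fun p : Place k F => (p.integers : Set p.Compl)) Filter.cofinite))

instance : DFunLike (Adele k F) (Place k F) (fun p => p.Compl) where
  coe a := a.1
  coe_injective _ _ := Subtype.ext

@[ext]
theorem ext {a b : Adele k F} (h : ∀ p, a p = b p) : a = b := Subtype.ext (funext h)

/-- The `p`-component of an adele. -/
def eval (p : Place k F) : Adele k F →+* p.Compl where
  toFun a := a p
  map_one' := rfl
  map_mul' _ _ := rfl
  map_zero' := rfl
  map_add' _ _ := rfl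

/-- The adele with `p`-component `x` and all other components `0`. -/
def single (p : Place k F) (x : p.Compl) : Adele k F :=
  letI := Classical.decEq (Place k F)
  RestrictedProduct.single (fun p : Place k F => p.integers) p x

theorem single_apply_same (p : Place k F) (x : p.Compl) : single p x p = x := by
  let _ := Classical.decEq (Place k F)
  exact RestrictedProduct.single_eq_same (fun p : Place k F => p.integers) p x

theorem single_apply_ne {p q : Place k F} (h : q ≠ p) (x : p.Compl) : single p x q = 0 := by
  let _ := Classical.decEq (Place k F)
  exact RestrictedProduct.single_eq_of_ne (fun p : Place k F => p.integers) x h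

variable [IsFunctionField k F]

/-- The diagonal embedding `F → 𝔸`. -/
def diag : F →+* Adele k F where
  toFun f := ⟨fun p => algebraMap F p.Compl f, by
    refine (finite_poles (k := k) f).subset fun p hp => ?_
    simpa [Place.mem_integers, Place.valued_algebraMap] using hp⟩
  map_one' := by ext p; exact map_one (algebraMap F p.Compl)
  map_mul' x y := by ext p; exact map_mul (algebraMap F p.Compl) x y
  map_zero' := by ext p; exact map_zero (algebraMap F p.Compl)
  map_add' x y := by ext p; exact map_add (algebraMap F p.Compl) x y

instance : Algebra F (Adele k F) := diag.toAlgebra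

instance : Algebra k (Adele k F) := (diag.comp (algebraMap k F)).toAlgebra

instance : IsScalarTower k F (Adele k F) := IsScalarTower.of_algebraMap_eq fun _ => rfl

theorem algebraMap_apply (f : F) (p : Place k F) :
    algebraMap F (Adele k F) f p = algebraMap F p.Compl f := rfl

theorem smul_apply (c : k) (a : Adele k F) (p : Place k F) :
    (c • a) p = algebraMap F p.Compl (algebraMap k F c) * a p := by
  rw [Algebra.smul_def]; rfl

variable (k F) in
/-- The ring `𝒪 ⊆ 𝔸` of integral adeles, as a `k`-vector space. -/
def integral : Submodule k (Adele k F) where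
  carrier := {a | ∀ p, a p ∈ p.integers}
  zero_mem' p := p.integers.zero_mem
  add_mem' ha hb p := p.integers.add_mem (ha p) (hb p)
  smul_mem' c a ha p := by
    rw [smul_apply]
    refine p.integers.mul_mem ?_ (ha p)
    rw [Place.mem_integers, Place.valued_algebraMap]
    exact p.val_const_le c

end Adele

/-! ### Divisors -/

variable (k F) in
/-- Divisors on the curve. -/
abbrev Divisor : Type v := Place k F →₀ ℤ

/-- The degree of a divisor. -/
def Divisor.degree (E : Divisor k F) : ℤ := E.sum fun p m => m * p.degree

/-- The characterizing idele `ι_E = (π_p ^ ord_p(E))_p` of a divisor `E`. -/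
def Divisor.idele (E : Divisor k F) : (Adele k F)ˣ where
  val := ⟨fun p => p.pi ^ E p, by
    refine E.hasFiniteSupport.subset fun p hp => ?_
    contrapose! hp
    rw [Function.notMem_support] at hp
    simp [hp, p.integers.one_mem]⟩
  inv := ⟨fun p => p.pi ^ (-E p), by
    refine E.hasFiniteSupport.subset fun p hp => ?_
    contrapose! hp
    rw [Function.notMem_support] at hp
    simp [hp, p.integers.one_mem]⟩
  val_inv := by
    ext p
    exact (zpow_add₀ p.pi_ne_zero _ _).symm.trans (by rw [add_neg_cancel, zpow_zero]; rfl)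
  inv_val := by
    ext p
    exact (zpow_add₀ p.pi_ne_zero _ _).symm.trans (by rw [neg_add_cancel, zpow_zero]; rfl)

/-! ### Adelic cohomology -/

section Cohomology

variable {r : ℕ}

/-- The component `g_p ∈ GL_r(F_p)` of `g ∈ GL_r(𝔸)`. -/
def component (g : GL (Fin r) (Adele k F)) (p : Place k F) : GL (Fin r) p.Compl :=
  Matrix.GeneralLinearGroup.map (Adele.eval p) g

/-- `deg(g) = deg(det g) = ∑_p ord_p(det g_p) deg(p)`. -/
def degree (g : GL (Fin r) (Adele k F)) : ℤ :=
  ∑ᶠ p : Place k F, p.ord (component g p).val.det * p.degree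

/-- `g(-E) = ι_E⁻¹ g`. -/
def twistNeg (g : GL (Fin r) (Adele k F)) (E : Divisor k F) : GL (Fin r) (Adele k F) :=
  Matrix.GeneralLinearGroup.scalar (Fin r) E.idele⁻¹ * g

variable [IsFunctionField k F]

variable (k F r) in
/-- The diagonal embedding `F^r → 𝔸^r`. -/
def diagonal : (Fin r → F) →ₗ[k] (Fin r → Adele k F) :=
  (IsScalarTower.toAlgHom k F (Adele k F)).toLinearMap.compLeft (Fin r)

/-- `𝔸^r(g) = {a ∈ 𝔸^r | g a ∈ 𝒪^r}`. -/
def adelicSpace (g : GL (Fin r) (Adele k F)) : Submodule k (Fin r → Adele k F) where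
  carrier := {a | ∀ j, g.val.mulVec a j ∈ Adele.integral k F}
  zero_mem' j := by
    rw [Matrix.mulVec_zero]; exact (Adele.integral k F).zero_mem
  add_mem' {a b} ha hb j := by
    rw [Matrix.mulVec_add]; exact (Adele.integral k F).add_mem (ha j) (hb j)
  smul_mem' c a ha j := by
    rw [Matrix.mulVec_smul]; exact (Adele.integral k F).smul_mem c (ha j)

/-- `H⁰(F, g) = 𝔸^r(g) ∩ F^r`, as a subspace of `F^r`. -/
def H0 (g : GL (Fin r) (Adele k F)) : Submodule k (Fin r → F) :=
  (adelicSpace g).comap (diagonal k F r)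

/-- `H¹(F, g) = 𝔸^r / (𝔸^r(g) + F^r)`. -/
abbrev H1 (g : GL (Fin r) (Adele k F)) : Type v :=
  (Fin r → Adele k F) ⧸ (adelicSpace g ⊔ LinearMap.range (diagonal k F r))

/-- `h⁰(F, g) = dim_k H⁰(F, g)`. -/
def h0 (g : GL (Fin r) (Adele k F)) : ℕ := Module.finrank k (H0 g)

/-- `h¹(F, g) = dim_k H¹(F, g)`. -/
def h1 (g : GL (Fin r) (Adele k F)) : ℕ := Module.finrank k (H1 g)

variable (k F) in
/-- The (arithmetic) genus `1 - χ(X, 𝒪_X) = 1 - h⁰(F, 1) + h¹(F, 1)` of the curve; this is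
`h¹(F, 1) = dim_k H¹(X, 𝒪_X)` as soon as `k` is the full constant field of `F`. -/
def genus : ℤ := 1 - h0 (1 : GL (Fin 1) (Adele k F)) + h1 (1 : GL (Fin 1) (Adele k F))

end Cohomology

/-! ### Locally free sheaves and stability

An `𝒪_X`-submodule of the constant sheaf `F^m` is given by its stalks at the closed points, a
family of submodules `M p` of `F^m` over the local rings; its sections over an open set `U` are
`⋂ p ∈ U, M p`. The nonempty open subsets of `X` are the complements of finite sets of closed
points. -/

section Sheaf

variable {m : ℕ}

variable (k F m) in
/-- A family of stalks in the constant sheaf `F^m`. -/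
abbrev Stalks : Type v := ∀ p : Place k F, Submodule p.localRing (Fin m → F)

/-- The sheaf `M` is locally free of rank `s`. -/
def IsLocallyFree (s : ℕ) (M : Stalks k F m) : Prop :=
  ∀ p, ∃ U : Set (Place k F), p ∈ U ∧ Uᶜ.Finite ∧ ∃ b : Fin s → Fin m → F,
    LinearIndependent F b ∧ ∀ q ∈ U, M q = Submodule.span q.localRing (Set.range b)

/-- The locally free sheaf `M` of rank `s` has degree `d`, i.e. `d` is the degree of the divisor of
a nonzero rational section `b_1 ∧ ⋯ ∧ b_s` of the line bundle `det M`: at each `p`, if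
`e_1, …, e_s` is a basis of the stalk at `p` and `b = A e`, then the order of this section at `p`
is `ord_p (det A)`. -/
def HasDegree (s : ℕ) (M : Stalks k F m) (d : ℤ) : Prop :=
  ∃ (b : Fin s → Fin m → F) (e : Place k F → Fin s → Fin m → F)
    (A : Place k F → Matrix (Fin s) (Fin s) F),
    LinearIndependent F b ∧
    (∀ p, LinearIndependent F (e p) ∧ M p = Submodule.span p.localRing (Set.range (e p))) ∧
    (∀ p i, b i = ∑ j, A p i j • e p j) ∧
    d = ∑ᶠ p : Place k F, p.ord (algebraMap F p.Compl (A p).det) * p.degree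

/-- Mumford semi-stability of a locally free sheaf `E` of rank `r`: `μ(M) ≤ μ(E)` for all proper
nonzero coherent (hence locally free) subsheaves `M`. -/
def IsSemistableSheaf (r : ℕ) (E : Stalks k F m) : Prop :=
  ∀ (s : ℕ) (M : Stalks k F m), 0 < s → IsLocallyFree s M → M ≤ E → M ≠ E →
    ∀ d d' : ℤ, HasDegree s M d → HasDegree r E d' → (d : ℚ) / s ≤ (d' : ℚ) / r

variable {r : ℕ}

/-- The locally free sheaf `𝓔(g)` with stalks `F^r ∩ g_p⁻¹(O_p^r)`. -/
def sheaf (g : GL (Fin r) (Adele k F)) : Stalks k F r := fun p =>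
  { carrier := {f | ∀ j, (component g p).val.mulVec (fun i => algebraMap F p.Compl (f i)) j ∈
      p.integers}
    zero_mem' := fun j => by
      have : (fun i => algebraMap F p.Compl ((0 : Fin r → F) i)) = 0 := by ext; simp
      rw [this, Matrix.mulVec_zero]; exact p.integers.zero_mem
    add_mem' := fun {a b} ha hb j => by
      have : (fun i => algebraMap F p.Compl ((a + b) i)) =
        (fun i => algebraMap F p.Compl (a i)) + (fun i => algebraMap F p.Compl (b i)) := by
        ext; simp
      rw [this, Matrix.mulVec_add]; exact p.integers.add_mem (ha j) (hb j)
    smul_mem' := fun c a ha j => by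
      have : (fun i => algebraMap F p.Compl ((c • a) i)) =
        algebraMap F p.Compl (c : F) • (fun i => algebraMap F p.Compl (a i)) := by
        ext i
        exact map_mul (algebraMap F p.Compl) (c : F) (a i)
      rw [this, Matrix.mulVec_smul]
      refine p.integers.mul_mem ?_ (ha j)
      rw [Place.mem_integers, Place.valued_algebraMap]
      exact c.2 }

/-- `g ∈ GL_r(𝔸)` is semi-stable if its associated locally free sheaf `𝓔(g)` is. -/
def IsSemistable (g : GL (Fin r) (Adele k F)) : Prop := IsSemistableSheaf r (sheaf g)

end Sheaf

/-! ### Differentials -/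

section Differentials

variable [IsFunctionField k F]

variable (k F) in
/-- The space `Ω_F` of rational differentials, realized as Weil differentials: the `k`-linear maps
`ω : 𝔸 → k` which vanish on `F` and on `𝔸(E) = {a | ord_p(a_p) + ord_p(E) ≥ 0 for all p}` for some
divisor `E`. -/
def Differentials : Submodule k (Module.Dual k (Adele k F)) where
  carrier := {ω | (∀ f : F, ω (algebraMap F (Adele k F) f) = 0) ∧
    ∃ E : Divisor k F, ∀ a : Adele k F, (∀ p, Valued.v (a p) ≤ WithZero.exp (E p)) → ω a = 0}
  zero_mem' := ⟨fun _ => rfl, 0, fun _ _ => rfl⟩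
  add_mem' := by
    rintro ω η ⟨h1, E, hE⟩ ⟨h2, E', hE'⟩
    refine ⟨fun f => by simp [h1, h2], E ⊓ E', fun a ha => ?_⟩
    rw [LinearMap.add_apply, hE a fun p => (ha p).trans (WithZero.exp_le_exp.2 inf_le_left),
      hE' a fun p => (ha p).trans (WithZero.exp_le_exp.2 inf_le_right), add_zero]
  smul_mem' := by
    rintro c ω ⟨h1, E, hE⟩
    exact ⟨fun f => by simp [h1], E, fun a ha => by simp [hE a ha]⟩

/-- The product `f ω` of a function and a differential: `(f ω)(a) = ω(f a)`. -/
def fmul (f : F) (ω : Module.Dual k (Adele k F)) : Module.Dual k (Adele k F) :=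
  ω ∘ₗ LinearMap.mulLeft k (algebraMap F (Adele k F) f)

/-- The local component `ω_p : F_p → k` of `ω`. -/
def localComponent (ω : Module.Dual k (Adele k F)) (p : Place k F) (x : p.Compl) : k :=
  ω (Adele.single p x)

/-- The order `ord_p(ω)` of a nonzero differential `ω`: the largest integer `m` such that `ω_p`
vanishes on all `x ∈ F_p` with `ord_p(x) ≥ -m`. -/
def ordDifferential (ω : Module.Dual k (Adele k F)) (p : Place k F) : ℤ :=
  sSup {m : ℤ | ∀ x : p.Compl, Valued.v x ≤ WithZero.exp m → localComponent ω p x = 0}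

end Differentials

/-! ### The codes -/

section Codes

variable {n r : ℕ}

/-- The divisor `D = p_1 + ⋯ + p_n`. -/
def pointDivisor (P : Fin n → Place k F) : Divisor k F := ∑ i, Finsupp.single (P i) 1

/-- `A ∈ GL_r(F_p)` has multiple orders `n_1 ≤ ⋯ ≤ n_r` at `p`: there are `M, N ∈ GL_r(O_p)` with
`M A N = diag(π_p^{n_1}, …, π_p^{n_r})`. -/
def HasMultipleOrders (p : Place k F) (A : GL (Fin r) p.Compl) (ν : Fin r → ℤ) : Prop :=
  Monotone ν ∧ ∃ M N : GL (Fin r) p.integers,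
    M.val.map p.integers.subtype * A.val * N.val.map p.integers.subtype =
      Matrix.diagonal fun j => p.pi ^ ν j

/-- `g` is `D`-balanced, where `D = p_1 + ⋯ + p_n`: all its multiple orders at the `p_i` are `0`. -/
def IsBalanced (P : Fin n → Place k F) (g : GL (Fin r) (Adele k F)) : Prop :=
  ∀ i, HasMultipleOrders (P i) (component g (P i)) 0

/-- The code `C_{F,r}(D, g)` of all words `((f_j(p_1))_j, …, (f_j(p_n))_j)` with
`f ∈ H⁰(F, g)`. -/
def codeF [IsFunctionField k F] (P : Fin n → Place k F) (g : GL (Fin r) (Adele k F)) :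
    Submodule k (Fin n → Fin r → k) where
  carrier := {c | ∃ f ∈ H0 g, ∀ i j, (P i).HasValue (f j) (c i j)}
  zero_mem' := ⟨0, (H0 g).zero_mem, fun i j => by simp [Place.HasValue]⟩
  add_mem' := by
    rintro c c' ⟨f, hf, h⟩ ⟨f', hf', h'⟩
    refine ⟨f + f', (H0 g).add_mem hf hf', fun i j => ?_⟩
    have : (f + f') j - algebraMap k F ((c + c') i j) =
        (f j - algebraMap k F (c i j)) + (f' j - algebraMap k F (c' i j)) := by
      simp only [Pi.add_apply, map_add]; ring
    rw [Place.HasValue, this]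
    exact (P i).vanishing.add_mem (h i j) (h' i j)
  smul_mem' := by
    rintro a c ⟨f, hf, h⟩
    refine ⟨a • f, (H0 g).smul_mem a hf, fun i j => ?_⟩
    have : (a • f) j - algebraMap k F ((a • c) i j) = a • (f j - algebraMap k F (c i j)) := by
      simp only [Pi.smul_apply, smul_eq_mul, map_mul, Algebra.smul_def]; ring
    rw [Place.HasValue, this]
    exact (P i).vanishing.smul_mem a (h i j)

variable [IsFunctionField k F]

/-- `ω₀` is a `D`-special differential. -/
def IsSpecial (P : Fin n → Place k F) (ω₀ : Module.Dual k (Adele k F)) : Prop :=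
  ω₀ ∈ Differentials k F ∧ ω₀ ≠ 0 ∧
    ∀ i, ordDifferential ω₀ (P i) = -1 ∧ localComponent ω₀ (P i) 1 = 1

/-- The space `Ω_F^r(g)` of the rational differentials `ω₀ (f_j)_j` with
`ι_{(ω₀)} (f_j)_j ∈ ᵗg 𝒪^r`. For `g(-D) = ι_D⁻¹ g` the condition reads
`ι_{(ω₀) + D} (f_j)_j ∈ ᵗg 𝒪^r`. -/
def differentialSpace (ω₀ : Module.Dual k (Adele k F)) (g : GL (Fin r) (Adele k F)) :
    Submodule k (Fin r → Module.Dual k (Adele k F)) where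
  carrier := {ω | (∀ j, ω j ∈ Differentials k F) ∧ ∃ f : Fin r → F, (∀ j, ω j = fmul (f j) ω₀) ∧
    ∀ p : Place k F, ∃ y : Fin r → p.Compl, (∀ j, y j ∈ p.integers) ∧
      ∀ j, p.pi ^ ordDifferential ω₀ p * algebraMap F p.Compl (f j) =
        (component g p).val.transpose.mulVec y j}
  zero_mem' := by
    refine ⟨fun j => (Differentials k F).zero_mem, 0, fun j => ?_, fun p => ⟨0, ?_, ?_⟩⟩
    · ext a; simp [fmul]
    · exact fun j => p.integers.zero_mem
    · intro j; rw [Matrix.mulVec_zero]; simp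
  add_mem' := by
    rintro ω η ⟨h1, f, h2, h3⟩ ⟨h1', f', h2', h3'⟩
    refine ⟨fun j => (Differentials k F).add_mem (h1 j) (h1' j), f + f', fun j => ?_, fun p => ?_⟩
    · ext a; simp [fmul, h2, h2', add_mul]
    · obtain ⟨y, hy, hfy⟩ := h3 p
      obtain ⟨y', hy', hfy'⟩ := h3' p
      refine ⟨y + y', fun j => p.integers.add_mem (hy j) (hy' j), fun j => ?_⟩
      rw [Matrix.mulVec_add, Pi.add_apply, Pi.add_apply, map_add, mul_add, hfy, hfy']
  smul_mem' := by
    rintro c ω ⟨h1, f, h2, h3⟩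
    refine ⟨fun j => (Differentials k F).smul_mem c (h1 j), c • f, fun j => ?_, fun p => ?_⟩
    · ext a
      have : algebraMap F (Adele k F) (c • f j) = c • algebraMap F (Adele k F) (f j) :=
        map_smul (IsScalarTower.toAlgHom k F (Adele k F)) c (f j)
      simp [fmul, h2, this]
    · obtain ⟨y, hy, hfy⟩ := h3 p
      refine ⟨algebraMap F p.Compl (algebraMap k F c) • y, fun j => ?_, fun j => ?_⟩
      · refine p.integers.mul_mem ?_ (hy j)
        rw [Place.mem_integers, Place.valued_algebraMap]
        exact p.val_const_le c
      · rw [Matrix.mulVec_smul, Pi.smul_apply, Pi.smul_apply, Algebra.smul_def, map_mul, ← hfy,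
          smul_eq_mul]
        ring

/-- The differential code `C_{Ω,r}(D, g)` of all words `((ω_{j,p_1}(1))_j, …, (ω_{j,p_n}(1))_j)`
with `ω ∈ Ω_F^r(g(-D))`. -/
def codeΩ (P : Fin n → Place k F) (ω₀ : Module.Dual k (Adele k F))
    (g : GL (Fin r) (Adele k F)) : Submodule k (Fin n → Fin r → k) :=
  (differentialSpace ω₀ (twistNeg g (pointDivisor P))).map
    (LinearMap.pi fun i => LinearMap.pi fun j =>
      (LinearMap.applyₗ (Adele.single (P i) 1)).comp (LinearMap.proj j))

end Codes

end AdelicCode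

end

open AdelicCode

/-! Write Ω(g) for the differentials attached to g and g(-D) for the twist. Evaluation at the points
p_i maps H⁰(g) onto the first code; since g is balanced, a section vanishing at every p_i is a
section of g(-D), so the kernel is H⁰(g(-D)). Taking local components at the p_i maps Ω(g(-D)) onto
the second code with kernel Ω(g). Both maps are injective once these kernels vanish
(`finrank_codeF`, `finrank_codeΩ`).

Semi-stability kills the kernels. A nonzero f in H⁰(g(-D)) spans a line subsheaf of 𝓔(g) of degree
deg D, which is too large if deg g < r deg D (`IsSemistable.H0_twistNeg_eq_bot`). A nonzero element
of Ω(g) is a nonzero map from 𝓔(g) to the line bundle O(W), with W canonical of degree 2(γ-1). Its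
kernel has rank r-1 and degree at least deg g - 2(γ-1), which is too large if deg g > 2r(γ-1)
(`IsSemistable.differentialSpace_eq_bot`).

Dimensions come from Serre duality, dim Ω(g) = h¹(g) (`finrank_differentialSpace`), and
Riemann-Roch, h⁰(g) - h¹(g) = deg g - r(γ-1) (`h0_sub_h1`), used for g and for g(-D). Dropping the
nonnegative terms h¹(g) and h⁰(g(-D)) gives the two bounds; in the range where both vanish the
bounds are equalities.

Riemann-Roch is proved adelically. The inequality dim M/tM ≤ [F : k(t)] for k[t]-submodules M of F
(`relDim_mulLeft_le`) yields finite residue fields, places from valuation rings, and the upper bound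
for the degree of a pole divisor; counting the products t^j b_i gives the lower bound, and hence the
product formula and Riemann's inequality. Enlarging a divisor changes ℓ - h¹ by exactly the change
of degree, because it changes the adelic box by that many dimensions. In rank r, Smith normal form
turns 𝔸^r(g) into a product of such boxes up to an integral change of coordinates
(`exists_adelicSpace_eq`). -/

open scoped WithZero

/-! ### Relative dimension of subspaces -/

section RelDim

variable {k V V' : Type*} [Field k] [AddCommGroup V] [Module k V] [AddCommGroup V'] [Module k V']

/-- The dimension of `B / (A ∩ B)`. -/
noncomputable def Submodule.relDim (A B : Submodule k V) : ℕ∞ := Module.length k (B.map A.mkQ)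

namespace Submodule

/-- Both sides are quotients of B by one kernel: membership in A is detected by f, and the images of
B and D modulo C agree. Later comparisons of quotients (local and global, scalar and vector) reduce
to this criterion. -/
theorem relDim_eq_of_map {A B : Submodule k V} {C D : Submodule k V'} (f : V →ₗ[k] V')
    (h : ∀ x ∈ B, x ∈ A ↔ f x ∈ C) (h1 : D ≤ B.map f ⊔ C) (h2 : B.map f ≤ D ⊔ C) :
    relDim A B = relDim C D := by
  have hr1 : LinearMap.range (A.mkQ ∘ₗ B.subtype) = B.map A.mkQ := by
    rw [LinearMap.range_comp, range_subtype]
  have hr2 : LinearMap.range ((C.mkQ ∘ₗ f) ∘ₗ B.subtype) = D.map C.mkQ := by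
    rw [LinearMap.range_comp, range_subtype, map_comp]
    apply le_antisymm
    · refine (map_mono h2).trans ?_
      rw [map_sup, C.mkQ_map_self, sup_bot_eq]
    · refine (map_mono h1).trans ?_
      rw [map_sup, C.mkQ_map_self, sup_bot_eq]
  have hk : LinearMap.ker (A.mkQ ∘ₗ B.subtype) = LinearMap.ker ((C.mkQ ∘ₗ f) ∘ₗ B.subtype) := by
    ext x
    simpa using h x x.2
  rw [relDim, relDim, ← hr1, ← hr2, ← (LinearMap.quotKerEquivRange _).length_eq,
    ← (LinearMap.quotKerEquivRange _).length_eq, hk]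

theorem relDim_sup_left (A B : Submodule k V) : relDim A (A ⊔ B) = relDim A B :=
  relDim_eq_of_map LinearMap.id (by simp) (by simp)
    (by simp)

theorem relDim_inf_left (A B : Submodule k V) : relDim (A ⊓ B) B = relDim A B :=
  relDim_eq_of_map LinearMap.id (by simp +contextual) (by simp) (by simp)

theorem relDim_map_equiv (e : V ≃ₗ[k] V') (A B : Submodule k V) :
    relDim (A.map e.toLinearMap) (B.map e.toLinearMap) = relDim A B := by
  refine (relDim_eq_of_map e.toLinearMap (fun x _ => ?_) le_sup_left le_sup_left).symm
  simp

theorem relDim_bot (A : Submodule k V) : relDim ⊥ A = Module.length k A :=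
  (((quotEquivOfEqBot (⊥ : Submodule k V) rfl).symm.submoduleMap A).length_eq).symm

theorem relDim_top (A : Submodule k V) : relDim A ⊤ = Module.length k (V ⧸ A) := by
  rw [relDim, map_top, range_mkQ, Module.length_top]

theorem relDim_of_le {A B : Submodule k V} (h : B ≤ A) : relDim A B = 0 := by
  rw [relDim,
    (map_le_iff_le_comap (p := B) (q := ⊥) (f := A.mkQ)).2 (by simpa using h) |> le_bot_iff.1]
  exact Module.length_bot

theorem le_of_relDim_eq_zero {A B : Submodule k V} (h : relDim A B = 0) : B ≤ A := by
  rw [relDim, Module.length_eq_zero_iff, subsingleton_iff_eq_bot, ← le_bot_iff,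
    map_le_iff_le_comap] at h
  simpa using h

/-- Additivity of length along 0 → B/A → C/A → C/B → 0. With lengths in ℕ∞, no finiteness has to be
known in advance. -/
theorem relDim_add {A B C : Submodule k V} (hAB : A ≤ B) (hBC : B ≤ C) :
    relDim A C = relDim A B + relDim B C := by
  let g : C.map A.mkQ →ₗ[k] C.map B.mkQ := (A.mapQ B LinearMap.id (by simpa)).restrict (by
    rintro _ ⟨x, hx, rfl⟩
    exact ⟨x, hx, rfl⟩)
  refine Module.length_eq_add_of_exact (inclusion (map_mono (f := A.mkQ) hBC)) g
    (inclusion_injective _) ?_ ?_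
  · rintro ⟨_, x, hx, rfl⟩
    exact ⟨⟨_, x, hx, rfl⟩, rfl⟩
  · rintro ⟨_, x, hx, rfl⟩
    have h1 : g ⟨A.mkQ x, x, hx, rfl⟩ = 0 ↔ x ∈ B := by
      rw [← Subtype.coe_inj]
      change B.mkQ x = 0 ↔ _
      simp
    change g ⟨A.mkQ x, x, hx, rfl⟩ = 0 ↔ _
    rw [h1]
    constructor
    · exact fun hB => ⟨⟨_, x, hB, rfl⟩, rfl⟩
    · rintro ⟨⟨_, y, hy, rfl⟩, hxy⟩
      have h2 : A.mkQ y = A.mkQ x := congrArg Subtype.val hxy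
      have h3 : y - x ∈ A := by
        rwa [← sub_eq_zero, ← map_sub, mkQ_apply, Quotient.mk_eq_zero] at h2
      simpa using B.sub_mem hy (hAB h3)

/-- Refine L ≤ L' by the middle term L + (L' ∩ W), which by the modular law is (L + W) ∩ L'. The
lower step is the change of the intersection with W, the upper step the change of the sum with W. -/
theorem relDim_eq_inf_add_sup {L L' : Submodule k V} (h : L ≤ L') (W : Submodule k V) :
    relDim L L' = relDim (L ⊓ W) (L' ⊓ W) + relDim (L ⊔ W) (L' ⊔ W) := by
  have h2 : L' ⊔ W = (L ⊔ W) ⊔ L' := by rw [sup_right_comm, sup_eq_right.2 h]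
  rw [relDim_add (le_sup_left : L ≤ L ⊔ L' ⊓ W) (sup_le h inf_le_left), relDim_sup_left,
    ← relDim_inf_left L, ← inf_assoc, inf_eq_left.2 h, h2, relDim_sup_left,
    ← relDim_inf_left (L ⊔ W), sup_inf_assoc_of_le W h, inf_comm W]

/-- The change of the Euler characteristic `dim (L ∩ W) - dim V / (L + W)` along an inclusion
`L ≤ L'` is `dim L' / L`. -/
theorem length_inf_add_length_quotient {L L' : Submodule k V} (h : L ≤ L') (W : Submodule k V) :
    Module.length k (L' ⊓ W : Submodule k V) + Module.length k (V ⧸ L ⊔ W) =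
      Module.length k (L ⊓ W : Submodule k V) + Module.length k (V ⧸ L' ⊔ W) + relDim L L' := by
  rw [← relDim_bot, ← relDim_bot, ← relDim_top, ← relDim_top, relDim_eq_inf_add_sup h W,
    relDim_add (bot_le : ⊥ ≤ L ⊓ W) (inf_le_inf_right W h),
    relDim_add (sup_le_sup_right h W) (le_top)]
  ring

theorem relDim_pi {ι : Type*} [Fintype ι] {V : ι → Type*} [∀ i, AddCommGroup (V i)]
    [∀ i, Module k (V i)] (A B : ∀ i, Submodule k (V i)) :
    relDim (pi Set.univ A) (pi Set.univ B) = ∑ i, relDim (A i) (B i) := by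
  have h1 : relDim (pi Set.univ A) (pi Set.univ B) =
      relDim (⊥ : Submodule k (∀ i, V i ⧸ A i)) (pi Set.univ fun i => (B i).map (A i).mkQ) := by
    refine relDim_eq_of_map (LinearMap.pi fun i => (A i).mkQ ∘ₗ LinearMap.proj i) ?_ ?_ ?_
    · intro x _
      simp [funext_iff]
    · rw [sup_bot_eq]
      intro y hy
      choose x hx hxy using fun i => hy i trivial
      exact ⟨x, fun i _ => hx i, funext hxy⟩
    · rw [sup_bot_eq]
      rintro _ ⟨x, hx, rfl⟩ i -
      exact ⟨x i, hx i trivial, rfl⟩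
  rw [h1, relDim_bot]
  have e : (pi Set.univ fun i => (B i).map (A i).mkQ) ≃ₗ[k] ∀ i, (B i).map (A i).mkQ :=
    { toFun := fun x i => ⟨x.1 i, x.2 i trivial⟩
      invFun := fun x => ⟨fun i => x i, fun i _ => (x i).2⟩
      map_add' := fun _ _ => rfl
      map_smul' := fun _ _ => rfl
      left_inv := fun _ => rfl
      right_inv := fun _ => rfl }
  rw [e.length_eq, Module.length_pi_of_fintype]
  rfl

end Submodule

theorem Module.finite_of_length_ne_top (h : Module.length k V ≠ ⊤) : Module.Finite k V := by
  rw [Module.length_ne_top_iff, isFiniteLength_iff_isNoetherian_isArtinian] at h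
  have := h.1
  infer_instance

end RelDim

noncomputable section

namespace AdelicCode

universe u v

variable {k : Type u} {F : Type v} [Field k] [Field F] [Algebra k F]

/-! ### The local filtration at a place -/

theorem lt_exp_add_one_iff {x : ℤᵐ⁰} {m : ℤ} : x < WithZero.exp (m + 1) ↔ x ≤ WithZero.exp m := by
  by_cases hx : x = 0
  · simp [hx]
  · rw [← WithZero.exp_log hx, WithZero.exp_le_exp, WithZero.exp_lt_exp]
    omega

theorem lt_one_iff_le_exp {x : ℤᵐ⁰} : x < 1 ↔ x ≤ WithZero.exp (-1) := by
  rw [← lt_exp_add_one_iff]; simp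

theorem exists_le_exp (x : ℤᵐ⁰) : ∃ m : ℤ, x ≤ WithZero.exp m := by
  by_cases hx : x = 0
  · exact ⟨0, by simp [hx]⟩
  · exact ⟨_, (WithZero.exp_log hx).ge⟩

namespace Place

theorem exists_val_eq (p : Place k F) (m : ℤ) : ∃ a : F, a ≠ 0 ∧ p.val a = WithZero.exp m := by
  obtain ⟨a, ha⟩ := p.surjective (WithZero.exp m)
  refine ⟨a, ?_, ha⟩
  rintro rfl
  rw [map_zero] at ha
  exact WithZero.exp_ne_zero ha.symm

/-- The functions `f` with `ord_p f ≥ -m`. -/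
def ball (p : Place k F) (m : ℤ) : Submodule k F where
  carrier := {f | p.val f ≤ WithZero.exp m}
  zero_mem' := by simp
  add_mem' {a b} ha hb := (p.val.map_add a b).trans (max_le ha hb)
  smul_mem' c a ha := by
    rw [Set.mem_ofPred_eq, Algebra.smul_def, map_mul]
    exact (mul_le_of_le_one_left' (p.val_const_le c)).trans ha

theorem mem_ball {p : Place k F} {m : ℤ} {f : F} : f ∈ p.ball m ↔ p.val f ≤ WithZero.exp m :=
  Iff.rfl

theorem ball_mono (p : Place k F) {m m' : ℤ} (h : m ≤ m') : p.ball m ≤ p.ball m' :=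
  fun _ hf => le_trans hf (WithZero.exp_le_exp.2 h)

/-- Multiplication by a nonzero function. -/
def mulEquiv (k : Type u) {F : Type v} [Field k] [Field F] [Algebra k F] (a : F) (ha : a ≠ 0) :
    F ≃ₗ[k] F :=
  LinearEquiv.ofBijective (LinearMap.mulLeft k a)
    ⟨mul_right_injective₀ ha, mul_left_surjective₀ ha⟩

theorem ball_map_mul (p : Place k F) {a : F} (ha : a ≠ 0) {e : ℤ} (he : p.val a = WithZero.exp e)
    (m : ℤ) : (p.ball m).map (mulEquiv k a ha).toLinearMap = p.ball (m + e) := by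
  have h0 : (0 : ℤᵐ⁰) < WithZero.exp e := WithZero.exp_pos
  ext x
  constructor
  · rintro ⟨y, hy, rfl⟩
    change p.val (a * y) ≤ _
    rw [map_mul, he, add_comm, WithZero.exp_add]
    exact mul_le_mul_right hy _
  · intro hx
    refine ⟨a⁻¹ * x, ?_, mul_inv_cancel_left₀ ha x⟩
    change p.val (a⁻¹ * x) ≤ _
    rw [map_mul, map_inv₀, he, ← WithZero.exp_neg,
      show m = -e + (m + e) by ring, WithZero.exp_add (-e)]
    exact mul_le_mul_right hx _

/-- Multiplication by a function of valuation `exp e` shifts the filtration, so all graded pieces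
have the dimension of the residue field. -/
theorem relDim_ball_add (p : Place k F) (m m' e : ℤ) :
    Submodule.relDim (p.ball (m + e)) (p.ball (m' + e)) =
      Submodule.relDim (p.ball m) (p.ball m') := by
  obtain ⟨a, ha, he⟩ := p.exists_val_eq e
  rw [← p.ball_map_mul ha he, ← p.ball_map_mul ha he, Submodule.relDim_map_equiv]

theorem relDim_ball_natCast (p : Place k F) (m : ℤ) (j : ℕ) :
    Submodule.relDim (p.ball m) (p.ball (m + j)) =
      j * Submodule.relDim (p.ball (-1)) (p.ball 0) := by
  induction j with
  | zero => simpa using Submodule.relDim_of_le le_rfl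
  | succ j ih =>
    rw [Submodule.relDim_add (p.ball_mono (show m ≤ m + j by omega))
      (p.ball_mono (show m + j ≤ m + (j + 1 : ℕ) by push_cast; omega)), ih]
    have := p.relDim_ball_add (-1) 0 (m + j + 1)
    rw [show -1 + (m + j + 1 : ℤ) = m + j by ring,
      show 0 + (m + j + 1 : ℤ) = m + (j + 1 : ℕ) by push_cast; ring] at this
    rw [this]
    push_cast
    ring

theorem length_residueField (p : Place k F) :
    Module.length k (p.regular ⧸ p.vanishing.comap p.regular.subtype) =
      Submodule.relDim (p.ball (-1)) (p.ball 0) := by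
  rw [← Submodule.relDim_top]
  refine Submodule.relDim_eq_of_map p.regular.subtype (fun x _ => ?_) ?_ ?_
  · change p.val x < 1 ↔ p.val x ≤ _
    rw [lt_one_iff_le_exp]
  · rw [Submodule.map_top, Submodule.range_subtype]
    refine le_sup_of_le_left fun x hx => ?_
    rw [mem_ball, WithZero.exp_zero] at hx
    exact hx
  · rw [Submodule.map_top, Submodule.range_subtype]
    refine le_sup_of_le_left fun x hx => ?_
    rw [mem_ball, WithZero.exp_zero]
    exact hx

end Place

/-! ### The fundamental inequality -/

/-- Reducing a k[t]-relation modulo tM leaves only constant coefficients, which vanish by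
independence. The rest is divisible by t; divide and repeat. Treating one coefficient index at a
time lets the induction run through `divX`. -/
theorem eq_zero_of_sum_aeval_mul_eq_zero {t : F} (ht : t ≠ 0) {M : Submodule k F}
    (hM : ∀ x ∈ M, t * x ∈ M) {ι : Type*} [Fintype ι] {y : ι → F} (hy : ∀ i, y i ∈ M)
    (hind : LinearIndependent k
      fun i => (M.map (LinearMap.mulLeft k t)).mkQ (y i)) (m : ℕ) (P : ι → Polynomial k)
    (h : ∑ i, Polynomial.aeval t (P i) * y i = 0) (i : ι) : (P i).coeff m = 0 := by
  have hpoly (Q : Polynomial k) {x : F} (hx : x ∈ M) : Polynomial.aeval t Q * x ∈ M := by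
    induction Q using Polynomial.induction_on' with
    | add p q hp hq => rw [map_add, add_mul]; exact M.add_mem hp hq
    | monomial n a =>
      rw [Polynomial.aeval_monomial, mul_assoc, ← Algebra.smul_def]
      refine M.smul_mem _ ?_
      induction n with
      | zero => simpa
      | succ n ih => rw [pow_succ', mul_assoc]; exact hM _ ih
  have hP (Q : Polynomial k) : Polynomial.aeval t Q =
      t * Polynomial.aeval t Q.divX + algebraMap k F (Q.coeff 0) := by
    conv_lhs => rw [← Polynomial.X_mul_divX_add Q]
    rw [map_add, map_mul, Polynomial.aeval_X, Polynomial.aeval_C]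
  have key (P : ι → Polynomial k) (h : ∑ i, Polynomial.aeval t (P i) * y i = 0) :
      (∀ i, (P i).coeff 0 = 0) ∧ ∑ i, Polynomial.aeval t (P i).divX * y i = 0 := by
    have h1 : ∑ i, (P i).coeff 0 • y i = t * -∑ i, Polynomial.aeval t (P i).divX * y i := by
      rw [mul_neg, ← sub_eq_zero, sub_neg_eq_add, ← h, Finset.mul_sum, ← Finset.sum_add_distrib]
      refine Finset.sum_congr rfl fun i _ => ?_
      rw [hP (P i), Algebra.smul_def]
      ring
    have h0 (i : ι) : (P i).coeff 0 = 0 := by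
      refine Fintype.linearIndependent_iff.1 hind (fun i => (P i).coeff 0) ?_ i
      simp_rw [← map_smul]
      rw [← map_sum, h1, Submodule.mkQ_apply, Submodule.Quotient.mk_eq_zero]
      exact ⟨_, M.neg_mem (M.sum_mem fun i _ => hpoly _ (hy i)), rfl⟩
    refine ⟨h0, neg_eq_zero.1 ((mul_eq_zero.1 (h1.symm.trans ?_)).resolve_left ht)⟩
    simp [h0]
  induction m generalizing P with
  | zero => exact (key P h).1 i
  | succ m ih =>
    rw [← Polynomial.coeff_divX]
    exact ih (fun i => (P i).divX) (key P h).2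

-- The fundamental inequality: vectors of M independent modulo tM over k are independent over k[t]
-- in F, hence over k(t). It is applied to rings of functions regular on a finite set of places and
-- to valuation rings.
open scoped IntermediateField.algebraAdjoinAdjoin in
theorem relDim_mulLeft_le [IsFunctionField k F] {t : F} (ht : Transcendental k t)
    {M : Submodule k F} (hM : ∀ x ∈ M, t * x ∈ M) :
    Submodule.relDim (M.map (LinearMap.mulLeft k t)) M ≤
      Module.finrank (IntermediateField.adjoin k {t}) F := by
  have hfin := finite_extension ht
  have ht0 : t ≠ 0 := by rintro rfl; exact ht isAlgebraic_zero
  by_contra! h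
  rw [Submodule.relDim, Module.length_eq_rank] at h
  have h' : ((Module.finrank (IntermediateField.adjoin k {t}) F + 1 : ℕ) : Cardinal) ≤
      Module.rank k (M.map (M.map (LinearMap.mulLeft k t)).mkQ) := by
    rw [← Cardinal.natCast_le_toENat]
    exact_mod_cast Order.add_one_le_of_lt h
  obtain ⟨s, hs, hind⟩ := le_rank_iff_exists_linearIndependent_finset.1 h'
  choose y hy hys using fun i : s => (i : M.map (M.map (LinearMap.mulLeft k t)).mkQ).2
  have hind' : LinearIndependent k fun i => (M.map (LinearMap.mulLeft k t)).mkQ (y i) := by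
    simp_rw [hys]
    exact hind.map' (Submodule.subtype _) (Submodule.ker_subtype _)
  have hli : LinearIndependent (Algebra.adjoin k {t}) y := by
    rw [Fintype.linearIndependent_iff]
    intro c hc i
    have hex (j : s) : ∃ P : Polynomial k, Polynomial.aeval t P = (c j : F) := by
      have h1 : (c j : F) ∈ (Polynomial.aeval t : Polynomial k →ₐ[k] F).range :=
        Algebra.adjoin_singleton_eq_range_aeval k t ▸ (c j).2
      exact h1
    choose P hP using hex
    have hc' : ∑ j, Polynomial.aeval t (P j) * y j = 0 := by
      rw [← hc]
      exact Finset.sum_congr rfl fun j _ => by rw [hP]; rfl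
    have : P i = 0 := Polynomial.ext fun m => by
      rw [Polynomial.coeff_zero]
      exact eq_zero_of_sum_aeval_mul_eq_zero ht0 hM hy hind' m P hc' i
    apply Subtype.ext
    rw [← hP, this]
    simp
  have hli' : LinearIndependent (IntermediateField.adjoin k {t}) y :=
    (LinearIndependent.iff_fractionRing (Algebra.adjoin k {t}) _).1 hli
  have := hli'.fintype_card_le_finrank
  simp [hs] at this

/-- Weak approximation. -/
theorem exists_val_sub_le {ι : Type*} [Finite ι] (P : ι → Place k F) (hP : Function.Injective P)
    (z : ι → F) (m : ι → ℤ) : ∃ f : F, ∀ i, (P i).val (f - z i) ≤ WithZero.exp (m i) := by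
  have := Fintype.ofFinite ι
  have hd := AbsoluteValue.denseRange_algebraMap_pi (v := fun i => (P i).abv)
    (fun i => (P i).abv_isNontrivial) (fun i j hij h => hij (hP (Place.eq_of_abv_isEquiv h)))
  choose a ha0 ha using fun i => (P i).exists_val_eq (m i)
  -- Density is a statement about balls of a single radius in the product, so the finitely many
  -- tolerances are replaced by their minimum.
  obtain ⟨r, hr0, hr⟩ : ∃ r : ℝ, 0 < r ∧ ∀ i, r ≤ (P i).abv (a i) := by
    cases isEmpty_or_nonempty ι
    · exact ⟨1, one_pos, fun i => isEmptyElim i⟩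
    · obtain ⟨i, hi⟩ := Finite.exists_min fun i => (P i).abv (a i)
      exact ⟨_, (P i).abv.pos (ha0 i), hi⟩
  obtain ⟨f, hf⟩ := Metric.denseRange_iff.1 hd (fun i => WithAbs.toAbs _ (z i)) r hr0
  refine ⟨f, fun i => ?_⟩
  have h1 := (dist_pi_lt_iff hr0).1 hf i
  rw [dist_comm, dist_eq_norm] at h1
  have h2 : (P i).abv (f - z i) ≤ (P i).abv (a i) := (le_of_lt h1).trans (hr i)
  rwa [Place.abv_le_iff, ha] at h2

theorem val_pos_of_transcendental {t : F} (ht : Transcendental k t) (p : Place k F) :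
    p.val t ≠ 0 := by
  rw [Ne, map_eq_zero]
  rintro rfl
  exact ht isAlgebraic_zero

/-- Let M be the ring of functions regular on S. Then M/tM is the product of the local quotients
O_p/tO_p over S, and the fundamental inequality bounds its dimension. -/
theorem sum_relDim_le [IsFunctionField k F] {t : F} (ht : Transcendental k t)
    (S : Finset (Place k F)) (hS : ∀ p ∈ S, p.val t ≤ 1) :
    ∑ p : S, Submodule.relDim (p.1.ball (WithZero.log (p.1.val t))) (p.1.ball 0) ≤
      Module.finrank (IntermediateField.adjoin k {t}) F := by
  have ht0 : t ≠ 0 := by rintro rfl; exact ht isAlgebraic_zero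
  set M : Submodule k F := ⨅ p : S, p.1.ball 0 with hMdef
  have hM {x : F} : x ∈ M ↔ ∀ p : S, p.1.val x ≤ 1 := by
    simp [hMdef, Place.mem_ball]
  refine le_trans (le_of_eq ?_) (relDim_mulLeft_le ht (M := M) fun x hx => ?_)
  · rw [← Submodule.relDim_pi]
    symm
    refine Submodule.relDim_eq_of_map (LinearMap.pi fun _ => LinearMap.id) ?_ ?_ ?_
    · intro x hx
      have h1 : (LinearMap.pi fun _ : S => (LinearMap.id : F →ₗ[k] F)) x ∈
          Submodule.pi Set.univ (fun p : S => p.1.ball (WithZero.log (p.1.val t))) ↔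
          ∀ p : S, p.1.val x ≤ p.1.val t := by
        simp [Submodule.mem_pi, Place.mem_ball, WithZero.exp_log, val_pos_of_transcendental ht]
      rw [h1]
      constructor
      · rintro ⟨y, hy, rfl⟩ p
        rw [LinearMap.mulLeft_apply, map_mul]
        exact mul_le_of_le_one_right' (hM.1 hy p)
      · intro h
        refine ⟨t⁻¹ * x, hM.2 fun p => ?_, mul_inv_cancel_left₀ ht0 x⟩
        rw [map_mul, map_inv₀]
        exact inv_mul_le_one_of_le₀ (h p) zero_le
    -- Surjectivity onto the product of local quotients is weak approximation; an approximant of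
    -- regular data is regular because t itself is regular on S.
    · intro z hz
      obtain ⟨f, hf⟩ := exists_val_sub_le (fun p : S => p.1) Subtype.val_injective z
        (fun p => WithZero.log (p.1.val t))
      have hlog (p : S) : WithZero.log (p.1.val t) ≤ 0 := by
        rw [← WithZero.exp_le_exp, WithZero.exp_log (val_pos_of_transcendental ht _)]
        simpa using hS p.1 p.2
      rw [← sub_sub_cancel (fun _ => f) z]
      refine Submodule.sub_mem _ (Submodule.mem_sup_left ⟨f, hM.2 fun p => ?_, rfl⟩)
        (Submodule.mem_sup_right fun p _ => hf p)
      have h2 : f = (f - z p) + z p := by ring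
      have h3 := (p.1.ball 0).add_mem (p.1.ball_mono (hlog p) (hf p)) (hz p trivial)
      rw [sub_add_cancel] at h3
      simpa [Place.mem_ball] using h3
    · rintro _ ⟨x, hx, rfl⟩
      refine Submodule.mem_sup_left fun p _ => ?_
      simpa [Place.mem_ball] using hM.1 hx p
  · rw [hM] at hx ⊢
    intro p
    rw [map_mul]
    exact mul_le_one' (hS p.1 p.2) (hx p)

theorem transcendental_of_val_ne_one {t : F} (ht : t ≠ 0) (p : Place k F) (h : p.val t ≠ 1) :
    Transcendental k t := fun halg => h <| by
  refine le_antisymm (val_le_one_of_isAlgebraic p halg) ?_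
  have := val_le_one_of_isAlgebraic p halg.inv
  rw [map_inv₀] at this
  exact (inv_le_one₀ (zero_lt_iff.2 (by simpa using ht))).1 this

theorem Place.unif_ne_zero (p : Place k F) : p.unif ≠ 0 := by
  intro h
  have := p.val_unif
  rw [h, map_zero] at this
  exact WithZero.exp_ne_zero this.symm

theorem Place.transcendental_unif (p : Place k F) : Transcendental k p.unif :=
  transcendental_of_val_ne_one p.unif_ne_zero p (by
    rw [p.val_unif, ← WithZero.exp_zero, Ne, WithZero.exp_inj]; decide)

variable [IsFunctionField k F]

/-- The case S = {p} with t a local parameter. Without this finiteness the `finrank` in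
`Place.degree` would be a default value. -/
instance (p : Place k F) : Module.Finite k (p.regular ⧸ p.vanishing.comap p.regular.subtype) := by
  apply Module.finite_of_length_ne_top
  have h := sum_relDim_le p.transcendental_unif {p} (by
    simp only [Finset.mem_singleton, forall_eq, p.val_unif, ← WithZero.exp_zero,
      WithZero.exp_le_exp]
    decide)
  have h' : Submodule.relDim (p.ball (-1)) (p.ball 0) ≤
      Module.finrank (IntermediateField.adjoin k {p.unif}) F := by
    simpa [p.val_unif] using h
  rw [p.length_residueField]
  exact ne_top_of_le_ne_top (ENat.natCast_ne_top _) h'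

namespace Place

theorem relDim_ball_neg_one (p : Place k F) :
    Submodule.relDim (p.ball (-1)) (p.ball 0) = p.degree := by
  rw [← p.length_residueField, Module.length_eq_finrank]
  rfl

theorem relDim_ball (p : Place k F) {m m' : ℤ} (h : m ≤ m') :
    Submodule.relDim (p.ball m) (p.ball m') = ((m' - m).toNat * p.degree : ℕ) := by
  have := p.relDim_ball_natCast m (m' - m).toNat
  rw [Int.toNat_of_nonneg (by omega), add_sub_cancel] at this
  rw [this, relDim_ball_neg_one]
  push_cast
  rfl

theorem degree_pos (p : Place k F) : 0 < p.degree := by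
  have h : Submodule.relDim (p.ball (-1)) (p.ball 0) ≠ 0 := fun h => by
    have h1 := Submodule.le_of_relDim_eq_zero h
      (show (1 : F) ∈ p.ball 0 by simp [mem_ball])
    rw [mem_ball, map_one, ← WithZero.exp_zero, WithZero.exp_le_exp] at h1
    omega
  rw [relDim_ball_neg_one] at h
  exact Nat.pos_of_ne_zero fun h0 => h (by simp [h0])

end Place

/-- The degree of the divisor of zeros of `t`, over a finite set of zeros, is at most `[F : k(t)]`.
-/
theorem sum_log_mul_degree_le {t : F} (ht : Transcendental k t)
    (S : Finset (Place k F)) (hS : ∀ p ∈ S, p.val t ≤ 1) :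
    ∑ p ∈ S, -WithZero.log (p.val t) * p.degree ≤
      Module.finrank (IntermediateField.adjoin k {t}) F := by
  have h := sum_relDim_le ht S hS
  have hlog (p : Place k F) (hp : p ∈ S) : WithZero.log (p.val t) ≤ 0 := by
    rw [← WithZero.exp_le_exp, WithZero.exp_log (val_pos_of_transcendental ht _)]
    simpa using hS p hp
  rw [Finset.sum_congr rfl fun (p : S) _ => p.1.relDim_ball (hlog p.1 p.2), ← Nat.cast_sum,
    Nat.cast_le] at h
  rw [← Finset.sum_coe_sort]
  refine le_trans (le_of_eq ?_) (Nat.cast_le.2 h)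
  rw [Nat.cast_sum]
  refine Finset.sum_congr rfl fun p _ => ?_
  rw [Nat.cast_mul, Int.toNat_of_nonneg (by have := hlog p.1 p.2; omega), zero_sub]

end AdelicCode

end

noncomputable section

namespace AdelicCode

universe u v

variable {k : Type u} {F : Type v} [Field k] [Field F] [Algebra k F]

/-! ### Existence of places -/

section ExistsPlace

variable (B : ValuationSubring F) [Algebra k B] [IsScalarTower k B F]

/-- If a were algebraic over k, then so would be its inverse, which would be integral over B and
hence in B, making a unit of a. -/
theorem transcendental_of_mem_maximalIdeal {a : B} (ha : a ∈ IsLocalRing.maximalIdeal B)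
    (ha0 : a ≠ 0) : Transcendental k (a : F) := fun halg => by
  have h1 : IsIntegral B (a : F)⁻¹ := halg.inv.isIntegral.tower_top
  obtain ⟨b, hb⟩ := IsIntegrallyClosed.isIntegral_iff.1 h1
  refine (IsLocalRing.mem_maximalIdeal a).1 ha (IsUnit.of_mul_eq_one b (Subtype.ext ?_))
  change (a : F) * algebraMap B F b = 1
  rw [hb]
  exact mul_inv_cancel₀ (by simpa using ha0)

-- For 0 ≠ a in a proper ideal I, the fundamental inequality with M = B and t = a makes B/aB finite
-- over k. So I/aB is finitely generated, and with it I. This is what makes the valuation rings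
-- below discrete.
variable (k) in
theorem isNoetherianRing_of_isFunctionField [IsFunctionField k F] : IsNoetherianRing B := by
  rw [isNoetherianRing_iff_ideal_fg]
  intro I
  by_cases hI : I = ⊤
  · rw [hI]; exact Module.Finite.fg_top
  by_cases hI0 : I = ⊥
  · rw [hI0]; exact Submodule.fg_bot
  obtain ⟨a, haI, ha0⟩ := Submodule.exists_mem_ne_zero_of_ne_bot hI0
  have ham := IsLocalRing.le_maximalIdeal hI haI
  have ht : Transcendental k (a : F) := transcendental_of_mem_maximalIdeal B ham ha0
  have hfin : Module.Finite k (B ⧸ Ideal.span {a}) := by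
    apply Module.finite_of_length_ne_top
    set f : B →ₗ[k] F := (IsScalarTower.toAlgHom k B F).toLinearMap
    have hle := relDim_mulLeft_le ht (M := LinearMap.range f) (by
      rintro _ ⟨x, rfl⟩
      exact ⟨a * x, map_mul (algebraMap B F) a x⟩)
    have heq : Submodule.relDim ((Ideal.span {a}).restrictScalars k) ⊤ =
        Submodule.relDim ((LinearMap.range f).map (LinearMap.mulLeft k (a : F)))
          (LinearMap.range f) := by
      refine Submodule.relDim_eq_of_map f (fun x _ => ?_) ?_ ?_
      · rw [Submodule.restrictScalars_mem, Ideal.mem_span_singleton]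
        constructor
        · rintro ⟨y, rfl⟩
          exact ⟨_, ⟨y, rfl⟩, (map_mul (algebraMap B F) a y).symm⟩
        · rintro ⟨_, ⟨y, rfl⟩, h⟩
          exact ⟨y, Subtype.ext h.symm⟩
      · rw [Submodule.map_top]; exact le_sup_left
      · rw [Submodule.map_top]; exact le_sup_left
    rw [← heq, Submodule.relDim_top] at hle
    exact ne_top_of_le_ne_top (ENat.natCast_ne_top _) hle
  have hnoeth : IsNoetherian B (B ⧸ Ideal.span {a}) :=
    isNoetherian_of_tower k (inferInstance : IsNoetherian k (B ⧸ Ideal.span {a}))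
  refine Submodule.fg_of_fg_map_of_fg_inf_ker (Submodule.mkQ (Ideal.span {a}))
    (IsNoetherian.noetherian _) ?_
  rw [Submodule.ker_mkQ, inf_eq_right.2 ((Ideal.span_singleton_le_iff_mem I).2 haI)]
  exact Submodule.fg_span (Set.finite_singleton a)

end ExistsPlace

variable [IsFunctionField k F]

/-- Since t is not a unit of k[t], there is a valuation ring of F containing k[t] with t in its
maximal ideal. It is noetherian and not a field, hence a discrete valuation ring, and its normalized
valuation is the place sought. -/
theorem exists_val_lt_one {t : F} (ht : Transcendental k t) : ∃ p : Place k F, p.val t < 1 := by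
  have ht0 : t ≠ 0 := by rintro rfl; exact ht isAlgebraic_zero
  let A : Subring F := (Algebra.adjoin k {t}).toSubring
  let s : A := ⟨t, Algebra.self_mem_adjoin_singleton k t⟩
  obtain ⟨B, hAB, hB⟩ := Ideal.image_subset_nonunits_valuationSubring (Ideal.span {s}) (by
    rw [Ne, Ideal.span_singleton_eq_top]
    intro hu
    obtain ⟨b, hb⟩ := isUnit_iff_exists_inv.1 hu
    have hmem : (b : F) ∈ (Polynomial.aeval t : Polynomial k →ₐ[k] F).range :=
      Algebra.adjoin_singleton_eq_range_aeval k t ▸ b.2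
    obtain ⟨Q, hQ⟩ := hmem
    have h1 : t * (b : F) = 1 := congrArg Subtype.val hb
    -- An inverse of t in k[t] would give an algebraic relation for t with constant coefficient -1.
    have h2 : Polynomial.aeval t (Polynomial.X * Q - 1) = 0 := by
      have hQ' : Polynomial.aeval t Q = (b : F) := hQ
      rw [map_sub, map_mul, Polynomial.aeval_X, hQ', h1, map_one, sub_self]
    have h3 : (Polynomial.X * Q - 1 : Polynomial k) = 0 := by
      by_contra h
      exact ht ⟨_, h, h2⟩
    simpa using congrArg (Polynomial.coeff · 0) h3)
  have hkB (c : k) : algebraMap k F c ∈ B := hAB ((Algebra.adjoin k {t}).algebraMap_mem c)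
  let _ : Algebra k B := ((algebraMap k F).codRestrict B hkB).toAlgebra
  have : IsScalarTower k B F := IsScalarTower.of_algebraMap_eq fun _ => rfl
  have hnoeth := isNoetherianRing_of_isFunctionField k B
  have htB : t ∈ B := hAB s.2
  have htm : (⟨t, htB⟩ : B) ∈ IsLocalRing.maximalIdeal B := by
    rw [B.valuation_lt_one_iff, ← B.mem_nonunits_iff]
    exact hB ⟨s, Ideal.mem_span_singleton_self s, rfl⟩
  have hdvr : IsDiscreteValuationRing B := ⟨fun h => by
    rw [h, Ideal.mem_bot] at htm
    exact ht0 (congrArg Subtype.val htm)⟩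
  let v := IsDiscreteValuationRing.maximalIdeal B
  refine ⟨⟨v.valuation F, v.valuation_surjective F, fun c hc => ?_⟩, ?_⟩
  · have h1 : v.valuation F (algebraMap k F c) ≤ 1 := v.valuation_le_one (algebraMap k B c)
    have h2 : v.valuation F (algebraMap k F c⁻¹) ≤ 1 := v.valuation_le_one (algebraMap k B c⁻¹)
    rw [map_inv₀, map_inv₀] at h2
    refine le_antisymm h1 ((inv_le_one₀ (zero_lt_iff.2 ?_)).1 h2)
    simpa using hc
  · exact (v.valuation_lt_one_iff_mem (⟨t, htB⟩ : B)).2 htm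

theorem exists_one_lt_val {t : F} (ht : Transcendental k t) : ∃ p : Place k F, 1 < p.val t := by
  obtain ⟨p, hp⟩ := exists_val_lt_one (t := t⁻¹) fun h => ht (by simpa using h.inv)
  refine ⟨p, ?_⟩
  rw [map_inv₀] at hp
  exact (inv_lt_one₀ (zero_lt_iff.2 (val_pos_of_transcendental ht p))).1 hp

variable (k F) in
theorem exists_transcendental : ∃ t : F, Transcendental k t := by
  by_contra! h
  have : Algebra.IsAlgebraic k F := ⟨fun x => not_not.1 (h x)⟩
  have h1 := IsFunctionField.trdeg_eq_one (k := k) (F := F)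
  rw [trdeg_eq_zero_iff.2 this] at h1
  exact zero_ne_one h1

variable (k F) in
instance : Nonempty (Place k F) := by
  obtain ⟨t, ht⟩ := exists_transcendental k F
  obtain ⟨p, -⟩ := exists_one_lt_val ht
  exact ⟨p⟩

end AdelicCode

end

noncomputable section

namespace AdelicCode

universe u v

variable {k : Type u} {F : Type v} [Field k] [Field F] [Algebra k F]

/-! ### The local fields -/

namespace Place

instance (p : Place k F) : Algebra k p.Compl :=
  ((algebraMap F p.Compl).comp (algebraMap k F)).toAlgebra

instance (p : Place k F) : IsScalarTower k F p.Compl := IsScalarTower.of_algebraMap_eq fun _ => rfl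

theorem valued_const_le (p : Place k F) (c : k) : Valued.v (algebraMap k p.Compl c) ≤ 1 := by
  rw [IsScalarTower.algebraMap_apply k F p.Compl, valued_algebraMap]
  exact p.val_const_le c

theorem denseRange_algebraMap (p : Place k F) : DenseRange (algebraMap F p.Compl) :=
  (UniformSpace.Completion.denseRange_coe (α := WithVal p.val)).comp
    (WithVal.equiv p.val).symm.surjective.denseRange (UniformSpace.Completion.continuous_coe _)

theorem exists_valued_sub_le (p : Place k F) (x : p.Compl) (m : ℤ) :
    ∃ f : F, Valued.v (x - algebraMap F p.Compl f) ≤ WithZero.exp m := by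
  obtain ⟨a, ha, ham⟩ := p.exists_val_eq m
  have ha' : Valued.v (algebraMap F p.Compl a) = WithZero.exp m := by
    rw [valued_algebraMap, ham]
  have hne : (Valued.v (R := p.Compl)).restrict (algebraMap F p.Compl a) ≠ 0 := by simp [ha]
  have hmem : {y : p.Compl | (Valued.v (R := p.Compl)).restrict (y - x) <
      (Units.mk0 _ hne).1} ∈ nhds x := Valued.mem_nhds.2 ⟨Units.mk0 _ hne, subset_rfl⟩
  obtain ⟨f, hf⟩ := p.denseRange_algebraMap.exists_mem_open isOpen_interior
    ⟨x, mem_interior_iff_mem_nhds.2 hmem⟩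
  refine ⟨f, ?_⟩
  have h0 := interior_subset hf
  have h1 : (Valued.v (R := p.Compl)).restrict (algebraMap F p.Compl f - x) <
    (Valued.v (R := p.Compl)).restrict (algebraMap F p.Compl a) := h0
  rw [Valuation.restrict_lt_iff] at h1
  rw [Valuation.map_sub_swap, ← ha']
  exact h1.le

/-- The elements `x` of `F_p` with `ord_p x ≥ -m`. -/
def complBall (p : Place k F) (m : ℤ) : Submodule k p.Compl where
  carrier := {x | Valued.v x ≤ WithZero.exp m}
  zero_mem' := by simp
  add_mem' {a b} ha hb := (Valued.v.map_add a b).trans (max_le ha hb)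
  smul_mem' c a ha := by
    rw [Set.mem_ofPred_eq, Algebra.smul_def, map_mul]
    exact (mul_le_of_le_one_left' (p.valued_const_le c)).trans ha

theorem mem_complBall {p : Place k F} {m : ℤ} {x : p.Compl} :
    x ∈ p.complBall m ↔ Valued.v x ≤ WithZero.exp m := Iff.rfl

theorem complBall_mono (p : Place k F) {m m' : ℤ} (h : m ≤ m') : p.complBall m ≤ p.complBall m' :=
  fun _ hf => le_trans hf (WithZero.exp_le_exp.2 h)

/-- F is dense in its completion, so quotients of balls are the same in F and in F_p. -/
theorem relDim_complBall [IsFunctionField k F] (p : Place k F) {m m' : ℤ} (h : m ≤ m') :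
    Submodule.relDim (p.complBall m) (p.complBall m') = ((m' - m).toNat * p.degree : ℕ) := by
  rw [← p.relDim_ball h]
  symm
  refine Submodule.relDim_eq_of_map (IsScalarTower.toAlgHom k F p.Compl).toLinearMap
    (fun x _ => ?_) (fun x hx => ?_) ?_
  · change _ ↔ Valued.v (algebraMap F p.Compl x) ≤ _
    rw [valued_algebraMap]
    rfl
  · obtain ⟨f, hf⟩ := p.exists_valued_sub_le x m
    rw [← add_sub_cancel (algebraMap F p.Compl f) x]
    refine Submodule.add_mem_sup ⟨f, ?_, rfl⟩ hf
    have h1 := (p.complBall m').sub_mem hx (p.complBall_mono h hf)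
    rw [sub_sub_cancel] at h1
    rw [SetLike.mem_coe, mem_ball, ← valued_algebraMap]
    exact h1
  · rintro _ ⟨x, hx, rfl⟩
    refine Submodule.mem_sup_left ?_
    change Valued.v (algebraMap F p.Compl x) ≤ _
    rw [valued_algebraMap]
    exact hx

theorem exists_valued_le (p : Place k F) (x : p.Compl) : ∃ m : ℤ, x ∈ p.complBall m :=
  exists_le_exp _

end Place

/-! ### Adeles with bounded poles -/

namespace Adele

open Classical in
/-- The adele which agrees with `z` at the places in the finite set `S` and vanishes elsewhere. -/
def ofFinset (S : Finset (Place k F)) (z : ∀ p : Place k F, p.Compl) : Adele k F :=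
  ⟨fun p => if p ∈ S then z p else 0, by
    refine S.finite_toSet.subset fun p hp => ?_
    contrapose! hp
    rw [Set.mem_compl_iff, not_not]
    change (if p ∈ S then z p else 0) ∈ p.integers
    rw [if_neg (by simpa using hp)]
    exact p.integers.zero_mem⟩

theorem ofFinset_apply_of_mem {S : Finset (Place k F)} (z : ∀ p : Place k F, p.Compl)
    {p : Place k F} (hp : p ∈ S) : ofFinset S z p = z p := if_pos hp

theorem ofFinset_apply_of_notMem {S : Finset (Place k F)} (z : ∀ p : Place k F, p.Compl)
    {p : Place k F} (hp : p ∉ S) : ofFinset S z p = 0 := if_neg hp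

theorem add_apply (a b : Adele k F) (p : Place k F) : (a + b) p = a p + b p := rfl

theorem sub_apply (a b : Adele k F) (p : Place k F) : (a - b) p = a p - b p := rfl

theorem mul_apply (a b : Adele k F) (p : Place k F) : (a * b) p = a p * b p := rfl

theorem finite_not_integral (a : Adele k F) : {p : Place k F | a p ∉ p.integers}.Finite := a.2

variable [IsFunctionField k F]

/-- The `p`-component of an adele, as a linear map. -/
def evalₗ (p : Place k F) : Adele k F →ₗ[k] p.Compl where
  toFun a := a p
  map_add' _ _ := rfl
  map_smul' c a := by
    rw [smul_apply, RingHom.id_apply, Algebra.smul_def]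
    rfl

theorem evalₗ_apply (p : Place k F) (a : Adele k F) : evalₗ p a = a p := rfl

variable (k F) in
/-- The functions, as a subspace of the adeles. -/
def functions : Submodule k (Adele k F) :=
  LinearMap.range (IsScalarTower.toAlgHom k F (Adele k F)).toLinearMap

/-- The adeles `a` with `ord_p(a_p) ≥ -E p` for all `p`. -/
def bounded (E : Divisor k F) : Submodule k (Adele k F) :=
  ⨅ p : Place k F, (p.complBall (E p)).comap (evalₗ p)

theorem mem_bounded {E : Divisor k F} {a : Adele k F} :
    a ∈ bounded E ↔ ∀ p, Valued.v (a p) ≤ WithZero.exp (E p) := by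
  simp [bounded, Place.mem_complBall, evalₗ_apply]

theorem bounded_mono {E E' : Divisor k F} (h : E ≤ E') : bounded E ≤ bounded E' :=
  iInf_mono fun p => Submodule.comap_mono (p.complBall_mono (h p))

theorem exists_mem_bounded (a : Adele k F) (E₀ : Divisor k F) :
    ∃ E, E₀ ≤ E ∧ a ∈ bounded E := by
  choose m hm using fun p : Place k F => p.exists_valued_le (a p)
  classical
  have hfin : {p : Place k F | a p ∉ p.integers}.Finite := a.finite_not_integral
  let G : Divisor k F := Finsupp.onFinset hfin.toFinset
    (fun p => if p ∈ hfin.toFinset then m p else 0) (fun p hp => by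
      contrapose! hp
      simp [hp])
  -- G covers the finitely many places with a pole; the term 0 covers the remaining ones, where E₀
  -- may be negative.
  refine ⟨E₀ ⊔ 0 ⊔ G, le_sup_left.trans le_sup_left, mem_bounded.2 fun p => ?_⟩
  by_cases hp : p ∈ hfin.toFinset
  · refine (hm p).trans (WithZero.exp_le_exp.2 (le_trans (le_of_eq ?_)
      ((le_sup_right : G ≤ E₀ ⊔ 0 ⊔ G) p)))
    simp only [G, Finsupp.onFinset_apply, if_pos hp]
  · have h1 : Valued.v (a p) ≤ 1 := by simpa [Place.mem_integers] using hp
    refine h1.trans ?_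
    rw [← WithZero.exp_zero, WithZero.exp_le_exp]
    exact (le_sup_right.trans le_sup_left : (0 : Divisor k F) ≤ E₀ ⊔ 0 ⊔ G) p

end Adele

/-! ### Divisors -/

namespace Divisor

theorem degree_eq_sum (E : Divisor k F) {S : Finset (Place k F)} (h : E.support ⊆ S) :
    E.degree = ∑ p ∈ S, E p * p.degree :=
  Finsupp.sum_of_support_subset _ h _ (by simp)

theorem degree_add (E E' : Divisor k F) : (E + E').degree = E.degree + E'.degree :=
  Finsupp.sum_add_index' (by simp) (by intros; ring)

theorem degree_zero : (0 : Divisor k F).degree = 0 := Finsupp.sum_zero_index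

theorem degree_neg (E : Divisor k F) : (-E).degree = -E.degree := by
  rw [eq_neg_iff_add_eq_zero, ← degree_add, neg_add_cancel, degree_zero]

theorem degree_sub (E E' : Divisor k F) : (E - E').degree = E.degree - E'.degree := by
  rw [sub_eq_add_neg, degree_add, degree_neg, sub_eq_add_neg]

theorem degree_nsmul (m : ℕ) (E : Divisor k F) : (m • E).degree = m * E.degree := by
  induction m with
  | zero => simp [degree_zero]
  | succ m ih => rw [succ_nsmul, degree_add, ih]; push_cast; ring

theorem degree_sum {ι : Type*} (s : Finset ι) (E : ι → Divisor k F) :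
    (∑ i ∈ s, E i).degree = ∑ i ∈ s, (E i).degree := by
  classical
  induction s using Finset.induction_on with
  | empty => simp [degree_zero]
  | insert i s hi ih => rw [Finset.sum_insert hi, Finset.sum_insert hi, degree_add, ih]

theorem degree_single (p : Place k F) (m : ℤ) :
    degree (Finsupp.single p m : Divisor k F) = m * p.degree :=
  Finsupp.sum_single_index (by simp)

theorem degree_mono {E E' : Divisor k F} (h : E ≤ E') : E.degree ≤ E'.degree := by
  rw [← sub_nonneg, ← degree_sub]
  refine Finsupp.sum_nonneg fun p _ => mul_nonneg ?_ (Nat.cast_nonneg _)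
  exact sub_nonneg.2 (h p)

end Divisor

/-- The two boxes differ only at the finitely many places in the support of E' - E, so the quotient
is a finite product of local ones, whose dimensions add up to the difference of degrees. -/
theorem relDim_bounded [IsFunctionField k F] {E E' : Divisor k F} (h : E ≤ E') :
    Submodule.relDim (Adele.bounded E) (Adele.bounded E') = (E'.degree - E.degree).toNat := by
  classical
  set S := (E' - E).support with hS
  have hSE (p : Place k F) (hp : p ∉ S) : E' p = E p := by
    simpa [hS, sub_eq_zero] using hp
  have h1 : Submodule.relDim (Adele.bounded E) (Adele.bounded E') =
      Submodule.relDim (Submodule.pi Set.univ fun p : S => p.1.complBall (E p.1))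
        (Submodule.pi Set.univ fun p : S => p.1.complBall (E' p.1)) := by
    refine Submodule.relDim_eq_of_map (LinearMap.pi fun p : S => Adele.evalₗ p.1) ?_ ?_ ?_
    · intro a ha
      rw [Adele.mem_bounded] at ha ⊢
      constructor
      · exact fun h p _ => h p.1
      · intro h p
        by_cases hp : p ∈ S
        · exact h ⟨p, hp⟩ trivial
        · rw [← hSE p hp]; exact ha p
    · intro z hz
      refine Submodule.mem_sup_left ⟨Adele.ofFinset S
        (fun p => if hp : p ∈ S then z ⟨p, hp⟩ else 0), ?_, ?_⟩
      · refine Adele.mem_bounded.2 fun p => ?_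
        by_cases hp : p ∈ S
        · rw [Adele.ofFinset_apply_of_mem _ hp, dif_pos hp]
          exact hz ⟨p, hp⟩ trivial
        · rw [Adele.ofFinset_apply_of_notMem _ hp]
          simp
      · ext p
        refine (Adele.ofFinset_apply_of_mem (fun p => if hp : p ∈ S then z ⟨p, hp⟩ else 0)
          p.2).trans ?_
        rw [dif_pos p.2]
    · rintro _ ⟨a, ha, rfl⟩
      exact Submodule.mem_sup_left fun p _ => Adele.mem_bounded.1 ha p.1
  rw [h1, Submodule.relDim_pi, Finset.sum_congr rfl fun (p : S) _ =>
    p.1.relDim_complBall (h p.1), ← Nat.cast_sum]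
  congr 1
  apply Nat.cast_injective (R := ℤ)
  rw [Int.toNat_of_nonneg (sub_nonneg.2 (Divisor.degree_mono h)), ← Divisor.degree_sub,
    Divisor.degree_eq_sum _ subset_rfl, ← hS, ← Finset.sum_coe_sort S, Nat.cast_sum]
  refine Finset.sum_congr rfl fun p _ => ?_
  rw [Nat.cast_mul, Int.toNat_of_nonneg (sub_nonneg.2 (h p.1))]
  rfl

end AdelicCode

end

noncomputable section

namespace AdelicCode

universe u v

variable {k : Type u} {F : Type v} [Field k] [Field F] [Algebra k F]

/-! ### Principal divisors and spaces of sections -/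

/-- The space of functions `f` with `ord_p f ≥ -E p` for all `p`. -/
def sections (E : Divisor k F) : Submodule k F := ⨅ p : Place k F, p.ball (E p)

theorem mem_sections {E : Divisor k F} {f : F} :
    f ∈ sections E ↔ ∀ p : Place k F, p.val f ≤ WithZero.exp (E p) := by
  simp [sections, Place.mem_ball]

theorem sections_mono {E E' : Divisor k F} (h : E ≤ E') : sections E ≤ sections E' :=
  iInf_mono fun p => p.ball_mono (h p)

theorem adjoin_inv (t : F) :
    IntermediateField.adjoin k {t⁻¹} = IntermediateField.adjoin k {t} := by
  apply le_antisymm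
  · rw [IntermediateField.adjoin_simple_le_iff]
    exact inv_mem (IntermediateField.mem_adjoin_simple_self k t)
  · rw [IntermediateField.adjoin_simple_le_iff, ← inv_inv t, inv_inv t⁻¹]
    have := inv_mem (IntermediateField.mem_adjoin_simple_self k t⁻¹)
    rwa [inv_inv] at this ⊢

theorem mul_mem_sections {E E' : Divisor k F} {f f' : F} (hf : f ∈ sections E)
    (hf' : f' ∈ sections E') : f * f' ∈ sections (E + E') := by
  rw [mem_sections] at *
  intro p
  rw [map_mul, Finsupp.add_apply, WithZero.exp_add]
  exact mul_le_mul' (hf p) (hf' p)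

theorem one_mem_sections : (1 : F) ∈ sections (0 : Divisor k F) := by
  simp [mem_sections]

theorem pow_mem_sections {E : Divisor k F} {f : F} (hf : f ∈ sections E) (m : ℕ) :
    f ^ m ∈ sections (m • E) := by
  induction m with
  | zero => rw [pow_zero, zero_smul]; exact one_mem_sections
  | succ m ih => rw [pow_succ, succ_nsmul]; exact mul_mem_sections ih hf

variable [IsFunctionField k F]

instance : Nontrivial (Adele k F) := by
  obtain ⟨p⟩ : Nonempty (Place k F) := inferInstance
  exact ⟨0, 1, fun h => zero_ne_one (α := p.Compl) (congrArg (Adele.eval p) h)⟩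

/-- The divisor `∑_p ord_p(f) p` of a function (`0` for `f = 0`). -/
def divisor (k : Type u) {F : Type v} [Field k] [Field F] [Algebra k F] [IsFunctionField k F]
    (f : F) : Divisor k F :=
  Finsupp.ofSupportFinite (fun p => -WithZero.log (p.val f)) <| by
    refine ((finite_poles f).union (finite_poles f⁻¹)).subset fun p hp => ?_
    by_contra h
    apply hp
    simp only [Set.mem_union, Set.mem_ofPred_eq, map_inv₀, not_or, not_lt] at h
    by_cases h0 : p.val f = 0
    · simp [h0]
    · change -WithZero.log (p.val f) = 0
      rw [le_antisymm h.1 ((inv_le_one₀ (zero_lt_iff.2 h0)).1 h.2), WithZero.log_one, neg_zero]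

theorem divisor_apply (f : F) (p : Place k F) : divisor k f p = -WithZero.log (p.val f) := rfl

theorem val_eq_exp {f : F} (hf : f ≠ 0) (p : Place k F) :
    p.val f = WithZero.exp (-divisor k f p) := by
  rw [divisor_apply, neg_neg, WithZero.exp_log (by simpa using hf)]

theorem divisor_inv (f : F) : divisor k f⁻¹ = -divisor k f := by
  ext p
  rw [Finsupp.neg_apply, divisor_apply, divisor_apply, map_inv₀, WithZero.log_inv]

theorem mem_sections_iff_neg_divisor_le {E : Divisor k F} {f : F} (hf : f ≠ 0) :
    f ∈ sections E ↔ -divisor k f ≤ E := by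
  simp only [mem_sections, val_eq_exp hf, WithZero.exp_le_exp]
  rfl

theorem algebraMap_mem_bounded {E : Divisor k F} {f : F} :
    algebraMap F (Adele k F) f ∈ Adele.bounded E ↔ f ∈ sections E := by
  rw [Adele.mem_bounded, mem_sections]
  simp only [Adele.algebraMap_apply, Place.valued_algebraMap]

theorem bounded_inf_functions (E : Divisor k F) :
    Adele.bounded E ⊓ Adele.functions k F =
      (sections E).map (IsScalarTower.toAlgHom k F (Adele k F)).toLinearMap := by
  ext a
  constructor
  · rintro ⟨ha, f, rfl⟩
    exact ⟨f, algebraMap_mem_bounded.1 ha, rfl⟩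
  · rintro ⟨f, hf, rfl⟩
    exact ⟨algebraMap_mem_bounded.2 hf, f, rfl⟩

theorem length_bounded_inf_functions (E : Divisor k F) :
    Module.length k (Adele.bounded E ⊓ Adele.functions k F : Submodule k (Adele k F)) =
      Module.length k (sections E) := by
  rw [bounded_inf_functions]
  exact (Submodule.equivMapOfInjective _
    (algebraMap F (Adele k F)).injective (sections E)).symm.length_eq

/-- A nonzero function vanishing at p is transcendental and therefore has a pole somewhere. This
starts the finiteness of all spaces of sections. -/
theorem sections_neg_single (p : Place k F) : sections (-Finsupp.single p 1 : Divisor k F) = ⊥ := by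
  refine (Submodule.eq_bot_iff _).2 fun f hf => ?_
  by_contra hf0
  rw [mem_sections] at hf
  have hp : p.val f ≠ 1 := by
    have := hf p
    rw [Finsupp.neg_apply, Finsupp.single_eq_same] at this
    exact (lt_one_iff_le_exp.2 this).ne
  obtain ⟨q, hq⟩ := exists_one_lt_val (transcendental_of_val_ne_one hf0 p hp)
  refine (hq.trans_le (hf q)).not_ge ?_
  rw [← WithZero.exp_zero, WithZero.exp_le_exp, Finsupp.neg_apply, neg_nonpos]
  classical
  rw [Finsupp.single_apply]
  split_ifs <;> simp

/-- The quotient of the two spaces of sections embeds into the quotient of the two adelic boxes. -/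
theorem length_sections_le {E E' : Divisor k F} (h : E ≤ E') :
    Module.length k (sections E') ≤
      Module.length k (sections E) + (E'.degree - E.degree).toNat := by
  rw [← length_bounded_inf_functions, ← length_bounded_inf_functions, ← relDim_bounded h,
    ← Submodule.relDim_bot, ← Submodule.relDim_bot, Submodule.relDim_add bot_le
      (inf_le_inf_right (Adele.functions k F) (Adele.bounded_mono h)),
    Submodule.relDim_eq_inf_add_sup (Adele.bounded_mono h) (Adele.functions k F)]
  exact add_le_add_right le_self_add _

instance (E : Divisor k F) : Module.Finite k (sections E) := by
  apply Module.finite_of_length_ne_top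
  obtain ⟨p⟩ : Nonempty (Place k F) := inferInstance
  -- Enlarge E so that it dominates -p; the space for -p is zero, and the enlargement adds only
  -- finitely many dimensions.
  refine ne_top_of_le_ne_top ?_ ((Module.length_le_of_injective (Submodule.inclusion
    (sections_mono (le_sup_left : E ≤ E ⊔ -Finsupp.single p 1))) (Submodule.inclusion_injective
      _)).trans (length_sections_le le_sup_right))
  rw [sections_neg_single, Module.length_bot, zero_add]
  exact ENat.natCast_ne_top _

/-- The dimension of the space of sections of a divisor. -/
def ell (E : Divisor k F) : ℕ := Module.finrank k (sections E)

theorem length_sections (E : Divisor k F) : Module.length k (sections E) = ell E :=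
  Module.length_eq_finrank k _

theorem ell_le_add {E E' : Divisor k F} (h : E ≤ E') :
    (ell E' : ℤ) ≤ ell E + (E'.degree - E.degree) := by
  have h1 := length_sections_le h
  rw [length_sections, length_sections, ← Nat.cast_add, Nat.cast_le] at h1
  have := Divisor.degree_mono h
  omega

theorem sections_map_mul {f : F} (hf : f ≠ 0) (E : Divisor k F) :
    (sections E).map (Place.mulEquiv k f hf).toLinearMap = sections (E - divisor k f) := by
  ext x
  simp only [Submodule.mem_map, mem_sections, Finsupp.sub_apply]
  constructor
  · rintro ⟨y, hy, rfl⟩ p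
    change p.val (f * y) ≤ _
    rw [map_mul, val_eq_exp hf, sub_eq_add_neg, add_comm, WithZero.exp_add]
    exact mul_le_mul_right (hy p) _
  · intro hx
    refine ⟨f⁻¹ * x, fun p => ?_, mul_inv_cancel_left₀ hf x⟩
    rw [map_mul, map_inv₀, val_eq_exp hf, ← WithZero.exp_neg, neg_neg,
      show E p = divisor k f p + (E p - divisor k f p) by ring, WithZero.exp_add (divisor k f p)]
    exact mul_le_mul_right (hx p) _

theorem ell_sub_divisor {f : F} (hf : f ≠ 0) (E : Divisor k F) :
    ell (E - divisor k f) = ell E := by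
  rw [ell, ← sections_map_mul hf]
  exact LinearEquiv.finrank_map_eq _ _

/-! ### The degree of a principal divisor -/

/-- The divisor of poles of a function. -/
def poleDivisor (k : Type u) {F : Type v} [Field k] [Field F] [Algebra k F] [IsFunctionField k F]
    (f : F) : Divisor k F := (-divisor k f) ⊔ 0

theorem poleDivisor_inv_sub_poleDivisor (f : F) :
    poleDivisor k f⁻¹ - poleDivisor k f = divisor k f := by
  ext p
  simp only [poleDivisor, divisor_inv, neg_neg, Finsupp.sub_apply, Finsupp.sup_apply,
    Finsupp.neg_apply, Finsupp.zero_apply]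
  omega

theorem poleDivisor_nonneg (f : F) : 0 ≤ poleDivisor k f := le_sup_right

theorem mem_sections_poleDivisor (f : F) : f ∈ sections (poleDivisor k f) := by
  by_cases hf : f = 0
  · rw [hf]; exact Submodule.zero_mem _
  · exact (mem_sections_iff_neg_divisor_le hf).2 le_sup_left

/-- Poles of t are zeros of t⁻¹, and t⁻¹ generates the same field, so the inequality for zeros
applies. -/
theorem degree_poleDivisor_le {t : F} (ht : Transcendental k t) :
    (poleDivisor k t).degree ≤ Module.finrank (IntermediateField.adjoin k {t}) F := by
  classical
  have ht' : Transcendental k t⁻¹ := fun h => ht (by simpa using h.inv)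
  have h := sum_log_mul_degree_le ht' ((poleDivisor k t).support.filter
    fun p => p.val t⁻¹ ≤ 1) (fun p hp => (Finset.mem_filter.1 hp).2)
  rw [adjoin_inv] at h
  refine le_trans (le_of_eq ?_) h
  rw [Divisor.degree_eq_sum _ subset_rfl, Finset.sum_filter_of_ne]
  · refine Finset.sum_congr rfl fun p hp => ?_
    congr 1
    have h1 : max (WithZero.log (p.val t)) 0 ≠ 0 := by
      simpa [poleDivisor, divisor_apply] using hp
    have h2 : poleDivisor k t p = max (WithZero.log (p.val t)) 0 := by
      simp [poleDivisor, divisor_apply]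
    rw [h2, map_inv₀, WithZero.log_inv, neg_neg]
    omega
  · intro p hp _
    have h1 : max (WithZero.log (p.val t)) 0 ≠ 0 := by
      simpa [poleDivisor, divisor_apply] using hp
    have h0 := val_pos_of_transcendental ht p
    rw [map_inv₀, inv_le_one₀ (zero_lt_iff.2 h0), ← WithZero.exp_zero, ← WithZero.exp_log h0,
      WithZero.exp_le_exp]
    omega

/-- If b_i is a basis of F over k(t) and C bounds the poles of the b_i, then the products t^j b_i
with j ≤ m are independent over k and have poles bounded by m times the pole divisor of t plus C. -/
theorem exists_mul_le_ell {t : F} (ht : Transcendental k t) : ∃ C : Divisor k F, 0 ≤ C ∧ ∀ m : ℕ,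
    (m + 1) * Module.finrank (IntermediateField.adjoin k {t}) F ≤
      ell (m • poleDivisor k t + C) := by
  have hfin := finite_extension ht
  let b := Module.finBasis (IntermediateField.adjoin k {t}) F
  refine ⟨∑ i, poleDivisor k (b i), Finset.sum_nonneg fun i _ => poleDivisor_nonneg _,
    fun m => ?_⟩
  let t' : IntermediateField.adjoin k {t} := ⟨t, IntermediateField.mem_adjoin_simple_self k t⟩
  have hpow : LinearIndependent k fun j : ℕ => t' ^ j := by
    have h1 : LinearIndependent k fun j : ℕ => t ^ j := by
      rw [transcendental_iff_injective] at ht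
      have h2 := (Polynomial.basisMonomials k).linearIndependent.map'
        (Polynomial.aeval t).toLinearMap (LinearMap.ker_eq_bot.2 ht)
      simpa [Function.comp_def, Polynomial.aeval_monomial] using h2
    refine LinearIndependent.of_comp (IntermediateField.adjoin k {t}).val.toLinearMap ?_
    exact h1
  have hind := linearIndependent_smul (hpow.comp (fun j : Fin (m + 1) => (j : ℕ))
    Fin.val_injective) b.linearIndependent
  have hmem (x : Fin (m + 1) × Fin (Module.finrank (IntermediateField.adjoin k {t}) F)) :
      t' ^ (x.1 : ℕ) • b x.2 ∈ sections (m • poleDivisor k t + ∑ i, poleDivisor k (b i)) := by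
    change t ^ (x.1 : ℕ) * b x.2 ∈ _
    refine sections_mono (add_le_add ?_ ?_) (mul_mem_sections (pow_mem_sections
      (mem_sections_poleDivisor t) _) (mem_sections_poleDivisor (b x.2)))
    · exact nsmul_le_nsmul_left (poleDivisor_nonneg t) (by omega)
    · exact Finset.single_le_sum (f := fun i => poleDivisor k (b i))
        (fun i _ => poleDivisor_nonneg _) (Finset.mem_univ _)
  have hind' : LinearIndependent k fun x => (⟨_, hmem x⟩ : sections (m • poleDivisor k t +
      ∑ i, poleDivisor k (b i))) := by
    refine LinearIndependent.of_comp (Submodule.subtype _) ?_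
    exact hind
  simpa [ell] using hind'.fintype_card_le_finrank

/-- Asymptotic comparison: ℓ of m times the pole divisor plus C grows at least like m[F : k(t)], and
at most like m times the degree of the pole divisor. -/
theorem degree_poleDivisor {t : F} (ht : Transcendental k t) :
    (poleDivisor k t).degree = Module.finrank (IntermediateField.adjoin k {t}) F := by
  refine le_antisymm (degree_poleDivisor_le ht) ?_
  by_contra! h
  obtain ⟨C, hC, hC'⟩ := exists_mul_le_ell ht
  set n := Module.finrank (IntermediateField.adjoin k {t}) F
  -- If the degree were at most n - 1, then (m + 1)n ≤ ℓ(0) + m(n - 1) + deg C; for this m the right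
  -- side is mn.
  set m : ℕ := ell (0 : Divisor k F) + C.degree.toNat
  have h1 := hC' m
  have h2 := ell_le_add (add_nonneg (nsmul_nonneg (poleDivisor_nonneg (k := k) t) m) hC)
  rw [Divisor.degree_add, Divisor.degree_zero, Divisor.degree_nsmul] at h2
  have h3 : (m : ℤ) * (poleDivisor k t).degree ≤ m * (n - 1) :=
    mul_le_mul_of_nonneg_left (by omega) (by positivity)
  have h4 : (((m + 1) * n : ℕ) : ℤ) ≤ ell (m • poleDivisor k t + C) := by exact_mod_cast h1
  push_cast at h4
  have h5 : 0 ≤ C.degree := Divisor.degree_zero (k := k) (F := F) ▸ Divisor.degree_mono hC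
  have h6 : (m : ℤ) = ell (0 : Divisor k F) + C.degree := by
    simp only [m]; push_cast; rw [Int.toNat_of_nonneg h5]
  have h7 : 0 < (n : ℤ) := by
    have : 0 ≤ (poleDivisor k t).degree :=
      Divisor.degree_zero (k := k) (F := F) ▸ Divisor.degree_mono (poleDivisor_nonneg t)
    omega
  nlinarith

/-- The product formula. -/
theorem degree_divisor (f : F) : (divisor k f).degree = 0 := by
  by_cases hf : IsAlgebraic k f
  · have : divisor k f = 0 := by
      ext p
      by_cases hf0 : f = 0
      · simp [divisor_apply, hf0]
      · have h1 : p.val f = 1 := not_not.1 fun h => transcendental_of_val_ne_one hf0 p h hf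
        simp [divisor_apply, h1]
    rw [this, Divisor.degree_zero]
  · have hf' : Transcendental k f⁻¹ := fun h => hf (by simpa using h.inv)
    -- Zeros and poles of f each have degree [F : k(f)], because f and f⁻¹ generate the same field.
    rw [← poleDivisor_inv_sub_poleDivisor, Divisor.degree_sub, degree_poleDivisor hf,
      degree_poleDivisor hf', adjoin_inv, sub_self]

/-! ### The Riemann-Roch theorem for divisors -/

variable (k F) in
/-- Riemann's inequality. -/
theorem exists_degree_sub_ell_le : ∃ c : ℤ, ∀ E : Divisor k F, E.degree - ell E ≤ c := by
  obtain ⟨t, ht⟩ := exists_transcendental k F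
  obtain ⟨C, hC, hC'⟩ := exists_mul_le_ell ht
  set n := Module.finrank (IntermediateField.adjoin k {t}) F
  have hn : 0 < n := by
    have := finite_extension ht
    exact Module.finrank_pos
  -- The inequality for multiples of the pole divisor of t. The general case follows because deg - ℓ
  -- is monotone and invariant under adding principal divisors.
  have key (m : ℕ) : (m * n : ℤ) - ell (m • poleDivisor k t) ≤ C.degree := by
    have h1 : (((m + 1) * n : ℕ) : ℤ) ≤ ell (m • poleDivisor k t + C) := by exact_mod_cast hC' m
    have h2 := ell_le_add (le_add_of_nonneg_right hC : m • poleDivisor k t ≤ _ + C)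
    rw [Divisor.degree_add] at h2
    push_cast at h1
    nlinarith
  refine ⟨C.degree, fun E => ?_⟩
  have hmono {E E' : Divisor k F} (h : E ≤ E') : E.degree - ell E ≤ E'.degree - ell E' := by
    have := ell_le_add h
    linarith
  -- For large m this space contains some z ≠ 0, and subtracting the divisor of z moves E ⊔ 0 below
  -- m times the pole divisor.
  obtain ⟨m, hm⟩ : ∃ m : ℕ, 0 < ell (m • poleDivisor k t - (E ⊔ 0)) := by
    refine ⟨((E ⊔ 0).degree + C.degree + 1).toNat, ?_⟩
    set m := ((E ⊔ 0).degree + C.degree + 1).toNat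
    have h1 := key m
    have h2 := ell_le_add (sub_le_self (m • poleDivisor k t) (le_sup_right : 0 ≤ E ⊔ 0))
    rw [Divisor.degree_sub] at h2
    have h3 : (E ⊔ 0).degree + C.degree + 1 ≤ m := Int.self_le_toNat _
    have h4 : (m : ℤ) ≤ m * n := le_mul_of_one_le_right (by positivity) (by omega)
    zify
    linarith
  obtain ⟨z, hz, hz0⟩ := Submodule.exists_mem_ne_zero_of_ne_bot
    (Submodule.one_le_finrank_iff.1 hm)
  rw [mem_sections_iff_neg_divisor_le hz0] at hz
  have hle : (E ⊔ 0) - divisor k z ≤ m • poleDivisor k t := by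
    rw [sub_eq_add_neg]
    exact (add_le_add_right hz _).trans (add_sub_cancel _ _).le
  calc _ ≤ (E ⊔ 0).degree - ell (E ⊔ 0) := hmono le_sup_left
    _ = ((E ⊔ 0) - divisor k z).degree - ell ((E ⊔ 0) - divisor k z) := by
      rw [Divisor.degree_sub, degree_divisor, sub_zero, ell_sub_divisor hz0]
    _ ≤ _ := hmono hle
    _ ≤ _ := by
      rw [Divisor.degree_nsmul, degree_poleDivisor ht]
      exact key m

variable (k F) in
/-- Strong approximation, with a sufficiently large divisor. -/
theorem exists_bounded_sup_functions_eq_top :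
    ∃ E₀ : Divisor k F, ∀ E, E₀ ≤ E → Adele.bounded E ⊔ Adele.functions k F = ⊤ := by
  obtain ⟨c, hc⟩ := exists_degree_sub_ell_le k F
  -- E₀ maximizes deg - ℓ, which Riemann's inequality bounds. For E ≥ E₀, the growth of 𝔸(E) + F
  -- over 𝔸(E₀) + F is the growth of deg - ℓ, hence zero.
  obtain ⟨_, ⟨E₀, rfl⟩, hmax⟩ := Int.exists_greatest_of_bdd
    (P := fun z => ∃ E : Divisor k F, E.degree - ell E = z) ⟨c, by rintro _ ⟨E, rfl⟩; exact hc E⟩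
    ⟨_, 0, rfl⟩
  have h1 {E : Divisor k F} (hE : E₀ ≤ E) :
      Adele.bounded E ⊔ Adele.functions k F ≤ Adele.bounded E₀ ⊔ Adele.functions k F := by
    have h2 := Submodule.relDim_eq_inf_add_sup (Adele.bounded_mono hE) (Adele.functions k F)
    have h3 := Submodule.relDim_add bot_le
      (inf_le_inf_right (Adele.functions k F) (Adele.bounded_mono hE))
    rw [Submodule.relDim_bot, Submodule.relDim_bot, length_bounded_inf_functions,
      length_bounded_inf_functions, length_sections, length_sections] at h3
    rw [relDim_bounded hE] at h2
    have h4 := hmax _ ⟨E, rfl⟩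
    have h5 := Divisor.degree_mono hE
    have h6 := ell_le_add hE
    obtain ⟨x, hx⟩ := ENat.ne_top_iff_exists.1 (ne_top_of_le_ne_top (ENat.natCast_ne_top _)
      (h2 ▸ le_self_add : (Adele.bounded E₀ ⊓ Adele.functions k F).relDim _ ≤ _))
    obtain ⟨y, hy⟩ := ENat.ne_top_iff_exists.1 (ne_top_of_le_ne_top (ENat.natCast_ne_top _)
      (h2 ▸ le_add_self : (Adele.bounded E₀ ⊔ Adele.functions k F).relDim _ ≤ _))
    apply Submodule.le_of_relDim_eq_zero
    rw [← hx, ← hy] at h2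
    rw [← hx] at h3
    rw [← hy]
    have h7 : (E.degree - E₀.degree).toNat = x + y := by exact_mod_cast h2
    have h8 : ell E = ell E₀ + x := by exact_mod_cast h3
    have : y = 0 := by omega
    simp [this]
  have h2 : Adele.bounded E₀ ⊔ Adele.functions k F = ⊤ := by
    refine eq_top_iff.2 fun a _ => ?_
    obtain ⟨E, hE, ha⟩ := Adele.exists_mem_bounded a E₀
    exact h1 hE (Submodule.mem_sup_left ha)
  exact ⟨E₀, fun E hE => top_le_iff.1 (h2 ▸ sup_le_sup_right (Adele.bounded_mono hE) _)⟩

/-- The first cohomology of a divisor. -/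
abbrev Cohomology (E : Divisor k F) : Type v := Adele k F ⧸ (Adele.bounded E ⊔ Adele.functions k F)

/-- Compare E with a larger divisor whose first cohomology vanishes: the Euler characteristic
changes by the difference of degrees. Passing through E ⊔ E₀ shows that the constant does not depend
on E. -/
theorem exists_length_add_eq : ∃ χ : ℤ, ∀ E : Divisor k F, Module.length k (Cohomology E) ≠ ⊤ ∧
    (ell E : ℤ) - Module.finrank k (Cohomology E) = E.degree + χ := by
  obtain ⟨E₀, hE₀⟩ := exists_bounded_sup_functions_eq_top k F
  have key (E E' : Divisor k F) (hE : E ≤ E') (hE' : E₀ ≤ E') :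
      Module.length k (Cohomology E) ≠ ⊤ ∧
      (ell E : ℤ) - Module.finrank k (Cohomology E) = E.degree + (ell E' - E'.degree) := by
    have h1 := Submodule.length_inf_add_length_quotient (Adele.bounded_mono hE)
      (Adele.functions k F)
    rw [length_bounded_inf_functions, length_bounded_inf_functions, length_sections,
      length_sections, hE₀ E' hE', Module.length_eq_zero (M := _ ⧸ (⊤ : Submodule k (Adele k F))),
      relDim_bounded hE, add_zero] at h1
    have h2 : Module.length k (Cohomology E) ≠ ⊤ := by
      refine ne_top_of_le_ne_top ?_ (le_add_self.trans h1.le)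
      exact_mod_cast ENat.natCast_ne_top _
    have := Module.finite_of_length_ne_top h2
    refine ⟨h2, ?_⟩
    rw [Module.length_eq_finrank] at h1
    have h3 : ell E' + Module.finrank k (Cohomology E) =
      ell E + (E'.degree - E.degree).toNat := by exact_mod_cast h1
    have h4 := Divisor.degree_mono hE
    omega
  refine ⟨ell E₀ - E₀.degree, fun E => ?_⟩
  obtain ⟨h1, h2⟩ := key E (E ⊔ E₀) le_sup_left le_sup_right
  obtain ⟨-, h3⟩ := key E₀ (E ⊔ E₀) le_sup_right le_sup_right
  obtain ⟨-, h4⟩ := key E₀ E₀ le_rfl le_rfl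
  exact ⟨h1, by omega⟩

instance (E : Divisor k F) : Module.Finite k (Cohomology E) :=
  Module.finite_of_length_ne_top (exists_length_add_eq.choose_spec E).1

theorem riemannRoch (E : Divisor k F) : (ell E : ℤ) - Module.finrank k (Cohomology E) =
    E.degree + (ell (0 : Divisor k F) - Module.finrank k (Cohomology (0 : Divisor k F))) := by
  obtain ⟨χ, hχ⟩ := exists_length_add_eq (k := k) (F := F)
  rw [(hχ E).2, (hχ 0).2, Divisor.degree_zero, zero_add]

end AdelicCode

end

noncomputable section

/-! ### Smith normal form -/

section Smith

variable {R : Type*} [CommRing R] {n : Type*} [Fintype n] [DecidableEq n]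

/-- The matrix of an automorphism of `R^n`. -/
def LinearEquiv.toGL (e : (n → R) ≃ₗ[R] (n → R)) : GL n R where
  val := LinearMap.toMatrix' e.toLinearMap
  inv := LinearMap.toMatrix' e.symm.toLinearMap
  val_inv := by rw [← LinearMap.toMatrix'_comp]; simp
  inv_val := by rw [← LinearMap.toMatrix'_comp]; simp

/-- The column module of A has full rank in R^n, so there is a basis b of R^n and scalars a_i such
that the vectors a_i b_i form a basis of it. M is the coordinate map of b, and N inverts the map
taking x to the coordinates of Ax in the second basis. -/
theorem Matrix.exists_smith [IsDomain R] [IsPrincipalIdealRing R] (A : Matrix n n R)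
    (hA : A.det ≠ 0) :
    ∃ (M N : GL n R) (a : n → R), M.val * A * N.val = Matrix.diagonal a := by
  have hinj : Function.Injective A.toLin' := by
    rw [← LinearMap.ker_eq_bot, LinearMap.ker_eq_bot']
    intro x hx
    by_contra h
    exact hA (Matrix.exists_mulVec_eq_zero_iff.1 ⟨x, h, hx⟩)
  let e := LinearEquiv.ofInjective A.toLin' hinj
  obtain ⟨b, a, c, hc⟩ := Submodule.exists_smith_normal_form_of_rank_eq (Pi.basisFun R n)
    (N := LinearMap.range A.toLin') e.finrank_eq.symm
  let V := e.trans c.equivFun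
  refine ⟨b.equivFun.toGL, V.symm.toGL, a, ?_⟩
  have key (x : n → R) : b.equivFun (A.toLin' x) = a * V x := by
    have h1 : A.toLin' x = ∑ i, (V x i * a i) • b i := by
      have h2 : e x = ∑ i, V x i • c i := (c.sum_equivFun (e x)).symm
      have h3 : (e x : n → R) = A.toLin' x := rfl
      rw [← h3, h2]
      simp only [Submodule.coe_sum, Submodule.coe_smul, hc, mul_smul]
    rw [h1]
    ext i
    simp [Finsupp.single_apply, mul_comm]
  change LinearMap.toMatrix' b.equivFun.toLinearMap * A * LinearMap.toMatrix' V.symm.toLinearMap = _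
  rw [← LinearMap.toMatrix'_toLin' A, ← LinearMap.toMatrix'_comp, ← LinearMap.toMatrix'_comp,
    ← LinearMap.toMatrix'_toLin' (Matrix.diagonal a)]
  congr 1
  refine LinearMap.ext fun x => ?_
  change b.equivFun (A.toLin' (V.symm x)) = _
  rw [key, LinearEquiv.apply_symm_apply]
  ext i
  simp [Matrix.mulVec_diagonal]

end Smith

namespace AdelicCode

universe u v

variable {k : Type u} {F : Type v} [Field k] [Field F] [Algebra k F]

namespace Place

theorem valued_pi (p : Place k F) : Valued.v p.pi = WithZero.exp (-1) := by
  rw [pi, valued_algebraMap, val_unif]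

theorem valued_pi_zpow (p : Place k F) (m : ℤ) : Valued.v (p.pi ^ m) = WithZero.exp (-m) := by
  rw [map_zpow₀, valued_pi, ← WithZero.exp_zsmul]
  simp

/-- An element of minimal order in a nonzero ideal divides all the others; the minimum exists
because the orders are natural numbers. -/
instance (p : Place k F) : IsPrincipalIdealRing p.integers where
  principal I := by
    by_cases hI : I = ⊥
    · rw [hI]; exact bot_isPrincipal
    obtain ⟨x₀, hx₀, hx₀0⟩ := Submodule.exists_mem_ne_zero_of_ne_bot hI
    have hval (x : p.integers) (hx : x ≠ 0) :
        ∃ n : ℕ, Valued.v (x : p.Compl) = WithZero.exp (-n : ℤ) := by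
      have h0 : Valued.v (x : p.Compl) ≠ 0 := by simpa using hx
      have h1 : Valued.v (x : p.Compl) ≤ 1 := x.2
      rw [← WithZero.exp_log h0, ← WithZero.exp_zero, WithZero.exp_le_exp] at h1
      refine ⟨(-WithZero.log (Valued.v (x : p.Compl))).toNat, ?_⟩
      rw [Int.toNat_of_nonneg (by omega), neg_neg, WithZero.exp_log h0]
    classical
    have hex : ∃ n : ℕ, ∃ x ∈ I, Valued.v (x : p.Compl) = WithZero.exp (-n : ℤ) :=
      (hval x₀ hx₀0).imp fun n hn => ⟨x₀, hx₀, hn⟩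
    obtain ⟨x, hxI, hx⟩ := Nat.find_spec hex
    refine ⟨x, le_antisymm (fun y hy => ?_) ((Ideal.span_singleton_le_iff_mem I).2 hxI)⟩
    have hx0 : (x : p.Compl) ≠ 0 := by
      intro h
      rw [h, map_zero] at hx
      exact WithZero.exp_ne_zero hx.symm
    refine Ideal.mem_span_singleton.2 ⟨⟨(y : p.Compl) / x, ?_⟩, Subtype.ext
      (mul_div_cancel₀ _ hx0).symm⟩
    rw [mem_integers, map_div₀]
    refine div_le_one_of_le₀ ?_ zero_le
    by_cases hy0 : y = 0
    · simp [hy0]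
    · obtain ⟨n, hn⟩ := hval y hy0
      rw [hn, hx, WithZero.exp_le_exp]
      have := Nat.find_min' hex ⟨y, hy, hn⟩
      omega

theorem valued_det_integers (p : Place k F) {r : ℕ} (M : GL (Fin r) p.integers) :
    Valued.v (M.val.map p.integers.subtype).det = 1 := by
  have h (M : GL (Fin r) p.integers) : Valued.v (M.val.map p.integers.subtype).det ≤ 1 := by
    rw [← RingHom.mapMatrix_apply, ← RingHom.map_det]
    exact M.val.det.2
  have h2 : (M.val.map p.integers.subtype).det * ((M⁻¹).val.map p.integers.subtype).det = 1 := by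
    rw [← Matrix.det_mul, ← Matrix.map_mul, ← Units.val_mul, mul_inv_cancel]
    simp
  have h3 := congrArg (Valued.v (R := p.Compl)) h2
  rw [map_mul, map_one] at h3
  refine le_antisymm (h M) ?_
  rw [← h3]
  exact mul_le_of_le_one_right' (h M⁻¹)

/-- Multiply A by a power of the local parameter to clear denominators, use Smith normal form over
the principal ideal ring O_p, and scale back. -/
theorem exists_smith (p : Place k F) {r : ℕ} (A : GL (Fin r) p.Compl) :
    ∃ (M N : GL (Fin r) p.integers) (d : Fin r → p.Compl), (∀ i, d i ≠ 0) ∧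
      M.val.map p.integers.subtype * A.val * N.val.map p.integers.subtype = Matrix.diagonal d := by
  choose m hm using fun x : Fin r × Fin r => p.exists_valued_le (A.val x.1 x.2)
  obtain ⟨m₀, hm₀⟩ : ∃ m₀ : ℤ, ∀ x, m x ≤ m₀ := by
    obtain ⟨m₀, hm₀⟩ := (Set.finite_range m).bddAbove
    exact ⟨m₀, fun x => hm₀ ⟨x, rfl⟩⟩
  have hint (i j : Fin r) : p.pi ^ m₀ * A.val i j ∈ p.integers := by
    rw [mem_integers, map_mul, valued_pi_zpow]
    calc _ ≤ WithZero.exp (-m₀) * WithZero.exp m₀ :=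
          mul_le_mul_right (p.complBall_mono (hm₀ (i, j)) (hm (i, j))) _
      _ = 1 := by rw [← WithZero.exp_add, neg_add_cancel, WithZero.exp_zero]
  let B : Matrix (Fin r) (Fin r) p.integers := Matrix.of fun i j => ⟨_, hint i j⟩
  have hB : B.map p.integers.subtype = p.pi ^ m₀ • A.val := rfl
  have hA : A.val.det ≠ 0 := ((Matrix.isUnit_iff_isUnit_det _).1 A.isUnit).ne_zero
  have hdet : B.det ≠ 0 := by
    intro h
    have h1 : (B.map p.integers.subtype).det = 0 := by
      rw [← RingHom.mapMatrix_apply, ← RingHom.map_det, h, map_zero]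
    rw [hB, Matrix.det_smul] at h1
    exact mul_ne_zero (pow_ne_zero _ (zpow_ne_zero _ p.pi_ne_zero)) hA h1
  obtain ⟨M, N, a, h⟩ := B.exists_smith hdet
  have h' := congrArg (fun X => Matrix.map X p.integers.subtype) h
  simp only [Matrix.map_mul, hB] at h'
  have hfin : M.val.map p.integers.subtype * A.val * N.val.map p.integers.subtype =
      Matrix.diagonal fun i => p.pi ^ (-m₀) * (a i : p.Compl) := by
    have h1 : A.val = p.pi ^ (-m₀) • (p.pi ^ m₀ • A.val) := by
      rw [smul_smul, ← zpow_add₀ p.pi_ne_zero, neg_add_cancel, zpow_zero, one_smul]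
    rw [h1, Matrix.mul_smul, Matrix.smul_mul, h']
    ext i j
    simp [Matrix.diagonal_apply]
  refine ⟨M, N, _, fun i hi => ?_, hfin⟩
  have h2 := congrArg (fun X => Valued.v (Matrix.det X)) hfin
  simp only [Matrix.det_mul, map_mul, valued_det_integers, Matrix.det_diagonal, one_mul,
    mul_one] at h2
  rw [Finset.prod_eq_zero (Finset.mem_univ i) hi, map_zero, map_eq_zero] at h2
  exact hA h2

end Place

/-! ### Integral matrices -/

variable {r : ℕ}

theorem component_val (g : GL (Fin r) (Adele k F)) (p : Place k F) (i j : Fin r) :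
    (component g p).val i j = g.val i j p := rfl

theorem component_mul (g h : GL (Fin r) (Adele k F)) (p : Place k F) :
    component (g * h) p = component g p * component h p := map_mul _ g h

theorem component_inv (g : GL (Fin r) (Adele k F)) (p : Place k F) :
    component g⁻¹ p = (component g p)⁻¹ := map_inv _ g

theorem mulVec_apply (g : GL (Fin r) (Adele k F)) (a : Fin r → Adele k F) (p : Place k F)
    (j : Fin r) : g.val.mulVec a j p = (component g p).val.mulVec (fun i => a i p) j := by
  change Adele.eval p (g.val.mulVec a j) = _
  simp only [Matrix.mulVec, dotProduct, map_sum, map_mul]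
  rfl

/-- `A ∈ GL_r(F_p)` lies in `GL_r(O_p)`. -/
def IsIntegralAt (p : Place k F) (A : GL (Fin r) p.Compl) : Prop :=
  ∃ M : GL (Fin r) p.integers, M.val.map p.integers.subtype = A.val

theorem isIntegralAt_of_entries {p : Place k F} {A : GL (Fin r) p.Compl}
    (h : ∀ i j, A.val i j ∈ p.integers) (h' : ∀ i j, A⁻¹.val i j ∈ p.integers) :
    IsIntegralAt p A := by
  have hinj : Function.Injective fun X : Matrix (Fin r) (Fin r) p.integers =>
      X.map p.integers.subtype := Matrix.map_injective Subtype.val_injective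
  refine ⟨⟨Matrix.of fun i j => ⟨_, h i j⟩, Matrix.of fun i j => ⟨_, h' i j⟩, hinj ?_, hinj ?_⟩,
    rfl⟩
  · simp only [Matrix.map_mul]
    refine (A.val_inv : A.val * A⁻¹.val = 1).trans ?_
    simp
  · simp only [Matrix.map_mul]
    refine (A.inv_val : A⁻¹.val * A.val = 1).trans ?_
    simp

theorem finite_not_isIntegralAt (g : GL (Fin r) (Adele k F)) :
    {p | ¬ IsIntegralAt p (component g p)}.Finite := by
  have h1 : (⋃ i, ⋃ j, {p : Place k F | g.val i j p ∉ p.integers} ∪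
      {p : Place k F | g⁻¹.val i j p ∉ p.integers}).Finite :=
    Set.finite_iUnion fun i => Set.finite_iUnion fun j =>
      (g.val i j).finite_not_integral.union (g⁻¹.val i j).finite_not_integral
  refine h1.subset fun p hp => ?_
  by_contra h
  simp only [Set.mem_iUnion, Set.mem_union, Set.mem_ofPred_eq, not_exists, not_or, not_not] at h
  refine hp (isIntegralAt_of_entries (fun i j => (h i j).1) fun i j => ?_)
  rw [← component_inv]
  exact (h i j).2

namespace IsIntegralAt

theorem mulVec_mem {p : Place k F} {A : GL (Fin r) p.Compl} (hA : IsIntegralAt p A)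
    {m : ℤ} {x : Fin r → p.Compl} (hx : ∀ i, x i ∈ p.complBall m) (j : Fin r) :
    A.val.mulVec x j ∈ p.complBall m := by
  obtain ⟨M, hM⟩ := hA
  rw [← hM]
  rw [Matrix.mulVec, dotProduct]
  refine (p.complBall m).sum_mem fun i _ => ?_
  rw [Place.mem_complBall, map_mul]
  exact (mul_le_of_le_one_left' (M.val j i).2).trans (hx i)

theorem inv {p : Place k F} {A : GL (Fin r) p.Compl} (hA : IsIntegralAt p A) :
    IsIntegralAt p A⁻¹ := by
  obtain ⟨M, hM⟩ := hA
  have h : Matrix.GeneralLinearGroup.map p.integers.subtype M = A := Units.ext hM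
  refine ⟨M⁻¹, ?_⟩
  rw [← h, ← map_inv]
  rfl

theorem mulVec_mem_iff {p : Place k F} {A : GL (Fin r) p.Compl} (hA : IsIntegralAt p A)
    {m : ℤ} {x : Fin r → p.Compl} :
    (∀ j, A.val.mulVec x j ∈ p.complBall m) ↔ ∀ i, x i ∈ p.complBall m := by
  refine ⟨fun h i => ?_, fun h => hA.mulVec_mem h⟩
  have := hA.inv.mulVec_mem h i
  rwa [Matrix.mulVec_mulVec, ← Units.val_mul, inv_mul_cancel, Units.val_one,
    Matrix.one_mulVec] at this

theorem valued_det {p : Place k F} {A : GL (Fin r) p.Compl} (hA : IsIntegralAt p A) :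
    Valued.v A.val.det = 1 := by
  obtain ⟨M, hM⟩ := hA
  rw [← hM]
  exact p.valued_det_integers M

theorem one (p : Place k F) : IsIntegralAt p (1 : GL (Fin r) p.Compl) :=
  ⟨1, by simp⟩

end IsIntegralAt

theorem Place.mem_complBall_zero {p : Place k F} {x : p.Compl} :
    x ∈ p.complBall 0 ↔ x ∈ p.integers := by
  rw [mem_complBall, WithZero.exp_zero, mem_integers]

/-- An idelic matrix with given integral components. -/
theorem exists_integral_components (N : ∀ p : Place k F, GL (Fin r) p.Compl)
    (hN : ∀ p, IsIntegralAt p (N p)) :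
    ∃ h : GL (Fin r) (Adele k F), ∀ p, component h p = N p := by
  have hint (p : Place k F) (A : GL (Fin r) p.Compl) (hA : IsIntegralAt p A) (i j : Fin r) :
      A.val i j ∈ p.integers := by
    obtain ⟨M, hM⟩ := hA
    rw [← hM]
    exact (M.val i j).2
  have hmem (z : ∀ p : Place k F, p.Compl) (hz : ∀ p, z p ∈ p.integers) :
      ∀ᶠ p in Filter.cofinite, z p ∈ (p.integers : Set p.Compl) := Filter.Eventually.of_forall hz
  let mk (X : ∀ p : Place k F, GL (Fin r) p.Compl) (hX : ∀ p, IsIntegralAt p (X p)) :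
    Matrix (Fin r) (Fin r) (Adele k F) := Matrix.of fun i j =>
      ⟨fun p => (X p).val i j, hmem _ fun p => hint p _ (hX p) i j⟩
  have hmul (X Y : ∀ p : Place k F, GL (Fin r) p.Compl) (hX : ∀ p, IsIntegralAt p (X p))
      (hY : ∀ p, IsIntegralAt p (Y p)) (hXY : ∀ p, X p * Y p = 1) : mk X hX * mk Y hY = 1 := by
    ext i j p
    have h1 : ((mk X hX * mk Y hY) i j) p = ((X p).val * (Y p).val) i j := by
      change Adele.eval p _ = _
      simp only [Matrix.mul_apply, map_sum, map_mul]
      rfl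
    rw [h1, ← Units.val_mul, hXY, Units.val_one, Matrix.one_apply, Matrix.one_apply]
    split_ifs <;> rfl
  have hN' (p : Place k F) : IsIntegralAt p (N p)⁻¹ := (hN p).inv
  exact ⟨⟨mk N hN, mk (fun p => (N p)⁻¹) hN', hmul N _ hN hN' fun p => mul_inv_cancel _,
    hmul _ N hN' hN fun p => inv_mul_cancel _⟩, fun p => Units.ext rfl⟩

/-! ### The Riemann-Roch theorem in higher rank -/

theorem degree_one : degree (1 : GL (Fin r) (Adele k F)) = 0 := by
  have h (p : Place k F) : component (1 : GL (Fin r) (Adele k F)) p = 1 := map_one _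
  simp [degree, h, Place.ord]

variable [IsFunctionField k F]

/-- The action of an idelic matrix on `𝔸^r`. -/
def mulVecEquiv (g : GL (Fin r) (Adele k F)) :
    (Fin r → Adele k F) ≃ₗ[k] (Fin r → Adele k F) where
  toFun a := g.val.mulVec a
  invFun a := g⁻¹.val.mulVec a
  map_add' a b := Matrix.mulVec_add _ _ _
  map_smul' c a := Matrix.mulVec_smul _ _ _
  left_inv a := by
    change g⁻¹.val.mulVec (g.val.mulVec a) = a
    rw [Matrix.mulVec_mulVec, ← Units.val_mul, inv_mul_cancel, Units.val_one, Matrix.one_mulVec]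
  right_inv a := by
    change g.val.mulVec (g⁻¹.val.mulVec a) = a
    rw [Matrix.mulVec_mulVec, ← Units.val_mul, mul_inv_cancel, Units.val_one, Matrix.one_mulVec]

theorem mem_adelicSpace {g : GL (Fin r) (Adele k F)} {a : Fin r → Adele k F} :
    a ∈ adelicSpace g ↔ ∀ p j,
      (component g p).val.mulVec (fun i => a i p) j ∈ p.complBall 0 := by
  simp only [← mulVec_apply, Place.mem_complBall_zero]
  exact forall_comm

theorem map_mulVecEquiv_pi_bounded (h : GL (Fin r) (Adele k F))
    (hh : ∀ p, IsIntegralAt p (component h p)) (E : Divisor k F) :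
    (Submodule.pi Set.univ fun _ : Fin r => Adele.bounded E).map (mulVecEquiv h).toLinearMap =
      Submodule.pi Set.univ fun _ : Fin r => Adele.bounded E := by
  have key (h : GL (Fin r) (Adele k F)) (hh : ∀ p, IsIntegralAt p (component h p))
      {a : Fin r → Adele k F} (ha : a ∈ Submodule.pi Set.univ fun _ : Fin r => Adele.bounded E) :
      mulVecEquiv h a ∈ Submodule.pi Set.univ fun _ : Fin r => Adele.bounded E := by
    refine fun j _ => Adele.mem_bounded.2 fun p => ?_
    change Valued.v (h.val.mulVec a j p) ≤ _
    rw [mulVec_apply]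
    exact (hh p).mulVec_mem (fun i => Adele.mem_bounded.1 (ha i trivial) p) j
  apply le_antisymm
  · rintro _ ⟨a, ha, rfl⟩
    exact key h hh ha
  · intro a ha
    refine ⟨mulVecEquiv h⁻¹ a, key h⁻¹ (fun p => ?_) ha, (mulVecEquiv h).apply_symm_apply a⟩
    rw [component_inv]
    exact (hh p).inv

/-- Locally g_p = M diag(d) N⁻¹ with M and N integral. M preserves O_p^r, so it does not affect the
lattice; the N_p assemble to h, and the orders of the d_j give the divisors E_j. Only the d_j
contribute to the order of det g_p, whence the degree. -/
theorem exists_adelicSpace_eq (g : GL (Fin r) (Adele k F)) :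
    ∃ (h : GL (Fin r) (Adele k F)) (E : Fin r → Divisor k F),
      (∀ p, IsIntegralAt p (component h p)) ∧ degree g = ∑ j, (E j).degree ∧
      adelicSpace g = (Submodule.pi Set.univ fun j => Adele.bounded (E j)).map
        (mulVecEquiv h).toLinearMap := by
  classical
  -- The last clause, e = 0 wherever g_p is already integral, is what gives the E_j finite support.
  have hloc (p : Place k F) : ∃ (M N : GL (Fin r) p.Compl) (e : Fin r → ℤ)
      (d : Fin r → p.Compl), IsIntegralAt p M ∧ IsIntegralAt p N ∧
      (∀ j, Valued.v (d j) = WithZero.exp (-e j)) ∧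
      (component g p).val = M.val * Matrix.diagonal d * N⁻¹.val ∧
      (IsIntegralAt p (component g p) → e = 0) := by
    by_cases hg : IsIntegralAt p (component g p)
    · refine ⟨component g p, 1, 0, 1, hg, IsIntegralAt.one p, by simp, by simp, fun _ => rfl⟩
    · obtain ⟨M, N, d, hd, h⟩ := p.exists_smith (component g p)
      set M' : GL (Fin r) p.Compl := Matrix.GeneralLinearGroup.map p.integers.subtype M
      set N' : GL (Fin r) p.Compl := Matrix.GeneralLinearGroup.map p.integers.subtype N
      have h' : M'.val * (component g p).val * N'.val = Matrix.diagonal d := h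
      have hM : IsIntegralAt p M' := ⟨M, rfl⟩
      refine ⟨M'⁻¹, N', fun j => -WithZero.log (Valued.v (d j)), d, hM.inv, ⟨N, rfl⟩,
        fun j => ?_, ?_, fun h => absurd h hg⟩
      · rw [neg_neg, WithZero.exp_log (by simpa using hd j)]
      · rw [← h']
        simp only [← Units.val_mul]
        congr 1
        group
  choose M N e d hM hN hd hg he using hloc
  obtain ⟨h, hh⟩ := exists_integral_components N hN
  have hfin (j : Fin r) : (Function.support fun p => e p j).Finite :=
    (finite_not_isIntegralAt g).subset fun p hp hint => hp (by simp [he p hint])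
  refine ⟨h, fun j => Finsupp.ofSupportFinite (fun p => e p j) (hfin j),
    fun p => (hh p).symm ▸ hN p, ?_, ?_⟩
  · have hord (p : Place k F) : p.ord (component g p).val.det = ∑ j, e p j := by
      rw [hg p, Matrix.det_mul, Matrix.det_mul, Place.ord, map_mul, map_mul, (hM p).valued_det,
        (hN p).inv.valued_det, Matrix.det_diagonal, map_prod, one_mul, mul_one,
        Finset.prod_congr rfl fun j _ => hd p j]
      have : ∀ s : Finset (Fin r), -WithZero.log (∏ j ∈ s, WithZero.exp (-e p j)) =
          ∑ j ∈ s, e p j := by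
        intro s
        induction s using Finset.induction_on with
        | empty => simp
        | insert a s ha ih =>
          rw [Finset.prod_insert ha, Finset.sum_insert ha, WithZero.log_mul WithZero.exp_ne_zero
            (Finset.prod_ne_zero_iff.2 fun _ _ => WithZero.exp_ne_zero), neg_add, ih]
          simp
      exact this _
    set G : Divisor k F := ∑ j, Finsupp.ofSupportFinite (fun p => e p j) (hfin j) with hG
    have hGp (p : Place k F) : G p = ∑ j, e p j := by
      rw [hG, Finsupp.finsetSum_apply]
      rfl
    rw [← Divisor.degree_sum, ← hG, Divisor.degree_eq_sum _ subset_rfl, degree]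
    simp only [hord, ← hGp]
    refine finsum_eq_sum_of_support_subset _ fun p hp => ?_
    simp only [Function.mem_support, ne_eq, mul_eq_zero, not_or] at hp
    simpa using hp.1
  · have key (a : Fin r → Adele k F) : a ∈ adelicSpace g ↔
        mulVecEquiv h⁻¹ a ∈ Submodule.pi Set.univ fun j => Adele.bounded
          (Finsupp.ofSupportFinite (fun p => e p j) (hfin j)) := by
      rw [mem_adelicSpace, Submodule.mem_pi]
      simp only [Set.mem_univ, true_imp_iff, Adele.mem_bounded]
      rw [forall_comm (α := Fin r)]
      refine forall_congr' fun p => ?_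
      have h1 (j : Fin r) : (mulVecEquiv h⁻¹ a) j p = (N p)⁻¹.val.mulVec (fun i => a i p) j := by
        change h⁻¹.val.mulVec a j p = _
        rw [mulVec_apply, component_inv, hh]
      rw [hg p, ← Matrix.mulVec_mulVec, ← Matrix.mulVec_mulVec]
      simp only [(hM p).mulVec_mem_iff, h1, Matrix.mulVec_diagonal]
      refine forall_congr' fun j => ?_
      rw [Place.mem_complBall, map_mul, hd]
      have h2 : (Finsupp.ofSupportFinite (fun p => e p j) (hfin j)) p = e p j := rfl
      rw [h2, WithZero.exp_zero, WithZero.exp_neg]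
      exact inv_mul_le_one₀ WithZero.exp_pos
    ext a
    rw [key]
    constructor
    · exact fun ha => ⟨_, ha, (mulVecEquiv h).apply_symm_apply a⟩
    · rintro ⟨b, hb, rfl⟩
      change (mulVecEquiv h).symm (mulVecEquiv h b) ∈ _
      rwa [LinearEquiv.symm_apply_apply]

theorem range_diagonal : LinearMap.range (diagonal k F r) =
    Submodule.pi Set.univ fun _ : Fin r => Adele.functions k F := by
  ext a
  constructor
  · rintro ⟨f, rfl⟩ j -
    exact ⟨f j, rfl⟩
  · intro ha
    choose f hf using fun j => ha j trivial
    exact ⟨f, funext hf⟩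

theorem diagonal_injective : Function.Injective (diagonal k F r) := fun _ _ h =>
  funext fun j => (algebraMap F (Adele k F)).injective (congrFun h j)

theorem length_H0 (g : GL (Fin r) (Adele k F)) : Module.length k (H0 g) =
    Module.length k (adelicSpace g ⊓ LinearMap.range (diagonal k F r) :
      Submodule k (Fin r → Adele k F)) := by
  rw [inf_comm, ← Submodule.map_comap_eq]
  exact (Submodule.equivMapOfInjective _ diagonal_injective (H0 g)).length_eq

/-- Compare 𝔸^r(g) with a smaller box L₀ = 𝔸(E₀)^r. The Euler characteristic of L₀ is r times that
of E₀, and the correction is the relative dimension of the two spaces. -/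
theorem finite_and_riemannRoch (g : GL (Fin r) (Adele k F)) :
    Module.length k (H0 g) ≠ ⊤ ∧ Module.length k (H1 g) ≠ ⊤ ∧ (h0 g : ℤ) - h1 g =
      degree g + r * (ell (0 : Divisor k F) - Module.finrank k (Cohomology (0 : Divisor k F))) := by
  obtain ⟨h, E, hh, hdeg, hE⟩ := exists_adelicSpace_eq g
  set W := LinearMap.range (diagonal k F r) with hW
  obtain ⟨E₀, hE₀⟩ : ∃ E₀, ∀ j, E₀ ≤ E j := by
    obtain ⟨E₀, h⟩ := (Set.finite_range E).bddBelow
    exact ⟨E₀, fun j => h ⟨j, rfl⟩⟩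
  set L₀ := Submodule.pi Set.univ fun _ : Fin r => Adele.bounded E₀ with hL₀
  -- As h is integral everywhere, it maps L₀ onto itself; so the comparison can be made before
  -- applying h, coordinate by coordinate.
  have hle : L₀ ≤ adelicSpace g := by
    rw [hE, hL₀, ← map_mulVecEquiv_pi_bounded h hh]
    exact Submodule.map_mono (Submodule.pi_mono fun j _ => Adele.bounded_mono (hE₀ j))
  have hrel : Submodule.relDim L₀ (adelicSpace g) =
      (∑ j, ((E j).degree - E₀.degree).toNat : ℕ) := by
    rw [hE, hL₀, ← map_mulVecEquiv_pi_bounded h hh, Submodule.relDim_map_equiv,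
      Submodule.relDim_pi, Nat.cast_sum]
    exact Finset.sum_congr rfl fun j _ => relDim_bounded (hE₀ j)
  have h1 := Submodule.length_inf_add_length_quotient hle W
  have h2 : Module.length k (L₀ ⊓ W : Submodule k (Fin r → Adele k F)) = (r * ell E₀ : ℕ) := by
    have : L₀ ⊓ W = Submodule.pi Set.univ fun _ : Fin r =>
        Adele.bounded E₀ ⊓ Adele.functions k F := by
      rw [hW, range_diagonal]
      ext a
      simp [L₀, forall_and]
    have hbot : (⊥ : Submodule k (Fin r → Adele k F)) = Submodule.pi Set.univ fun _ => ⊥ := by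
      ext a
      simp [funext_iff]
    rw [this, ← Submodule.relDim_bot, hbot, Submodule.relDim_pi]
    simp [Submodule.relDim_bot, length_bounded_inf_functions, length_sections]
  have h3 : Module.length k ((Fin r → Adele k F) ⧸ L₀ ⊔ W) =
      (r * Module.finrank k (Cohomology E₀) : ℕ) := by
    have : L₀ ⊔ W = Submodule.pi Set.univ fun _ : Fin r =>
        Adele.bounded E₀ ⊔ Adele.functions k F := by
      rw [hW, range_diagonal]
      apply le_antisymm
      · exact sup_le (Submodule.pi_mono fun _ _ => le_sup_left)
          (Submodule.pi_mono fun _ _ => le_sup_right)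
      · intro a ha
        choose x hx y hy hxy using fun j => Submodule.mem_sup.1 (ha j trivial)
        rw [← funext hxy]
        exact Submodule.add_mem_sup (fun j _ => hx j) (fun j _ => hy j)
    have htop : (⊤ : Submodule k (Fin r → Adele k F)) = Submodule.pi Set.univ fun _ => ⊤ := by
      ext a
      simp
    rw [this, ← Submodule.relDim_top, htop, Submodule.relDim_pi]
    simp [Submodule.relDim_top, Module.length_eq_finrank]
  rw [h2, h3, hrel, ← length_H0] at h1
  have hH1 : Module.length k (H1 g) ≠ ⊤ := by
    refine ne_top_of_le_ne_top ?_ (Module.length_le_of_surjective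
      (Submodule.factor (sup_le_sup_right hle W)) (Submodule.factor_surjective _))
    rw [h3]
    exact ENat.natCast_ne_top _
  have := Module.finite_of_length_ne_top hH1
  have hH0 : Module.length k (H0 g) ≠ ⊤ := by
    refine ne_top_of_le_ne_top ?_ (le_self_add.trans h1.le)
    rw [Module.length_eq_finrank]
    exact_mod_cast ENat.natCast_ne_top _
  have := Module.finite_of_length_ne_top hH0
  refine ⟨hH0, hH1, ?_⟩
  rw [Module.length_eq_finrank, Module.length_eq_finrank] at h1
  have h4 : h0 g + r * Module.finrank k (Cohomology E₀) =
      r * ell E₀ + AdelicCode.h1 g + ∑ j, ((E j).degree - E₀.degree).toNat := by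
    exact_mod_cast h1
  have h5 := riemannRoch E₀
  zify at h4
  rw [Finset.sum_congr rfl fun j _ =>
    Int.toNat_of_nonneg (sub_nonneg.2 (Divisor.degree_mono (hE₀ j))), Finset.sum_sub_distrib,
    ← hdeg, Finset.sum_const, Finset.card_univ, Fintype.card_fin, nsmul_eq_mul] at h4
  linear_combination h4 + r * h5

instance (g : GL (Fin r) (Adele k F)) : Module.Finite k (H0 g) :=
  Module.finite_of_length_ne_top (finite_and_riemannRoch g).1

instance (g : GL (Fin r) (Adele k F)) : Module.Finite k (H1 g) :=
  Module.finite_of_length_ne_top (finite_and_riemannRoch g).2.1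

/-- The case r = 1, g = 1 of Riemann-Roch; it identifies the genus, defined through matrices, with
the constant in the version for divisors. -/
theorem genus_eq : genus k F =
    1 - (ell (0 : Divisor k F) - Module.finrank k (Cohomology (0 : Divisor k F))) := by
  have := (finite_and_riemannRoch (1 : GL (Fin 1) (Adele k F))).2.2
  rw [degree_one] at this
  rw [genus]
  push_cast at this
  linarith

theorem h0_sub_h1 (g : GL (Fin r) (Adele k F)) :
    (h0 g : ℤ) - h1 g = degree g - r * (genus k F - 1) := by
  rw [(finite_and_riemannRoch g).2.2, genus_eq]
  ring

theorem ell_sub_finrank_cohomology (E : Divisor k F) :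
    (ell E : ℤ) - Module.finrank k (Cohomology E) = E.degree - (genus k F - 1) := by
  rw [riemannRoch, genus_eq]
  ring

end AdelicCode

end

noncomputable section

namespace AdelicCode

universe u v

variable {k : Type u} {F : Type v} [Field k] [Field F] [Algebra k F]

/-! ### Adeles supported at finitely many places -/

namespace Adele

theorem single_add (p : Place k F) (x y : p.Compl) :
    single p (x + y) = single p x + single p y := by
  ext q
  rw [add_apply]
  by_cases h : q = p
  · subst h; simp only [single_apply_same]
  · simp only [single_apply_ne h, add_zero]

theorem mul_single (a : Adele k F) (p : Place k F) (x : p.Compl) :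
    a * single p x = single p (a p * x) := by
  ext q
  rw [mul_apply]
  by_cases h : q = p
  · subst h; simp only [single_apply_same]
  · simp only [single_apply_ne h, mul_zero]

/-- The adeles supported at `p`, as an additive map. -/
def singleHom (p : Place k F) : p.Compl →+ Adele k F := AddMonoidHom.mk' (single p) (single_add p)

theorem sum_single (S : Finset (Place k F)) (z : ∀ p : Place k F, p.Compl) :
    ∑ p ∈ S, single p (z p) = ofFinset S z := by
  classical
  ext q
  change Adele.eval q _ = _
  rw [map_sum]
  change ∑ p ∈ S, single p (z p) q = _
  by_cases hq : q ∈ S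
  · rw [ofFinset_apply_of_mem _ hq, Finset.sum_eq_single_of_mem q hq fun p _ hp =>
      single_apply_ne hp.symm _, single_apply_same]
  · rw [ofFinset_apply_of_notMem _ hq]
    exact Finset.sum_eq_zero fun p hp => single_apply_ne (by rintro rfl; exact hq hp) _

variable [IsFunctionField k F]

theorem single_mem_bounded {E : Divisor k F} {p : Place k F} {x : p.Compl}
    (hx : x ∈ p.complBall (E p)) : single p x ∈ bounded E := by
  refine mem_bounded.2 fun q => ?_
  by_cases h : q = p
  · subst h; rwa [single_apply_same]
  · rw [single_apply_ne h]; simp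

theorem smul_single (p : Place k F) (c : k) (x : p.Compl) :
    c • single p x = single p (c • x) := by
  rw [Algebra.smul_def, mul_single, Algebra.smul_def]
  rfl

end Adele

/-! ### Weil differentials -/

variable [IsFunctionField k F]

/-- The differentials vanishing on the adeles bounded by `E`. -/
def differentialsBounded (E : Divisor k F) : Submodule k (Module.Dual k (Adele k F)) :=
  (Adele.bounded E ⊔ Adele.functions k F).dualAnnihilator

theorem mem_differentialsBounded {E : Divisor k F} {ω : Module.Dual k (Adele k F)} :
    ω ∈ differentialsBounded E ↔ (∀ a ∈ Adele.bounded E, ω a = 0) ∧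
      ∀ f : F, ω (algebraMap F (Adele k F) f) = 0 := by
  rw [differentialsBounded, Submodule.dualAnnihilator_sup_eq, Submodule.mem_inf,
    Submodule.mem_dualAnnihilator, Submodule.mem_dualAnnihilator]
  refine and_congr_right fun _ => ⟨fun h f => h _ ⟨f, rfl⟩, ?_⟩
  rintro h _ ⟨f, rfl⟩
  exact h f

theorem finrank_differentialsBounded (E : Divisor k F) :
    Module.finrank k (differentialsBounded E) = Module.finrank k (Cohomology E) := by
  rw [differentialsBounded, ← (Submodule.dualQuotEquivDualAnnihilator _).finrank_eq]
  exact Subspace.dual_finrank_eq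

instance (E : Divisor k F) : Module.Finite k (differentialsBounded E) :=
  Module.Finite.equiv (Submodule.dualQuotEquivDualAnnihilator
    (Adele.bounded E ⊔ Adele.functions k F))

theorem mem_differentials_iff {ω : Module.Dual k (Adele k F)} :
    ω ∈ Differentials k F ↔ ∃ E, ω ∈ differentialsBounded E := by
  simp only [mem_differentialsBounded, Adele.mem_bounded]
  constructor
  · rintro ⟨h, E, hE⟩
    exact ⟨E, hE, h⟩
  · rintro ⟨E, hE, h⟩
    exact ⟨h, E, hE⟩

theorem differentialsBounded_anti {E E' : Divisor k F} (h : E ≤ E') :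
    differentialsBounded E' ≤ differentialsBounded E :=
  Submodule.dualAnnihilator_anti (sup_le_sup_right (Adele.bounded_mono h) _)

theorem fmul_apply (f : F) (ω : Module.Dual k (Adele k F)) (a : Adele k F) :
    fmul f ω a = ω (algebraMap F (Adele k F) f * a) := rfl

/-- The products of a fixed differential with functions. -/
def fmulₗ (ω : Module.Dual k (Adele k F)) : F →ₗ[k] Module.Dual k (Adele k F) where
  toFun f := fmul f ω
  map_add' f f' := by ext a; simp [fmul_apply, add_mul]
  map_smul' c f := by
    ext a
    have : algebraMap F (Adele k F) (c • f) = c • algebraMap F (Adele k F) f :=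
      map_smul (IsScalarTower.toAlgHom k F (Adele k F)) c f
    simp [fmul_apply, this]

theorem fmul_fmul (f f' : F) (ω : Module.Dual k (Adele k F)) :
    fmul f (fmul f' ω) = fmul (f' * f) ω := by
  ext a
  change ω (algebraMap F (Adele k F) f' * (algebraMap F (Adele k F) f * a)) = _
  rw [fmul_apply, map_mul (algebraMap F (Adele k F)), mul_assoc]

theorem fmul_one (ω : Module.Dual k (Adele k F)) : fmul 1 ω = ω := by
  ext a
  rw [fmul_apply, map_one, one_mul]

theorem eq_zero_of_fmul_eq_zero {f : F} {ω : Module.Dual k (Adele k F)} (hω : ω ≠ 0)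
    (h : fmul f ω = 0) : f = 0 := by
  by_contra hf
  apply hω
  rw [← fmul_one ω, ← mul_inv_cancel₀ hf, ← fmul_fmul, h]
  rfl

theorem mul_mem_bounded {E E' : Divisor k F} {f : F} (hf : f ∈ sections E) {a : Adele k F}
    (ha : a ∈ Adele.bounded E') : algebraMap F (Adele k F) f * a ∈ Adele.bounded (E + E') := by
  rw [Adele.mem_bounded] at *
  intro p
  rw [Adele.mul_apply, map_mul, Adele.algebraMap_apply, Place.valued_algebraMap,
    Finsupp.add_apply, WithZero.exp_add]
  exact mul_le_mul' (mem_sections.1 hf p) (ha p)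

theorem fmul_mem_differentialsBounded {E G : Divisor k F} {ω : Module.Dual k (Adele k F)}
    (hω : ω ∈ differentialsBounded E) {f : F} (hf : f ∈ sections G) :
    fmul f ω ∈ differentialsBounded (E - G) := by
  rw [mem_differentialsBounded] at *
  refine ⟨fun a ha => hω.1 _ ?_, fun h => ?_⟩
  · have := mul_mem_bounded hf ha
    rwa [add_sub_cancel] at this
  · rw [fmul_apply, ← map_mul]
    exact hω.2 _

/-- Multiplication of a differential by the sections of a divisor. -/
def fmulBounded {E : Divisor k F} {ω : Module.Dual k (Adele k F)}
    (hω : ω ∈ differentialsBounded E) (G : Divisor k F) :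
    sections G →ₗ[k] differentialsBounded (E - G) :=
  ((fmulₗ ω).domRestrict (sections G)).codRestrict _
    fun f => fmul_mem_differentialsBounded hω f.2

/-- Multiplication of ω by functions embeds the sections of G into the dual of the cohomology of E -
G. -/
theorem ell_le_finrank_cohomology {E : Divisor k F} {ω : Module.Dual k (Adele k F)} (hω0 : ω ≠ 0)
    (hω : ω ∈ differentialsBounded E) (G : Divisor k F) :
    ell G ≤ Module.finrank k (Cohomology (E - G)) := by
  rw [← finrank_differentialsBounded]
  refine LinearMap.finrank_le_finrank_of_injective (f := fmulBounded hω G)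
    ((injective_iff_map_eq_zero _).2 fun f hf => ?_)
  exact Subtype.ext (eq_zero_of_fmul_eq_zero hω0 (congrArg Subtype.val hf))

-- Take G = E in the preceding embedding: ℓ(E) ≤ h¹(0), while Riemann-Roch gives ℓ(E) ≥ deg E - (γ -
-- 1). This bound makes the order of a differential well defined.
variable (k F) in
theorem exists_degree_le_of_mem_differentialsBounded : ∃ c : ℤ, ∀ (E : Divisor k F)
    (ω : Module.Dual k (Adele k F)), ω ≠ 0 → ω ∈ differentialsBounded E → E.degree ≤ c := by
  refine ⟨Module.finrank k (Cohomology (0 : Divisor k F)) + (genus k F - 1), fun E ω h0 h => ?_⟩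
  have h1 := ell_le_finrank_cohomology h0 h E
  rw [sub_self] at h1
  have h2 := ell_sub_finrank_cohomology E
  omega

theorem ell_eq_zero_of_degree_neg {E : Divisor k F} (h : E.degree < 0) : ell E = 0 := by
  rw [ell, Submodule.finrank_eq_zero, Submodule.eq_bot_iff]
  intro f hf
  by_contra hf0
  have h1 := Divisor.degree_mono ((mem_sections_iff_neg_divisor_le hf0).1 hf)
  rw [Divisor.degree_neg, degree_divisor] at h1
  omega

variable (k F) in
theorem exists_lt_degree (c : ℤ) : ∃ G : Divisor k F, c < G.degree := by
  obtain ⟨p⟩ : Nonempty (Place k F) := inferInstance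
  refine ⟨Finsupp.single p (c.toNat + 1), ?_⟩
  rw [Divisor.degree_single]
  have h1 := p.degree_pos
  have h2 := Int.self_le_toNat c
  have h3 : ((c.toNat : ℤ) + 1) * 1 ≤ (c.toNat + 1) * p.degree :=
    mul_le_mul_of_nonneg_left (by omega) (by positivity)
  omega

/-- The space of differentials is one-dimensional over the function field. -/
theorem exists_eq_fmul {ω η : Module.Dual k (Adele k F)} (hω0 : ω ≠ 0) (hω : ω ∈ Differentials k F)
    (hη : η ∈ Differentials k F) : ∃ f : F, η = fmul f ω := by
  by_contra! hne
  obtain ⟨E₁, h₁⟩ := mem_differentials_iff.1 hω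
  obtain ⟨E₂, h₂⟩ := mem_differentials_iff.1 hη
  set E := E₁ ⊓ E₂
  replace h₁ := differentialsBounded_anti (inf_le_left : E ≤ E₁) h₁
  replace h₂ := differentialsBounded_anti (inf_le_right : E ≤ E₂) h₂
  -- If η is not a multiple of ω, then (f, f') ↦ fω + f'η is injective, so h¹(E - G) would have to
  -- grow like 2 deg G.
  have key (G : Divisor k F) : 2 * ell G ≤ Module.finrank k (Cohomology (E - G)) := by
    rw [← finrank_differentialsBounded]
    have hinj := LinearMap.finrank_le_finrank_of_injective (f := LinearMap.coprod
        (fmulBounded h₁ G) (fmulBounded h₂ G)) ((injective_iff_map_eq_zero _).2 (by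
      rintro ⟨f, f'⟩ h
      have h' : fmulₗ ω f + fmulₗ η f' = 0 := congrArg Subtype.val h
      have hf' : (f' : F) = 0 := by
        by_contra hf'
        apply hne (-((f : F) * (f' : F)⁻¹))
        have h3 : fmul (f' : F) η = fmulₗ ω (-f) := by
          rw [map_neg]
          exact (add_eq_zero_iff_neg_eq.1 h').symm
        rw [← neg_mul, ← fmul_fmul]
        change η = fmul (f' : F)⁻¹ (fmulₗ ω (-f))
        rw [← h3, fmul_fmul, mul_inv_cancel₀ hf', fmul_one]
      rw [hf', map_zero, add_zero] at h'
      exact Prod.ext (Subtype.ext (eq_zero_of_fmul_eq_zero hω0 h')) (Subtype.ext hf')))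
    rw [Module.finrank_prod] at hinj
    rw [two_mul]
    exact hinj
  -- The first bound forces ℓ(E - G) = 0; then Riemann-Roch turns the inequality `key` into deg G ≤
  -- 3(γ - 1) - deg E, against the second bound.
  obtain ⟨G, hG⟩ := exists_lt_degree k F (max E.degree (3 * (genus k F - 1) - E.degree))
  have h3 := key G
  have h4 := ell_sub_finrank_cohomology G
  have h5 := ell_sub_finrank_cohomology (E - G)
  rw [ell_eq_zero_of_degree_neg (by rw [Divisor.degree_sub]; omega), Divisor.degree_sub] at h5
  omega

/-! ### The divisor of a differential -/

/-- The integers `m` such that `ω_p` vanishes on the elements `x` with `ord_p x ≥ -m`. -/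
def vanishingSet (ω : Module.Dual k (Adele k F)) (p : Place k F) : Set ℤ :=
  {m : ℤ | ∀ x : p.Compl, Valued.v x ≤ WithZero.exp m → localComponent ω p x = 0}

theorem mem_vanishingSet_of_le {ω : Module.Dual k (Adele k F)} {p : Place k F} {m m' : ℤ}
    (h : m ≤ m') (hm' : m' ∈ vanishingSet ω p) : m ∈ vanishingSet ω p :=
  fun x hx => hm' x (p.complBall_mono h hx)

theorem mem_vanishingSet {E : Divisor k F} {ω : Module.Dual k (Adele k F)}
    (hω : ω ∈ differentialsBounded E) (p : Place k F) : E p ∈ vanishingSet ω p :=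
  fun _ hx => (mem_differentialsBounded.1 hω).1 _ (Adele.single_mem_bounded hx)

/-- Vanishing can be checked place by place: remove from an adele its components at the finitely
many places where E' differs from E. What remains lies in 𝔸(E), and each removed component is killed
by hypothesis. -/
theorem mem_differentialsBounded_of_vanishingSet {E E' : Divisor k F}
    {ω : Module.Dual k (Adele k F)} (hω : ω ∈ differentialsBounded E)
    (h : ∀ p, E' p ∈ vanishingSet ω p) : ω ∈ differentialsBounded E' := by
  rw [mem_differentialsBounded] at *
  refine ⟨fun a ha => ?_, hω.2⟩
  rw [Adele.mem_bounded] at ha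
  set S := (E' - E).support with hS
  rw [← sub_add_cancel a (Adele.ofFinset S a), map_add, hω.1, zero_add, ← Adele.sum_single,
    map_sum]
  · exact Finset.sum_eq_zero fun p _ => h p _ (ha p)
  · refine Adele.mem_bounded.2 fun p => ?_
    rw [Adele.sub_apply]
    by_cases hp : p ∈ S
    · rw [Adele.ofFinset_apply_of_mem _ hp, sub_self]
      simp
    · rw [Adele.ofFinset_apply_of_notMem _ hp, sub_zero]
      have : E' p = E p := by simpa [hS, sub_eq_zero] using hp
      rw [← this]
      exact ha p

/-- The integer supremum is meaningful only for a nonempty set bounded above. It is bounded because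
raising E at p alone would otherwise give divisors of arbitrarily large degree on which ω still
vanishes. -/
theorem isGreatest_ordDifferential {ω : Module.Dual k (Adele k F)} (hω0 : ω ≠ 0)
    (hω : ω ∈ Differentials k F) (p : Place k F) :
    IsGreatest (vanishingSet ω p) (ordDifferential ω p) := by
  classical
  obtain ⟨E, hE⟩ := mem_differentials_iff.1 hω
  obtain ⟨c, hc⟩ := exists_degree_le_of_mem_differentialsBounded k F
  have hne : (vanishingSet ω p).Nonempty := ⟨E p, mem_vanishingSet hE p⟩
  have hbdd : BddAbove (vanishingSet ω p) := by
    refine ⟨max (E p) (E p + (c - E.degree)), fun m hm => ?_⟩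
    by_contra! hlt
    have h1 := hc (E + Finsupp.single p (m - E p)) ω hω0
      (mem_differentialsBounded_of_vanishingSet hE fun q => by
        rw [Finsupp.add_apply, Finsupp.single_apply]
        split_ifs with h
        · subst h
          rwa [add_sub_cancel]
        · rw [add_zero]
          exact mem_vanishingSet hE q)
    rw [Divisor.degree_add, Divisor.degree_single] at h1
    have h2 := p.degree_pos
    have h3 : (m - E p) * 1 ≤ (m - E p) * p.degree :=
      mul_le_mul_of_nonneg_left (by omega) (by omega)
    omega
  exact ⟨Int.csSup_mem hne hbdd, fun m hm => le_csSup hbdd hm⟩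

/-- The orders differ from those of a bounding divisor E at finitely many places only: each place
with a strictly larger order allows E to be raised by a divisor of positive degree, and the total
degree is bounded. -/
theorem exists_divisor_eq_ordDifferential {ω : Module.Dual k (Adele k F)} (hω0 : ω ≠ 0)
    (hω : ω ∈ Differentials k F) : ∃ W : Divisor k F, ∀ p, W p = ordDifferential ω p := by
  classical
  obtain ⟨E, hE⟩ := mem_differentials_iff.1 hω
  obtain ⟨c, hc⟩ := exists_degree_le_of_mem_differentialsBounded k F
  have hfin : {p | E p ≠ ordDifferential ω p}.Finite := by
    by_contra hinf
    obtain ⟨T, hT, hcard⟩ := Set.Infinite.exists_subset_card_eq hinf (c - E.degree + 1).toNat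
    have h1 := hc (E + ∑ q ∈ T, Finsupp.single q 1) ω hω0
      (mem_differentialsBounded_of_vanishingSet hE fun q => by
        have hgr := isGreatest_ordDifferential hω0 hω q
        have hle := hgr.2 (mem_vanishingSet hE q)
        refine mem_vanishingSet_of_le ?_ hgr.1
        rw [Finsupp.add_apply, Finsupp.finsetSum_apply]
        simp only [Finsupp.single_apply, Finset.sum_ite_eq']
        split_ifs with hq
        · have : E q ≠ ordDifferential ω q := hT hq
          omega
        · omega)
    rw [Divisor.degree_add, Divisor.degree_sum] at h1
    have h2 : (T.card : ℤ) ≤ ∑ q ∈ T, Divisor.degree (Finsupp.single q 1 : Divisor k F) := by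
      rw [Finset.card_eq_sum_ones, Nat.cast_sum]
      refine Finset.sum_le_sum fun q _ => ?_
      rw [Divisor.degree_single, one_mul]
      exact_mod_cast q.degree_pos
    omega
  refine ⟨Finsupp.ofSupportFinite (ordDifferential ω) ((hfin.union E.hasFiniteSupport).subset
    fun p hp => ?_), fun p => rfl⟩
  by_contra h
  simp only [Set.mem_union, Set.mem_ofPred_eq, not_or, not_not] at h
  refine hp ?_
  rw [← h.1]
  exact Function.notMem_support.1 h.2

section Canonical

variable {ω : Module.Dual k (Adele k F)} {W : Divisor k F}

theorem mem_differentialsBounded_iff_le (hω0 : ω ≠ 0) (hω : ω ∈ Differentials k F)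
    (hW : ∀ p, W p = ordDifferential ω p) {E : Divisor k F} :
    ω ∈ differentialsBounded E ↔ E ≤ W := by
  constructor
  · intro h p
    rw [hW]
    exact (isGreatest_ordDifferential hω0 hω p).2 (mem_vanishingSet h p)
  · intro h
    obtain ⟨E', hE'⟩ := mem_differentials_iff.1 hω
    refine mem_differentialsBounded_of_vanishingSet hE' fun p => mem_vanishingSet_of_le
      (h p) ?_
    rw [hW]
    exact (isGreatest_ordDifferential hω0 hω p).1

/-- Serre duality for divisors: f ↦ fω identifies the sections of W - E with the differentials
vanishing on 𝔸(E), the dual of the cohomology of E. -/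
theorem finrank_cohomology (hω0 : ω ≠ 0) (hω : ω ∈ Differentials k F)
    (hW : ∀ p, W p = ordDifferential ω p) (E : Divisor k F) :
    Module.finrank k (Cohomology E) = ell (W - E) := by
  have hmem (E : Divisor k F) {f : F} (hf : f ∈ sections (W - E)) :
      fmul f ω ∈ differentialsBounded E := by
    have := fmul_mem_differentialsBounded
      ((mem_differentialsBounded_iff_le hω0 hω hW).2 le_rfl) hf
    rwa [sub_sub_cancel] at this
  rw [← finrank_differentialsBounded]
  have hmap : (sections (W - E)).map (fmulₗ ω) = differentialsBounded E := by
    apply le_antisymm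
    · rintro _ ⟨f, hf, rfl⟩
      exact hmem E hf
    · intro η hη
      obtain ⟨f, rfl⟩ := exists_eq_fmul hω0 hω (mem_differentials_iff.2 ⟨E, hη⟩)
      refine ⟨f, ?_, rfl⟩
      by_cases hf : f = 0
      · rw [hf]; exact Submodule.zero_mem _
      -- Undoing the multiplication by f shows that ω is bounded by E minus the divisor of f; this
      -- divisor is then at most W.
      have h1 : f⁻¹ ∈ sections (divisor k f) := by
        rw [mem_sections_iff_neg_divisor_le (inv_ne_zero hf), divisor_inv, neg_neg]
      have h2 := fmul_mem_differentialsBounded hη h1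
      rw [fmul_fmul, mul_inv_cancel₀ hf, fmul_one,
        mem_differentialsBounded_iff_le hω0 hω hW] at h2
      rw [SetLike.mem_coe, mem_sections_iff_neg_divisor_le hf]
      intro p
      have := h2 p
      simp only [Finsupp.sub_apply, Finsupp.neg_apply] at this ⊢
      omega
  rw [← hmap]
  refine LinearEquiv.finrank_eq (Submodule.equivMapOfInjective (fmulₗ ω) ?_ _).symm
  rw [← LinearMap.ker_eq_bot, LinearMap.ker_eq_bot']
  exact fun f hf => eq_zero_of_fmul_eq_zero hω0 hf

/-- The degree of a canonical divisor. -/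
theorem degree_canonical (hω0 : ω ≠ 0) (hω : ω ∈ Differentials k F)
    (hW : ∀ p, W p = ordDifferential ω p) : W.degree = 2 * (genus k F - 1) := by
  have h1 := ell_sub_finrank_cohomology (0 : Divisor k F)
  have h2 := ell_sub_finrank_cohomology W
  rw [finrank_cohomology hω0 hω hW, sub_self] at h2
  rw [finrank_cohomology hω0 hω hW, sub_zero, Divisor.degree_zero] at h1
  omega

end Canonical

/-! ### Serre duality in higher rank -/

variable {r : ℕ}

/-- The pairing of ᵗg y with x equals that of y with g x, and the latter is integral. Used both for
duality and to see differentials as maps from the sheaf to a line bundle. -/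
theorem sum_mul_mem_complBall {ω₀ : Module.Dual k (Adele k F)} {g : GL (Fin r) (Adele k F)}
    {f : Fin r → F} {p : Place k F}
    {y : Fin r → p.Compl} (hy : ∀ j, y j ∈ p.integers)
    (hf : ∀ j, p.pi ^ ordDifferential ω₀ p * algebraMap F p.Compl (f j) =
      (component g p).val.transpose.mulVec y j)
    {x : Fin r → p.Compl} (hx : ∀ j, (component g p).val.mulVec x j ∈ p.complBall 0) :
    ∑ j, algebraMap F p.Compl (f j) * x j ∈ p.complBall (ordDifferential ω₀ p) := by
  have h1 : p.pi ^ ordDifferential ω₀ p * ∑ j, algebraMap F p.Compl (f j) * x j =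
      ∑ j, y j * (component g p).val.mulVec x j := by
    change _ = dotProduct y _
    rw [Matrix.dotProduct_mulVec, ← Matrix.mulVec_transpose, Finset.mul_sum, dotProduct]
    exact Finset.sum_congr rfl fun j _ => by rw [← hf, mul_assoc]
  have h2 : Valued.v (∑ j, y j * (component g p).val.mulVec x j) ≤ 1 := by
    refine Valuation.map_sum_le _ fun j _ => ?_
    rw [map_mul]
    exact mul_le_one' (hy j) (Place.mem_complBall_zero.1 (hx j))
  rw [← h1, map_mul, Place.valued_pi_zpow, WithZero.exp_neg,
    inv_mul_le_one₀ WithZero.exp_pos] at h2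
  exact h2

theorem exists_bounded_of_mulVec (g : GL (Fin r) (Adele k F)) : ∃ E : Divisor k F,
    ∀ a ∈ Adele.bounded E, ∀ j, Pi.single j a ∈ adelicSpace g := by
  choose G _ hG using fun x : Fin r × Fin r => Adele.exists_mem_bounded (g.val x.1 x.2) 0
  obtain ⟨G₀, hG₀⟩ : ∃ G₀, ∀ x, G x ≤ G₀ := by
    obtain ⟨G₀, h⟩ := (Set.finite_range G).bddAbove
    exact ⟨G₀, fun x => h ⟨x, rfl⟩⟩
  refine ⟨-G₀, fun a ha j i p => ?_⟩
  rw [Matrix.mulVec_single, Place.mem_integers]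
  change Valued.v (g.val i j p * a p) ≤ 1
  rw [map_mul]
  have h1 := mul_le_mul' (Adele.mem_bounded.1 (Adele.bounded_mono (hG₀ (i, j)) (hG (i, j))) p)
    (Adele.mem_bounded.1 ha p)
  rwa [← WithZero.exp_add, Finsupp.neg_apply, add_neg_cancel, WithZero.exp_zero] at h1

/-- The space is the full annihilator of 𝔸^r(g) + F^r under ∑ ω_j(a_j). Vanishing follows from the
local pairing estimate; conversely the maximality of the orders of ω₀ recovers the local integrality
conditions. -/
theorem mem_differentialSpace_iff {ω₀ : Module.Dual k (Adele k F)} (hω0 : ω₀ ≠ 0)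
    (hω : ω₀ ∈ Differentials k F) (g : GL (Fin r) (Adele k F))
    (ω : Fin r → Module.Dual k (Adele k F)) : ω ∈ differentialSpace ω₀ g ↔
      ∀ a ∈ adelicSpace g ⊔ LinearMap.range (diagonal k F r), ∑ j, ω j (a j) = 0 := by
  obtain ⟨W, hW⟩ := exists_divisor_eq_ordDifferential hω0 hω
  have hωW := (mem_differentialsBounded_iff_le hω0 hω hW).2 le_rfl
  rw [mem_differentialsBounded] at hωW
  have hsum (f : Fin r → F) (a : Fin r → Adele k F) : ∑ j, fmul (f j) ω₀ (a j) =
      ω₀ (∑ j, algebraMap F (Adele k F) (f j) * a j) := by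
    rw [map_sum]
    rfl
  have hsump (f : Fin r → F) (a : Fin r → Adele k F) (p : Place k F) :
      (∑ j, algebraMap F (Adele k F) (f j) * a j) p =
        ∑ j, algebraMap F p.Compl (f j) * a j p := by
    change Adele.eval p _ = _
    rw [map_sum]
    rfl
  constructor
  · rintro ⟨-, f, hf, hloc⟩ a ha
    simp only [hf]
    obtain ⟨b, hb, _, ⟨c, rfl⟩, rfl⟩ := Submodule.mem_sup.1 ha
    simp only [Pi.add_apply, map_add, Finset.sum_add_distrib, hsum]
    rw [hωW.1, zero_add]
    · have : ∑ j, algebraMap F (Adele k F) (f j) * diagonal k F r c j =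
          algebraMap F (Adele k F) (∑ j, f j * c j) := by
        rw [map_sum]
        exact Finset.sum_congr rfl fun j _ => (map_mul _ _ _).symm
      rw [this]
      exact hωW.2 _
    · refine Adele.mem_bounded.2 fun p => ?_
      obtain ⟨y, hy, hfy⟩ := hloc p
      rw [hsump, hW]
      exact sum_mul_mem_complBall hy hfy (mem_adelicSpace.1 hb p)
  · intro h
    have hdiff (j : Fin r) : ω j ∈ Differentials k F := by
      obtain ⟨E, hE⟩ := exists_bounded_of_mulVec g
      refine mem_differentials_iff.2 ⟨E, mem_differentialsBounded.2 ⟨fun a ha => ?_, fun f => ?_⟩⟩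
      · have := h _ (Submodule.mem_sup_left (hE a ha j))
        rwa [Finset.sum_eq_single_of_mem j (Finset.mem_univ j) fun i _ hi => by
          rw [Pi.single_eq_of_ne hi, map_zero], Pi.single_eq_same] at this
      · have := h (Pi.single j (algebraMap F (Adele k F) f))
          (Submodule.mem_sup_right ⟨Pi.single j f, by
            ext1 i
            change algebraMap F (Adele k F) (Pi.single (M := fun _ => F) j f i) = _
            by_cases hi : i = j
            · subst hi; simp
            · simp [Pi.single_eq_of_ne hi]⟩)
        rwa [Finset.sum_eq_single_of_mem j (Finset.mem_univ j) fun i _ hi => by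
          rw [Pi.single_eq_of_ne hi, map_zero], Pi.single_eq_same] at this
    choose f hf using fun j => exists_eq_fmul hω0 hω (hdiff j)
    refine ⟨hdiff, f, hf, fun p => ?_⟩
    set B := (component g p)⁻¹ with hB
    -- The only possible y is the inverse transpose of g_p applied to the given vector; its
    -- integrality is what has to be shown.
    refine ⟨B.val.transpose.mulVec fun j => p.pi ^ ordDifferential ω₀ p *
      algebraMap F p.Compl (f j), fun i => ?_, fun j => ?_⟩
    · set c := ∑ j, algebraMap F p.Compl (f j) * B.val j i with hc
      have h1 : B.val.transpose.mulVec (fun j => p.pi ^ ordDifferential ω₀ p *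
          algebraMap F p.Compl (f j)) i = p.pi ^ ordDifferential ω₀ p * c := by
        rw [hc, Finset.mul_sum, Matrix.mulVec, dotProduct]
        exact Finset.sum_congr rfl fun j _ => by rw [Matrix.transpose_apply]; ring
      rw [h1, Place.mem_integers, map_mul, Place.valued_pi_zpow, WithZero.exp_neg,
        inv_mul_le_one₀ WithZero.exp_pos]
      by_cases hc0 : c = 0
      · simp [hc0]
      have hvc : Valued.v c ≠ 0 := by simpa using hc0
      rw [← WithZero.exp_log hvc, WithZero.exp_le_exp]
      -- The estimate on c amounts to ω₀ vanishing locally on all x with |x| ≤ |c|. Such an x is cz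
      -- with z integral.
      refine (isGreatest_ordDifferential hω0 hω p).2 fun x hx => ?_
      rw [WithZero.exp_log hvc] at hx
      set z := x / c with hz
      have hzint : Valued.v z ≤ 1 := by
        rw [hz, map_div₀]
        exact div_le_one_of_le₀ hx zero_le
      -- This test vector is z times the i-th column of g_p⁻¹, placed at p; g sends it to z times a
      -- unit vector.
      have hmem : (fun j => Adele.single p (B.val j i * z)) ∈ adelicSpace g := by
        rw [mem_adelicSpace]
        intro q l
        by_cases hq : q = p
        · subst hq
          have h2 : (component g q).val.mulVec (fun j => B.val j i * z) l =
              (1 : Matrix (Fin r) (Fin r) q.Compl) l i * z := by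
            rw [← (component g q).mul_inv, Matrix.mul_apply, Finset.sum_mul, Matrix.mulVec,
              dotProduct]
            exact Finset.sum_congr rfl fun j _ => (mul_assoc _ _ _).symm
          simp only [Adele.single_apply_same]
          rw [h2, Matrix.one_apply, Place.mem_complBall_zero]
          split_ifs
          · rw [one_mul]; exact hzint
          · rw [zero_mul]; exact q.integers.zero_mem
        · simp only [Adele.single_apply_ne hq]
          have : (component g q).val.mulVec (fun _ => 0) l = 0 := by
            simp [Matrix.mulVec, dotProduct]
          rw [this]
          exact Submodule.zero_mem _
      have h3 := h _ (Submodule.mem_sup_left hmem)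
      simp only [hf] at h3
      rw [hsum] at h3
      have h4 : ∑ j, algebraMap F (Adele k F) (f j) * Adele.single p (B.val j i * z) =
          Adele.single p x := by
        have h5 : x = ∑ j, algebraMap F p.Compl (f j) * (B.val j i * z) := by
          rw [← div_mul_cancel₀ x hc0, ← hz, mul_comm, hc, Finset.sum_mul]
          exact Finset.sum_congr rfl fun j _ => mul_assoc _ _ _
        change _ = Adele.singleHom p x
        rw [h5, map_sum]
        exact Finset.sum_congr rfl fun j _ => Adele.mul_single _ p _
      rw [h4] at h3
      exact h3
    · rw [Matrix.mulVec_mulVec, ← Matrix.transpose_mul, hB, (component g p).inv_mul,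
        Matrix.transpose_one, Matrix.one_mulVec]

/-- Serre duality. -/
theorem finrank_differentialSpace {ω₀ : Module.Dual k (Adele k F)} (hω0 : ω₀ ≠ 0)
    (hω : ω₀ ∈ Differentials k F) (g : GL (Fin r) (Adele k F)) :
    Module.finrank k (differentialSpace ω₀ g) = h1 g := by
  let e := LinearMap.lsum k (fun _ : Fin r => Adele k F) (M := k) k
  have he (ω : Fin r → Module.Dual k (Adele k F)) (a : Fin r → Adele k F) :
      e ω a = ∑ j, ω j (a j) := by
    simp [e, LinearMap.lsum_apply]
  have hmap : (differentialSpace ω₀ g).map e.toLinearMap =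
      (adelicSpace g ⊔ LinearMap.range (diagonal k F r)).dualAnnihilator := by
    ext φ
    rw [Submodule.mem_map_equiv, mem_differentialSpace_iff hω0 hω, Submodule.mem_dualAnnihilator]
    simp only [← he, LinearEquiv.apply_symm_apply]
  rw [← LinearEquiv.finrank_map_eq e, hmap,
    ← (Submodule.dualQuotEquivDualAnnihilator _).finrank_eq, Subspace.dual_finrank_eq, h1]

end AdelicCode

end

noncomputable section

namespace AdelicCode

universe u v

variable {k : Type u} {F : Type v} [Field k] [Field F] [Algebra k F] {r : ℕ}

/-! ### Stalks of the sheaf of an idelic matrix -/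

/-- The image in `GL_r(F_p)` of a matrix over `F`. -/
def Place.embedGL (p : Place k F) (h : GL (Fin r) F) : GL (Fin r) p.Compl :=
  Matrix.GeneralLinearGroup.map (algebraMap F p.Compl) h

theorem Place.embedGL_inv (p : Place k F) (h : GL (Fin r) F) :
    p.embedGL h⁻¹ = (p.embedGL h)⁻¹ := map_inv _ h

theorem Place.embedGL_mul (p : Place k F) (h h' : GL (Fin r) F) :
    p.embedGL (h * h') = p.embedGL h * p.embedGL h' := map_mul _ h h'

theorem Place.det_embedGL (p : Place k F) (h : GL (Fin r) F) :
    (p.embedGL h).val.det = algebraMap F p.Compl h.val.det := by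
  rw [RingHom.map_det]
  rfl

theorem Place.embedGL_mulVec (p : Place k F) (h : GL (Fin r) F) (c : Fin r → F) :
    (p.embedGL h).val.mulVec (fun i => algebraMap F p.Compl (c i)) =
      fun i => algebraMap F p.Compl (h.val.mulVec c i) := by
  ext i
  exact ((algebraMap F p.Compl).map_mulVec h.val c i).symm

theorem Place.algebraMap_mem_complBall {p : Place k F} {f : F} {m : ℤ} :
    algebraMap F p.Compl f ∈ p.complBall m ↔ p.val f ≤ WithZero.exp m := by
  rw [mem_complBall, valued_algebraMap]

theorem det_ne_zero {K : Type*} [Field K] (A : GL (Fin r) K) : A.val.det ≠ 0 :=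
  ((Matrix.isUnit_iff_isUnit_det _).1 A.isUnit).ne_zero

theorem mulVec_eq_sum_col {K : Type*} [CommRing K] (A : Matrix (Fin r) (Fin r) K)
    (c : Fin r → K) : A.mulVec c = ∑ i, c i • A.col i := by
  ext j
  simp [Matrix.mulVec, dotProduct, mul_comm]

/-- Approximate A⁻¹ by a matrix H over F so closely that AH is the identity modulo the maximal
ideal; then AH lies in GL_r(O_p). The columns of H form a basis of the stalk. -/
theorem exists_isIntegralAt_mul (p : Place k F) (A : GL (Fin r) p.Compl) :
    ∃ h : GL (Fin r) F, IsIntegralAt p (A * p.embedGL h) := by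
  choose m hm using fun x : Fin r × Fin r => p.exists_valued_le (A.val x.1 x.2)
  obtain ⟨m₀, hm₀⟩ : ∃ m₀ : ℤ, ∀ x, m x ≤ m₀ := by
    obtain ⟨m₀, hm₀⟩ := (Set.finite_range m).bddAbove
    exact ⟨m₀, fun x => hm₀ ⟨x, rfl⟩⟩
  -- The entries of A have valuation at most `exp m₀`, so this precision puts the entries of 1 - AH
  -- into the maximal ideal.
  choose f hf using fun i j => p.exists_valued_sub_le (A⁻¹.val i j) (-1 - m₀)
  set H : Matrix (Fin r) (Fin r) F := Matrix.of f with hH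
  set B := A.val * H.map (algebraMap F p.Compl) with hB
  have hsub : 1 - B = A.val * (A⁻¹.val - H.map (algebraMap F p.Compl)) := by
    rw [mul_sub, ← hB, A.mul_inv]
  have hlt (i j : Fin r) : Valued.v ((1 - B) i j) < 1 := by
    rw [hsub, Matrix.mul_apply]
    refine Valuation.map_sum_lt _ one_ne_zero fun l _ => ?_
    rw [map_mul, lt_one_iff_le_exp]
    calc _ ≤ WithZero.exp m₀ * WithZero.exp (-1 - m₀) :=
          mul_le_mul' (p.complBall_mono (hm₀ (i, l)) (hm (i, l))) (hf l j)
      _ = _ := by rw [← WithZero.exp_add]; congr 1; ring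
  have hint (i j : Fin r) : B i j ∈ p.integers := by
    have h1 : B i j = (1 : Matrix (Fin r) (Fin r) p.Compl) i j - (1 - B) i j := by
      simp
    rw [h1]
    refine p.integers.sub_mem ?_ (hlt i j).le
    rw [Matrix.one_apply]
    split_ifs
    exacts [p.integers.one_mem, p.integers.zero_mem]
  let I : Ideal p.integers :=
    { carrier := {x | Valued.v (x : p.Compl) < 1}
      zero_mem' := by simp
      add_mem' := fun {a b} ha hb =>
        (Valued.v.map_add (a : p.Compl) (b : p.Compl)).trans_lt (max_lt ha hb)
      smul_mem' := fun c x hx => by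
        change Valued.v ((c : p.Compl) * x) < 1
        rw [map_mul]
        exact (mul_le_of_le_one_left' c.2).trans_lt hx }
  let Y : Matrix (Fin r) (Fin r) p.integers := Matrix.of fun i j => ⟨B i j, hint i j⟩
  have hY1 : (Ideal.Quotient.mk I).mapMatrix Y = 1 := by
    rw [← map_one (Ideal.Quotient.mk I).mapMatrix]
    ext i j
    rw [RingHom.mapMatrix_apply, RingHom.mapMatrix_apply, Matrix.map_apply, Matrix.map_apply]
    refine (Ideal.Quotient.eq.2 ?_).symm
    change Valued.v (((1 : Matrix (Fin r) (Fin r) p.integers) i j : p.Compl) - B i j) < 1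
    have h1 : ((1 : Matrix (Fin r) (Fin r) p.integers) i j : p.Compl) =
        (1 : Matrix (Fin r) (Fin r) p.Compl) i j := by
      rw [Matrix.one_apply, Matrix.one_apply]
      split_ifs <;> rfl
    rw [h1]
    exact hlt i j
  have hYdet : Valued.v (Y.det : p.Compl) = 1 := by
    have h1 := congrArg Matrix.det hY1
    rw [← RingHom.map_det, Matrix.det_one, ← map_one (Ideal.Quotient.mk I)] at h1
    have h2 : Valued.v ((Y.det : p.Compl) - 1) < 1 := Ideal.Quotient.eq.1 h1
    have h3 := Valuation.map_add_eq_of_lt_right (v := Valued.v (R := p.Compl))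
      (x := (Y.det : p.Compl) - 1) (y := 1) (by rwa [map_one])
    rwa [sub_add_cancel, map_one] at h3
  have hYu : IsUnit Y.det := by
    have h0 : (Y.det : p.Compl) ≠ 0 := by
      intro h
      rw [h, map_zero] at hYdet
      exact zero_ne_one hYdet
    refine IsUnit.of_mul_eq_one ⟨(Y.det : p.Compl)⁻¹, ?_⟩ (Subtype.ext (mul_inv_cancel₀ h0))
    rw [Place.mem_integers, map_inv₀, hYdet, inv_one]
  have hYB : Y.map p.integers.subtype = B := rfl
  have hH0 : H.det ≠ 0 := by
    intro h
    have h1 : B.det = 0 := by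
      rw [hB, Matrix.det_mul, ← RingHom.mapMatrix_apply, ← RingHom.map_det, h, map_zero, mul_zero]
    have h2 : (Y.det : p.Compl) = B.det := p.integers.subtype.map_det Y
    rw [h2, h1, map_zero] at hYdet
    exact zero_ne_one hYdet
  exact ⟨Matrix.GeneralLinearGroup.mkOfDetNeZero H hH0,
    Matrix.GeneralLinearGroup.mk'' Y hYu, hYB⟩

theorem IsIntegralAt.mul {p : Place k F} {A B : GL (Fin r) p.Compl} (hA : IsIntegralAt p A)
    (hB : IsIntegralAt p B) : IsIntegralAt p (A * B) := by
  obtain ⟨M, hM⟩ := hA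
  obtain ⟨N, hN⟩ := hB
  exact ⟨M * N, by rw [Units.val_mul, Units.val_mul, Matrix.map_mul, hM, hN]⟩

theorem mem_sheaf {g : GL (Fin r) (Adele k F)} {p : Place k F} {f : Fin r → F} :
    f ∈ sheaf g p ↔ ∀ j, (component g p).val.mulVec (fun i => algebraMap F p.Compl (f i)) j ∈
      p.complBall 0 := by
  simp only [Place.mem_complBall_zero]
  rfl

theorem mem_H0 [IsFunctionField k F] {g : GL (Fin r) (Adele k F)} {f : Fin r → F} :
    f ∈ H0 g ↔ ∀ p, f ∈ sheaf g p := mem_adelicSpace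

theorem linearIndependent_col {K : Type*} [Field K] (h : GL (Fin r) K) :
    LinearIndependent K h.val.col :=
  Matrix.linearIndependent_cols_iff_isUnit.2 h.isUnit

theorem mem_span_localRing {s m : ℕ} {p : Place k F} {e : Fin s → Fin m → F} {x : Fin m → F} :
    x ∈ Submodule.span p.localRing (Set.range e) ↔
      ∃ c : Fin s → F, (∀ i, p.val (c i) ≤ 1) ∧ x = ∑ i, c i • e i := by
  rw [Submodule.mem_span_range_iff_exists_fun]
  constructor
  · rintro ⟨c, rfl⟩
    exact ⟨fun i => c i, fun i => (c i).2, rfl⟩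
  · rintro ⟨c, hc, rfl⟩
    exact ⟨fun i => ⟨c i, hc i⟩, rfl⟩

theorem sheaf_eq_span_col {g : GL (Fin r) (Adele k F)} {p : Place k F} {h : GL (Fin r) F}
    (hh : IsIntegralAt p (component g p * p.embedGL h)) :
    sheaf g p = Submodule.span p.localRing (Set.range h.val.col) := by
  have key (c : Fin r → F) : h.val.mulVec c ∈ sheaf g p ↔ ∀ i, p.val (c i) ≤ 1 := by
    rw [mem_sheaf, ← p.embedGL_mulVec, Matrix.mulVec_mulVec, ← Units.val_mul, hh.mulVec_mem_iff]
    simp only [Place.algebraMap_mem_complBall, WithZero.exp_zero]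
  ext x
  rw [mem_span_localRing]
  simp only [← mulVec_eq_sum_col]
  constructor
  · intro hx
    have h1 : h.val.mulVec (h⁻¹.val.mulVec x) = x := by
      rw [Matrix.mulVec_mulVec, h.mul_inv, Matrix.one_mulVec]
    exact ⟨_, (key _).1 (h1.symm ▸ hx), h1.symm⟩
  · rintro ⟨c, hc, rfl⟩
    exact (key c).2 hc

/-- Two bases of the same stalk differ by a matrix which is integral together with its inverse. -/
theorem IsIntegralAt.of_span_eq {p : Place k F} {A : GL (Fin r) p.Compl} {h h' : GL (Fin r) F}
    (hh : IsIntegralAt p (A * p.embedGL h))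
    (hs : Submodule.span p.localRing (Set.range h.val.col) =
      Submodule.span p.localRing (Set.range h'.val.col)) :
    IsIntegralAt p (A * p.embedGL h') := by
  have key (h h' : GL (Fin r) F) (hs : Submodule.span p.localRing (Set.range h.val.col) =
      Submodule.span p.localRing (Set.range h'.val.col)) (i j : Fin r) :
      (p.embedGL (h⁻¹ * h')).val i j ∈ p.integers := by
    have h1 : h'.val.col j ∈ Submodule.span p.localRing (Set.range h.val.col) :=
      hs ▸ Submodule.subset_span ⟨j, rfl⟩
    obtain ⟨c, hc, hj⟩ := mem_span_localRing.1 h1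
    rw [← mulVec_eq_sum_col] at hj
    have h2 : (h⁻¹ * h').val i j = c i := by
      have h3 : h⁻¹.val.mulVec (h'.val.col j) = c := by
        rw [hj, Matrix.mulVec_mulVec, h.inv_mul, Matrix.one_mulVec]
      rw [← h3]
      rfl
    change algebraMap F p.Compl ((h⁻¹ * h').val i j) ∈ p.integers
    rw [h2, Place.mem_integers, Place.valued_algebraMap]
    exact hc i
  have h1 : IsIntegralAt p (p.embedGL (h⁻¹ * h')) := by
    refine isIntegralAt_of_entries (key h h' hs) ?_
    rw [← Place.embedGL_inv, mul_inv_rev, inv_inv]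
    exact key h' h hs.symm
  have h2 := hh.mul h1
  rwa [mul_assoc, ← p.embedGL_mul, mul_inv_cancel_left] at h2

theorem finite_not_isIntegralAt_embedGL [IsFunctionField k F] (g : GL (Fin r) (Adele k F))
    (h : GL (Fin r) F) :
    {p : Place k F | ¬ IsIntegralAt p (component g p * p.embedGL h)}.Finite := by
  have := finite_not_isIntegralAt
    (g * Matrix.GeneralLinearGroup.map (algebraMap F (Adele k F)) h)
  simp only [component_mul] at this
  exact this

/-! ### Degrees and local freeness -/

/-- The divisor of the determinant of an idelic matrix. -/
def detDivisor (g : GL (Fin r) (Adele k F)) : Divisor k F :=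
  Finsupp.ofSupportFinite (fun p => p.ord (component g p).val.det) <| by
    refine (finite_not_isIntegralAt g).subset fun p hp h => hp ?_
    change p.ord _ = 0
    rw [Place.ord, h.valued_det]
    simp

theorem detDivisor_apply (g : GL (Fin r) (Adele k F)) (p : Place k F) :
    detDivisor g p = p.ord (component g p).val.det := rfl

theorem valued_det_eq_exp (g : GL (Fin r) (Adele k F)) (p : Place k F) :
    Valued.v (component g p).val.det = WithZero.exp (-detDivisor g p) := by
  rw [detDivisor_apply, Place.ord, neg_neg, WithZero.exp_log]
  simpa using det_ne_zero (component g p)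

theorem finsum_eq_degree (E : Divisor k F) : ∑ᶠ p : Place k F, E p * p.degree = E.degree := by
  rw [finsum_eq_sum_of_support_subset (s := E.support)]
  · rfl
  · intro p hp
    simp only [Function.mem_support] at hp
    simpa using left_ne_zero_of_mul hp

theorem degree_eq_degree_detDivisor (g : GL (Fin r) (Adele k F)) :
    degree g = (detDivisor g).degree := finsum_eq_degree (detDivisor g)

/-- Use the standard basis of F^r as rational frame and the columns of h_p as stalk basis, where g_p
h_p is integral. The transition determinant det h_p⁻¹ then has the order of det g_p. -/
theorem hasDegree_sheaf (g : GL (Fin r) (Adele k F)) : HasDegree r (sheaf g) (degree g) := by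
  classical
  choose h hh using fun p => exists_isIntegralAt_mul p (component g p)
  refine ⟨(1 : GL (Fin r) F).val.col, fun p => (h p).val.col, fun p => ((h p)⁻¹).val.transpose,
    linearIndependent_col _, fun p => ⟨linearIndependent_col _, sheaf_eq_span_col (hh p)⟩,
    fun p i => ?_, finsum_congr fun p => ?_⟩
  · have h1 := mulVec_eq_sum_col (h p).val fun j => ((h p)⁻¹).val j i
    refine Eq.trans ?_ h1
    ext j
    exact (congrFun (congrFun (h p).mul_inv j) i).symm
  · congr 1
    have h1 := (hh p).valued_det
    rw [Units.val_mul, Matrix.det_mul, map_mul] at h1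
    rw [Matrix.det_transpose, ← p.det_embedGL, p.embedGL_inv, Place.ord, Place.ord]
    have h2 : ((p.embedGL (h p))⁻¹).val.det * (p.embedGL (h p)).val.det = 1 := by
      rw [← Matrix.det_mul, Units.inv_mul, Matrix.det_one]
    have h3 := congrArg (Valued.v (R := p.Compl)) h2
    rw [map_mul, map_one] at h3
    have h4 : Valued.v (p.embedGL (h p)).val.det ≠ 0 := by
      simpa using det_ne_zero (p.embedGL (h p))
    rw [mul_right_cancel₀ h4 (h1.trans h3.symm)]

/-- Near p use the basis at p itself: its transition matrices to and from b have finitely many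
poles, and b generates almost all stalks. -/
theorem isLocallyFree_of_span_eq [IsFunctionField k F] {s m : ℕ} {M : Stalks k F m}
    {b : Fin s → Fin m → F}
    {e : Place k F → Fin s → Fin m → F} (he : ∀ p, LinearIndependent F (e p))
    (hM : ∀ p, M p = Submodule.span p.localRing (Set.range (e p)))
    (hspan : ∀ p, Submodule.span F (Set.range (e p)) = Submodule.span F (Set.range b))
    (hfin : {p | M p ≠ Submodule.span p.localRing (Set.range b)}.Finite) :
    IsLocallyFree s M := by
  have key (b e : Fin s → Fin m → F)
      (hbe : Submodule.span F (Set.range e) = Submodule.span F (Set.range b)) :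
      {q : Place k F | ¬ Submodule.span q.localRing (Set.range b) ≤
        Submodule.span q.localRing (Set.range e)}.Finite := by
    have h1 (i : Fin s) : ∃ c : Fin s → F, ∑ j, c j • e j = b i :=
      (Submodule.mem_span_range_iff_exists_fun F).1 (hbe ▸ Submodule.subset_span ⟨i, rfl⟩)
    choose c hc using h1
    refine (Set.finite_iUnion fun i => Set.finite_iUnion fun j =>
      finite_poles (k := k) (c i j)).subset fun q hq => ?_
    by_contra h
    simp only [Set.mem_iUnion, Set.mem_ofPred_eq, not_exists, not_lt] at h
    refine hq (Submodule.span_le.2 ?_)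
    rintro _ ⟨i, rfl⟩
    exact mem_span_localRing.2 ⟨c i, h i, (hc i).symm⟩
  intro p
  set U : Set (Place k F) := {q | M q = Submodule.span q.localRing (Set.range (e p))} with hU
  refine ⟨U, hM p, ?_, e p, he p, fun q hq => hq⟩
  refine ((hfin.union (key _ _ (hspan p))).union (key _ _ (hspan p).symm)).subset fun q hq => ?_
  by_contra h
  simp only [Set.mem_union, Set.mem_ofPred_eq, not_or, not_not] at h
  exact hq (h.1.1.trans (le_antisymm h.1.2 h.2))

theorem sheaf_ne_of_span {s : ℕ} (hs : s < r) {g : GL (Fin r) (Adele k F)} {M : Stalks k F r}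
    {p : Place k F} {e : Fin s → Fin r → F}
    (hM : M p = Submodule.span p.localRing (Set.range e)) : M ≠ sheaf g := by
  rintro rfl
  obtain ⟨h, hh⟩ := exists_isIntegralAt_mul p (component g p)
  have h1 : Set.range h.val.col ⊆ Submodule.span F (Set.range e) := by
    refine subset_trans ?_ (Submodule.span_subset_span p.localRing F _)
    rw [← hM, sheaf_eq_span_col hh]
    exact Submodule.subset_span
  have h2 := (linearIndependent_col h).fintype_card_le_finrank
  have h3 := Submodule.finrank_mono (Submodule.span_le.2 h1)
  rw [finrank_span_eq_card (linearIndependent_col h), Fintype.card_fin] at h3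
  have h4 := finrank_range_le_card (R := F) e
  rw [Fintype.card_fin] at h4
  exact absurd (h3.trans h4) (by omega)

end AdelicCode

end

noncomputable section

namespace AdelicCode

universe u v

variable {k : Type u} {F : Type v} [Field k] [Field F] [Algebra k F] {r : ℕ}

/-! ### Vanishing of `H⁰` -/

theorem component_twistNeg (g : GL (Fin r) (Adele k F)) (E : Divisor k F) (p : Place k F) :
    (component (twistNeg g E) p).val = p.pi ^ (-E p) • (component g p).val := by
  rw [twistNeg, component_mul, Units.val_mul]
  have h1 : (component (Matrix.GeneralLinearGroup.scalar (Fin r) E.idele⁻¹) p).val =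
      p.pi ^ (-E p) • 1 := by
    ext i j
    rw [component_val]
    change ((Matrix.scalar (Fin r) (E.idele⁻¹).val) i j) p = _
    rw [Matrix.scalar_apply, Matrix.smul_apply, Matrix.diagonal_apply, Matrix.one_apply]
    split_ifs
    · rw [smul_eq_mul, mul_one]
      rfl
    · rw [smul_zero]
      rfl
  rw [h1, Matrix.smul_mul, one_mul]

theorem detDivisor_twistNeg (g : GL (Fin r) (Adele k F)) (E : Divisor k F) :
    detDivisor (twistNeg g E) = detDivisor g - r • E := by
  ext p
  apply neg_injective
  apply WithZero.exp_injective
  rw [← valued_det_eq_exp, component_twistNeg, Matrix.det_smul, map_mul, map_pow,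
    Place.valued_pi_zpow, valued_det_eq_exp, ← WithZero.exp_nsmul, ← WithZero.exp_add]
  congr 1
  simp
  ring

theorem degree_twistNeg (g : GL (Fin r) (Adele k F)) (E : Divisor k F) :
    degree (twistNeg g E) = degree g - r * E.degree := by
  rw [degree_eq_degree_detDivisor, degree_eq_degree_detDivisor, detDivisor_twistNeg,
    Divisor.degree_sub, Divisor.degree_nsmul]

theorem mem_sheaf_twistNeg {g : GL (Fin r) (Adele k F)} {E : Divisor k F} {p : Place k F}
    {f : Fin r → F} : f ∈ sheaf (twistNeg g E) p ↔ p.unif ^ (-E p) • f ∈ sheaf g p := by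
  rw [mem_sheaf, mem_sheaf]
  have h1 : (fun i => algebraMap F p.Compl ((p.unif ^ (-E p) • f) i)) =
      p.pi ^ (-E p) • fun i => algebraMap F p.Compl (f i) := by
    ext i
    simp [Place.pi]
  rw [h1, Matrix.mulVec_smul, component_twistNeg, Matrix.smul_mulVec]

variable [IsFunctionField k F]

theorem H0_eq_bot_of_degree_neg {g : GL (Fin 1) (Adele k F)} (h : degree g < 0) : H0 g = ⊥ := by
  rw [eq_bot_iff]
  intro f hf
  by_contra hf0
  have hf0' : f 0 ≠ 0 := fun h0 => hf0 <| by
    rw [Submodule.mem_bot]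
    ext i
    rw [Subsingleton.elim i 0, h0]
    rfl
  rw [mem_H0] at hf
  have h1 : 0 ≤ detDivisor g + divisor k (f 0) := by
    intro p
    have h2 := mem_sheaf.1 (hf p) 0
    rw [Matrix.mulVec, dotProduct, Fin.sum_univ_one, ← Matrix.det_fin_one (component g p).val,
      Place.mem_complBall, map_mul, valued_det_eq_exp, Place.valued_algebraMap,
      val_eq_exp hf0', ← WithZero.exp_add, WithZero.exp_le_exp] at h2
    simp only [Finsupp.add_apply, Finsupp.zero_apply]
    omega
  have h2 := Divisor.degree_mono h1
  rw [Divisor.degree_zero, Divisor.degree_add, degree_divisor, add_zero,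
    ← degree_eq_degree_detDivisor] at h2
  omega

/-- A nonzero section f would give the line subsheaf f·O(E) of 𝓔(g), of degree deg E > deg g / r,
contrary to semi-stability. -/
theorem IsSemistable.H0_twistNeg_eq_bot {g : GL (Fin r) (Adele k F)} (hss : IsSemistable g)
    (hr : 0 < r) {E : Divisor k F} (hE : degree g < r * E.degree) : H0 (twistNeg g E) = ⊥ := by
  -- In rank one the line subsheaf need not be proper, so semi-stability may say nothing; there a
  -- nonzero section has an effective divisor of degree deg g - deg E.
  obtain rfl | hr1 : r = 1 ∨ 1 < r := by omega
  · refine H0_eq_bot_of_degree_neg ?_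
    rw [degree_twistNeg]
    omega
  rw [eq_bot_iff]
  intro f hf
  by_contra hf0
  rw [Submodule.mem_bot] at hf0
  rw [mem_H0] at hf
  let e : Place k F → Fin 1 → Fin r → F := fun p _ => p.unif ^ (-E p) • f
  have hu (p : Place k F) (m : ℤ) : p.unif ^ m ≠ 0 := zpow_ne_zero _ p.unif_ne_zero
  let M : Stalks k F r := fun p => Submodule.span p.localRing (Set.range (e p))
  have hind {x : Fin r → F} (hx : x ≠ 0) : LinearIndependent F fun _ : Fin 1 => x :=
    LinearIndependent.of_subsingleton 0 hx
  have he (p : Place k F) : LinearIndependent F (e p) := hind (smul_ne_zero (hu p _) hf0)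
  have hdeg : HasDegree 1 M E.degree := by
    refine ⟨fun _ => f, e, fun p => Matrix.of fun _ _ => p.unif ^ E p, hind hf0,
      fun p => ⟨he p, rfl⟩, fun p i => ?_, ?_⟩
    · change f = ∑ j : Fin 1, p.unif ^ E p • p.unif ^ (-E p) • f
      rw [Fin.sum_univ_one, smul_smul, ← zpow_add₀ p.unif_ne_zero, add_neg_cancel, zpow_zero,
        one_smul]
    · rw [← finsum_eq_degree]
      refine finsum_congr fun p => ?_
      congr 1
      rw [Matrix.det_fin_one]
      change E p = p.ord (algebraMap F p.Compl (p.unif ^ E p))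
      rw [Place.ord, Place.valued_algebraMap, map_zpow₀,
        Place.val_unif, ← WithZero.exp_zsmul]
      simp
  have hfree : IsLocallyFree 1 M := by
    refine isLocallyFree_of_span_eq (b := fun _ => f) he (fun _ => rfl) (fun p => ?_) ?_
    · rw [Set.range_const, Set.range_const]
      exact Submodule.span_singleton_smul_eq (hu p _).isUnit f
    · refine E.hasFiniteSupport.subset fun p hp => ?_
      contrapose! hp
      rw [Function.notMem_support] at hp
      simp [M, e, hp]
  obtain ⟨p⟩ := (inferInstance : Nonempty (Place k F))
  have h1 := hss 1 M one_pos hfree (fun p => Submodule.span_le.2 (by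
    rintro _ ⟨i, rfl⟩
    exact mem_sheaf_twistNeg.1 (hf p))) (sheaf_ne_of_span hr1 (p := p) rfl) _ _ hdeg
    (hasDegree_sheaf g)
  rw [Nat.cast_one, div_one, le_div_iff₀ (by exact_mod_cast hr)] at h1
  have h2 : E.degree * r ≤ degree g := by exact_mod_cast h1
  rw [mul_comm] at h2
  omega

end AdelicCode

end

noncomputable section

namespace AdelicCode

universe u v

variable {k : Type u} {F : Type v} [Field k] [Field F] [Algebra k F]

/-! ### Vanishing of `H¹` -/

/-- A stalk with a basis adapted to a linear form. -/
theorem exists_adapted {s : ℕ} {p : Place k F} {A : GL (Fin (s + 1)) p.Compl}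
    {φ : (Fin (s + 1) → F) →ₗ[F] F} (hφ : φ ≠ 0) :
    ∃ h : GL (Fin (s + 1)) F, IsIntegralAt p (A * p.embedGL h) ∧
      φ (h.val.col 0) ≠ 0 ∧ ∀ j : Fin s, φ (h.val.col j.succ) = 0 := by
  obtain ⟨h, hh⟩ := exists_isIntegralAt_mul p A
  -- A column with largest |φ| serves as pivot: the multiples of it needed to clear φ on the other
  -- columns have integral coefficients, so the stalk is unchanged.
  obtain ⟨i₀, hi₀⟩ := Finite.exists_max fun i => p.val (φ (h.val.col i))
  have hne : φ (h.val.col i₀) ≠ 0 := by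
    intro h0
    refine hφ (LinearMap.ext fun x => ?_)
    have h1 : x = h.val.mulVec (h⁻¹.val.mulVec x) := by
      rw [Matrix.mulVec_mulVec, h.mul_inv, Matrix.one_mulVec]
    rw [h1, mulVec_eq_sum_col, map_sum]
    refine Finset.sum_eq_zero fun i _ => ?_
    have h2 := hi₀ i
    simp only [h0, map_zero, le_zero_iff, map_eq_zero] at h2
    rw [map_smul, h2, smul_zero]
  set c : Fin (s + 1) → F := fun i => φ (h.val.col i) / φ (h.val.col i₀) with hc
  have hcint (i : Fin (s + 1)) : c i ∈ p.localRing := by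
    change p.val (_ / _) ≤ 1
    rw [map_div₀]
    exact div_le_one_of_le₀ (hi₀ i) zero_le
  let σ := Equiv.swap 0 i₀
  let e : Fin (s + 1) → Fin (s + 1) → F := Fin.cons (h.val.col i₀)
    fun j => h.val.col (σ j.succ) - c (σ j.succ) • h.val.col i₀
  have he (l : Fin (s + 1)) : h.val.col (σ l) ∈ Submodule.span p.localRing (Set.range e) := by
    have h0 : h.val.col i₀ ∈ Submodule.span p.localRing (Set.range e) :=
      Submodule.subset_span ⟨0, rfl⟩
    refine Fin.cases ?_ (fun j => ?_) l
    · rwa [Equiv.swap_apply_left]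
    · have h1 : e j.succ ∈ Submodule.span p.localRing (Set.range e) :=
        Submodule.subset_span ⟨_, rfl⟩
      have h2 : h.val.col (σ j.succ) = e j.succ +
          (⟨c (σ j.succ), hcint _⟩ : p.localRing) • h.val.col i₀ :=
        (sub_add_cancel _ _).symm
      rw [h2]
      exact Submodule.add_mem _ h1 (Submodule.smul_mem _ _ h0)
  have hspan : Submodule.span p.localRing (Set.range h.val.col) =
      Submodule.span p.localRing (Set.range e) := by
    apply le_antisymm
    · rw [Submodule.span_le]
      rintro _ ⟨l, rfl⟩
      have := he (σ l)
      rwa [Equiv.swap_apply_self] at this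
    · rw [Submodule.span_le]
      rintro _ ⟨l, rfl⟩
      refine Fin.cases (Submodule.subset_span ⟨i₀, rfl⟩) (fun j => ?_) l
      exact Submodule.sub_mem _ (Submodule.subset_span ⟨_, rfl⟩) (Submodule.smul_mem _
        (⟨c (σ j.succ), hcint _⟩ : p.localRing) (Submodule.subset_span ⟨i₀, rfl⟩))
  have hli : LinearIndependent F e := by
    refine linearIndependent_of_top_le_span_of_card_eq_finrank ?_ (by simp)
    have h1 := (linearIndependent_col h).span_eq_top_of_card_eq_finrank' (by simp)
    rw [← h1, Submodule.span_le]
    refine subset_trans ?_ (Submodule.span_subset_span p.localRing F _)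
    rw [← hspan]
    exact Submodule.subset_span
  have hunit : IsUnit (Matrix.of fun i j => e j i) :=
    Matrix.linearIndependent_cols_iff_isUnit.1 hli
  refine ⟨hunit.unit, hh.of_span_eq hspan, hne, fun j => ?_⟩
  change φ (h.val.col (σ j.succ) - c (σ j.succ) • h.val.col i₀) = 0
  rw [map_sub, map_smul, smul_eq_mul, hc, div_mul_cancel₀ _ hne, sub_self]

variable [IsFunctionField k F]

/-- The kernel of a linear form on the sheaf of an idelic matrix is locally free, and of large
degree. -/
theorem exists_kernel_sheaf {s : ℕ} (g : GL (Fin (s + 1)) (Adele k F))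
    {φ : (Fin (s + 1) → F) →ₗ[F] F} (hφ : φ ≠ 0) {W : Divisor k F}
    (hW : ∀ p, ∀ x ∈ sheaf g p, p.val (φ x) ≤ WithZero.exp (W p)) :
    ∃ (M : Stalks k F (s + 1)) (d : ℤ), IsLocallyFree s M ∧ M ≤ sheaf g ∧ M ≠ sheaf g ∧
      HasDegree s M d ∧ degree g ≤ d + W.degree ∧ (s = 0 → d = 0) := by
  classical
  obtain ⟨p₀⟩ := (inferInstance : Nonempty (Place k F))
  choose h hh hh0 hhs using fun p => exists_adapted (p := p) (A := component g p) hφ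
  -- A single adapted basis B is kept wherever it generates the stalk, that is, at almost all
  -- places. So the kernel has one global frame and the transition determinants are 1 almost
  -- everywhere.
  set B := h p₀ with hB
  let H : Place k F → GL (Fin (s + 1)) F := fun p =>
    if IsIntegralAt p (component g p * p.embedGL B) then B else h p
  have hHB {p : Place k F} (hp : IsIntegralAt p (component g p * p.embedGL B)) : H p = B :=
    if_pos hp
  have hH (p : Place k F) : IsIntegralAt p (component g p * p.embedGL (H p)) := by
    by_cases hp : IsIntegralAt p (component g p * p.embedGL B)
    · rwa [hHB hp]
    · rw [show H p = h p from if_neg hp]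
      exact hh p
  have hH0 (p : Place k F) : φ ((H p).val.col 0) ≠ 0 := by
    simp only [H]
    split_ifs
    exacts [hh0 p₀, hh0 p]
  have hHs (p : Place k F) (j : Fin s) : φ ((H p).val.col j.succ) = 0 := by
    simp only [H]
    split_ifs
    exacts [hhs p₀ j, hhs p j]
  have hfin := finite_not_isIntegralAt_embedGL g B
  let b : Fin s → Fin (s + 1) → F := fun j => B.val.col j.succ
  let e : Place k F → Fin s → Fin (s + 1) → F := fun p j => (H p).val.col j.succ
  have hli (h : GL (Fin (s + 1)) F) : LinearIndependent F fun j : Fin s => h.val.col j.succ :=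
    (linearIndependent_col h).comp _ (Fin.succ_injective s)
  let M : Stalks k F (s + 1) := fun p => sheaf g p ⊓ (LinearMap.ker φ).restrictScalars p.localRing
  have hker (h : GL (Fin (s + 1)) F) (h0 : φ (h.val.col 0) ≠ 0)
      (hs : ∀ j : Fin s, φ (h.val.col j.succ) = 0) (c : Fin (s + 1) → F) :
      φ (∑ i, c i • h.val.col i) = 0 ↔ c 0 = 0 := by
    simp [Fin.sum_univ_succ, hs, h0]
  have hM (p : Place k F) : M p = Submodule.span p.localRing (Set.range (e p)) := by
    apply le_antisymm
    · rintro x ⟨hx, hx0⟩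
      rw [sheaf_eq_span_col (hH p)] at hx
      obtain ⟨c, hc, rfl⟩ := mem_span_localRing.1 hx
      have h1 : c 0 = 0 := (hker _ (hH0 p) (hHs p) c).1 hx0
      refine mem_span_localRing.2 ⟨fun j => c j.succ, fun j => hc _, ?_⟩
      rw [Fin.sum_univ_succ, h1, zero_smul, zero_add]
    · rw [Submodule.span_le]
      rintro _ ⟨j, rfl⟩
      refine ⟨?_, hHs p j⟩
      rw [sheaf_eq_span_col (hH p)]
      exact Submodule.subset_span ⟨_, rfl⟩
  let C : Place k F → Matrix (Fin (s + 1)) (Fin (s + 1)) F := fun p => (H p)⁻¹.val * B.val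
  have hC (p : Place k F) (l : Fin (s + 1)) :
      B.val.col l = ∑ j, C p j l • (H p).val.col j := by
    rw [← mulVec_eq_sum_col (H p).val fun j => C p j l]
    have h1 : B.val = (H p).val * C p := by
      rw [← Matrix.mul_assoc, (H p).mul_inv, Matrix.one_mul]
    conv_lhs => rw [h1]
    rfl
  have hC0 (p : Place k F) (j : Fin s) : C p 0 j.succ = 0 := by
    refine (hker _ (hH0 p) (hHs p) fun i => C p i j.succ).1 ?_
    rw [← hC]
    exact hhs p₀ j
  -- Both bases are adapted to φ, so the first row of C_p vanishes off the corner. Its lower block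
  -- is the transition matrix of the kernel, and det C_p is the corner entry times det A_p.
  let A : Place k F → Matrix (Fin s) (Fin s) F := fun p =>
    ((C p).submatrix Fin.succ Fin.succ).transpose
  have hA (p : Place k F) (i : Fin s) : b i = ∑ j, A p i j • e p j := by
    change B.val.col i.succ = _
    rw [hC p, Fin.sum_univ_succ, hC0, zero_smul, zero_add]
    rfl
  have hdetC (p : Place k F) : (C p).det = C p 0 0 * (A p).det := by
    rw [Matrix.det_succ_row_zero, Fin.sum_univ_succ, Matrix.det_transpose]
    simp [hC0]
  have hA1 {p : Place k F} (hp : IsIntegralAt p (component g p * p.embedGL B)) :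
      (A p).det = 1 := by
    have h1 : C p = 1 := by
      change (H p)⁻¹.val * B.val = 1
      rw [hHB hp, B.inv_mul]
    have h2 : A p = 1 := by
      change ((C p).submatrix Fin.succ Fin.succ).transpose = 1
      rw [h1, Matrix.submatrix_one _ (Fin.succ_injective s), Matrix.transpose_one]
    rw [h2, Matrix.det_one]
  have hord1 (p : Place k F) : p.ord (algebraMap F p.Compl 1) = 0 := by
    simp [Place.ord]
  let D : Divisor k F := Finsupp.ofSupportFinite
    (fun p => p.ord (algebraMap F p.Compl (A p).det)) <| by
      refine hfin.subset fun p hp hpi => hp ?_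
      change p.ord _ = 0
      rw [hA1 hpi, hord1]
  have hspan (p : Place k F) :
      Submodule.span F (Set.range (e p)) = Submodule.span F (Set.range b) := by
    refine (Submodule.eq_of_le_of_finrank_eq ?_ ?_).symm
    · rw [Submodule.span_le]
      rintro _ ⟨i, rfl⟩
      exact (Submodule.mem_span_range_iff_exists_fun F).2 ⟨A p i, (hA p i).symm⟩
    · rw [finrank_span_eq_card (hli B), finrank_span_eq_card (hli (H p))]
  refine ⟨M, D.degree, isLocallyFree_of_span_eq (fun p => hli (H p)) hM hspan
    (hfin.subset fun p hp hpi => hp ?_), fun p => inf_le_left,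
    sheaf_ne_of_span s.lt_succ_self (hM p₀),
    ⟨b, e, A, hli B, fun p => ⟨hli (H p), hM p⟩, hA, (finsum_eq_degree D).symm⟩, ?_, ?_⟩
  · rw [hM p]
    simp only [e, b, hHB hpi]
  · have hdetB : B.val.det ≠ 0 := det_ne_zero B
    have hB0 : φ (B.val.col 0) ≠ 0 := hh0 p₀
    -- Locally det C_p carries the orders of det B and det g_p, and its corner entry is the ratio of
    -- two values of φ, the second bounded by W. The principal divisors disappear in degree.
    have hle : divisor k B.val.det + detDivisor g ≤ D + divisor k (φ (B.val.col 0)) + W := by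
      intro p
      have hdet : p.val (C p).det = p.val B.val.det * Valued.v (component g p).val.det := by
        have h1 := (hH p).valued_det
        rw [Units.val_mul, Matrix.det_mul, map_mul, p.det_embedGL, Place.valued_algebraMap] at h1
        have h2 : (H p).val.det * (C p).det = B.val.det := by
          rw [← Matrix.det_mul, ← Matrix.mul_assoc, (H p).mul_inv, Matrix.one_mul]
        rw [← h2, map_mul, mul_right_comm, mul_comm (p.val (H p).val.det), h1, one_mul]
      have hCne : (C p).det ≠ 0 := by
        intro h0
        rw [h0, map_zero, eq_comm, mul_eq_zero, map_eq_zero, map_eq_zero] at hdet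
        exact hdet.elim hdetB (det_ne_zero _)
      have hAne : (A p).det ≠ 0 := right_ne_zero_of_mul (hdetC p ▸ hCne)
      have hvA : p.val (A p).det = WithZero.exp (-D p) := by
        change _ = WithZero.exp (- -WithZero.log (Valued.v (algebraMap F p.Compl (A p).det)))
        rw [neg_neg, Place.valued_algebraMap, WithZero.exp_log]
        simpa using hAne
      have hφ0 : φ (B.val.col 0) = C p 0 0 * φ ((H p).val.col 0) := by
        rw [hC p 0, Fin.sum_univ_succ]
        simp [hHs]
      have hmem : (H p).val.col 0 ∈ sheaf g p := by
        rw [sheaf_eq_span_col (hH p)]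
        exact Submodule.subset_span ⟨0, rfl⟩
      have key : p.val (A p).det * p.val (φ (B.val.col 0)) ≤
          p.val B.val.det * Valued.v (component g p).val.det * WithZero.exp (W p) := by
        rw [← hdet, hdetC, hφ0, map_mul, map_mul, ← mul_assoc, mul_comm (p.val (A p).det)]
        exact mul_le_mul_right (hW p _ hmem) _
      rw [hvA, val_eq_exp hB0, val_eq_exp hdetB, valued_det_eq_exp, ← WithZero.exp_add,
        ← WithZero.exp_add, ← WithZero.exp_add, WithZero.exp_le_exp] at key
      simp only [Finsupp.add_apply]
      omega
    have h1 := Divisor.degree_mono hle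
    rw [Divisor.degree_add, Divisor.degree_add, Divisor.degree_add, degree_divisor,
      degree_divisor, ← degree_eq_degree_detDivisor] at h1
    omega
  · rintro rfl
    have h1 : D = 0 := by
      ext p
      change p.ord (algebraMap F p.Compl (A p).det) = 0
      rw [Matrix.det_fin_zero, hord1]
    rw [h1, Divisor.degree_zero]

/-- A nonzero element gives a nonzero map φ from 𝓔(g) to O(W). Its kernel has degree d ≥ deg g -
2(γ-1) and rank r - 1, and d/(r-1) ≤ deg g / r forces deg g ≤ 2r(γ-1). -/
theorem IsSemistable.differentialSpace_eq_bot {r : ℕ} {g : GL (Fin r) (Adele k F)}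
    (hss : IsSemistable g) (hr : 0 < r) {ω₀ : Module.Dual k (Adele k F)} (hω0 : ω₀ ≠ 0)
    (hω : ω₀ ∈ Differentials k F) (hdeg : degree g > 2 * r * (genus k F - 1)) :
    differentialSpace ω₀ g = ⊥ := by
  obtain ⟨s, rfl⟩ : ∃ s, r = s + 1 := ⟨r - 1, by omega⟩
  obtain ⟨W, hW⟩ := exists_divisor_eq_ordDifferential hω0 hω
  have hWdeg := degree_canonical hω0 hω hW
  rw [eq_bot_iff]
  rintro ω ⟨-, f, hf, hloc⟩
  by_contra hne
  rw [Submodule.mem_bot] at hne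
  let φ := Fintype.linearCombination F f
  have hφ : φ ≠ 0 := by
    intro h0
    refine hne (funext fun j => ?_)
    have h1 : f j = 0 := by
      have := LinearMap.congr_fun h0 (Pi.single j 1)
      simpa [φ, Fintype.linearCombination_apply, Pi.single_apply] using this
    rw [hf, h1]
    ext a
    simp [fmul]
  obtain ⟨M, d, hfree, hle, hMne, hd, hdle, hd0⟩ := exists_kernel_sheaf g hφ (W := W) (by
    intro p x hx
    obtain ⟨y, hy, hfy⟩ := hloc p
    have h1 := sum_mul_mem_complBall hy hfy (mem_sheaf.1 hx)
    have h2 : ∑ j, algebraMap F p.Compl (f j) * algebraMap F p.Compl (x j) =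
        algebraMap F p.Compl (φ x) := by
      simp only [φ, Fintype.linearCombination_apply, map_sum, smul_eq_mul, map_mul]
      exact Finset.sum_congr rfl fun j _ => mul_comm _ _
    rw [h2, Place.algebraMap_mem_complBall] at h1
    rwa [hW])
  -- In rank one the kernel is zero and cannot test semi-stability; d = 0 gives deg g ≤ deg W
  -- directly.
  obtain rfl | hs := Nat.eq_zero_or_pos s
  · rw [hd0 rfl, hWdeg] at hdle
    push_cast at hdeg
    omega
  have h1 := hss s M hs hfree hle hMne _ _ hd (hasDegree_sheaf g)
  rw [div_le_div_iff₀ (by exact_mod_cast hs) (by positivity)] at h1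
  have h2 : d * (s + 1) ≤ degree g * s := by exact_mod_cast h1
  have h3 : (degree g - W.degree) * (s + 1) ≤ d * (s + 1) :=
    mul_le_mul_of_nonneg_right (by omega) (by omega)
  push_cast at hdeg
  rw [hWdeg] at h3
  nlinarith

end AdelicCode

end

noncomputable section

namespace AdelicCode

universe u v

variable {k : Type u} {F : Type v} [Field k] [Field F] [Algebra k F]

/-! ### Values at rational points -/

namespace Place

theorem HasValue.unique {p : Place k F} {f : F} {c c' : k} (h : p.HasValue f c)
    (h' : p.HasValue f c') : c = c' := by
  by_contra hne
  have h1 := p.map_const (c - c') (sub_ne_zero.2 hne)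
  have h2 : algebraMap k F (c - c') = (f - algebraMap k F c') - (f - algebraMap k F c) := by
    rw [map_sub]; ring
  have h3 : p.val (algebraMap k F (c - c')) < 1 := by
    rw [h2]
    exact (p.val.map_sub _ _).trans_lt (max_lt h' h)
  exact h3.ne h1

theorem HasValue.add {p : Place k F} {f f' : F} {c c' : k} (h : p.HasValue f c)
    (h' : p.HasValue f' c') : p.HasValue (f + f') (c + c') := by
  have h1 : f + f' - algebraMap k F (c + c') =
      (f - algebraMap k F c) + (f' - algebraMap k F c') := by
    rw [map_add]; ring
  rw [HasValue, h1]
  exact p.vanishing.add_mem h h'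

theorem HasValue.smul {p : Place k F} {f : F} {c : k} (h : p.HasValue f c) (a : k) :
    p.HasValue (a • f) (a * c) := by
  have h1 : a • f - algebraMap k F (a * c) = a • (f - algebraMap k F c) := by
    rw [map_mul, smul_sub, Algebra.smul_def, Algebra.smul_def]
  rw [HasValue, h1]
  exact p.vanishing.smul_mem a h

theorem hasValue_zero_iff {p : Place k F} {f : F} :
    p.HasValue f 0 ↔ p.val f ≤ WithZero.exp (-1) := by
  rw [HasValue, map_zero, sub_zero, lt_one_iff_le_exp]

/-- At a rational point the residue field is one-dimensional over k, hence spanned by 1. -/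
theorem exists_hasValue {p : Place k F} (hp : p.degree = 1) {f : F} (hf : p.val f ≤ 1) :
    ∃ c, p.HasValue f c := by
  have hone : (1 : F) ∈ p.regular := (map_one p.val).le
  let V := p.vanishing.comap p.regular.subtype
  have hne : V.mkQ ⟨1, hone⟩ ≠ 0 := by
    rw [Ne, Submodule.mkQ_apply, Submodule.Quotient.mk_eq_zero]
    intro h
    have h1 : p.val 1 < 1 := h
    rw [map_one] at h1
    exact lt_irrefl _ h1
  obtain ⟨c, hc⟩ := (finrank_eq_one_iff_of_nonzero' _ hne).1 hp (V.mkQ ⟨f, hf⟩)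
  refine ⟨c, ?_⟩
  rw [← map_smul, eq_comm, ← sub_eq_zero, ← map_sub, Submodule.mkQ_apply,
    Submodule.Quotient.mk_eq_zero] at hc
  rw [HasValue, Algebra.algebraMap_eq_smul_one]
  exact hc

end Place

/-! ### Balanced matrices -/

variable {n r : ℕ}

theorem IsBalanced.isIntegralAt {P : Fin n → Place k F} {g : GL (Fin r) (Adele k F)}
    (hg : IsBalanced P g) (i : Fin n) : IsIntegralAt (P i) (component g (P i)) := by
  obtain ⟨-, M, N, h⟩ := hg i
  set A := component g (P i)
  set M' := Matrix.GeneralLinearGroup.map (P i).integers.subtype M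
  set N' := Matrix.GeneralLinearGroup.map (P i).integers.subtype N
  have hM : IsIntegralAt (P i) M' := ⟨M, rfl⟩
  have hN : IsIntegralAt (P i) N' := ⟨N, rfl⟩
  have h1 : M' * A * N' = 1 := by
    refine Units.ext (h.trans ?_)
    simp
  have h2 : A = M'⁻¹ * N'⁻¹ := by
    rw [eq_mul_inv_iff_mul_eq]
    exact eq_inv_of_mul_eq_one_right (by rwa [← mul_assoc])
  rw [h2]
  exact hM.inv.mul hN.inv

theorem IsIntegralAt.mem_sheaf_iff {g : GL (Fin r) (Adele k F)} {p : Place k F}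
    (hg : IsIntegralAt p (component g p)) {f : Fin r → F} :
    f ∈ sheaf g p ↔ ∀ j, p.val (f j) ≤ 1 := by
  rw [mem_sheaf, hg.mulVec_mem_iff]
  simp only [Place.algebraMap_mem_complBall, WithZero.exp_zero]

theorem IsIntegralAt.transpose_mulVec_mem {p : Place k F} {A : GL (Fin r) p.Compl}
    (hA : IsIntegralAt p A) {y : Fin r → p.Compl} (hy : ∀ j, y j ∈ p.integers) (j : Fin r) :
    A.val.transpose.mulVec y j ∈ p.integers := by
  obtain ⟨M, hM⟩ := hA
  rw [← hM, Matrix.mulVec, dotProduct]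
  refine p.integers.sum_mem fun i _ => ?_
  rw [Place.mem_integers, map_mul]
  exact mul_le_one' (M.val i j).2 (hy i)

theorem IsIntegralAt.exists_transpose_mulVec_eq {p : Place k F} {A : GL (Fin r) p.Compl}
    (hA : IsIntegralAt p A) {z : Fin r → p.Compl} (hz : ∀ j, z j ∈ p.integers) :
    ∃ y : Fin r → p.Compl, (∀ j, y j ∈ p.integers) ∧ A.val.transpose.mulVec y = z := by
  refine ⟨A⁻¹.val.transpose.mulVec z, hA.inv.transpose_mulVec_mem hz, ?_⟩
  rw [Matrix.mulVec_mulVec, ← Matrix.transpose_mul, A.inv_mul, Matrix.transpose_one,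
    Matrix.one_mulVec]

theorem pointDivisor_apply_self {P : Fin n → Place k F} (hP : Function.Injective P) (i : Fin n) :
    pointDivisor P (P i) = 1 := by
  classical
  rw [pointDivisor, Finsupp.finsetSum_apply, Finset.sum_eq_single_of_mem i (Finset.mem_univ i)
    fun j _ hj => Finsupp.single_eq_of_ne (hP.ne hj.symm), Finsupp.single_eq_same]

theorem pointDivisor_apply_of_notMem {P : Fin n → Place k F} {p : Place k F}
    (hp : p ∉ Set.range P) : pointDivisor P p = 0 := by
  rw [pointDivisor, Finsupp.finsetSum_apply]
  exact Finset.sum_eq_zero fun i _ => Finsupp.single_eq_of_ne fun h => hp ⟨i, h.symm⟩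

/-! ### The dimensions of the codes -/

variable [IsFunctionField k F]

/-- The code is the image of evaluation on H⁰(g). Balancedness makes the stalk at p_i the standard
lattice, so sections vanishing at all p_i are sections of g(-D), and evaluation is injective. -/
theorem finrank_codeF {P : Fin n → Place k F} (hP : Function.Injective P)
    (hP1 : ∀ i, (P i).degree = 1) {g : GL (Fin r) (Adele k F)} (hg : IsBalanced P g)
    (h0 : H0 (twistNeg g (pointDivisor P)) = ⊥) :
    Module.finrank k (codeF P g) = AdelicCode.h0 g := by
  have hval (f : H0 g) (i : Fin n) (j : Fin r) : ∃ c, (P i).HasValue (f.1 j) c :=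
    Place.exists_hasValue (hP1 i) ((hg.isIntegralAt i).mem_sheaf_iff.1 (mem_H0.1 f.2 (P i)) j)
  choose c hc using hval
  let T : H0 g →ₗ[k] (Fin n → Fin r → k) :=
    { toFun := c
      map_add' := fun f f' => funext fun i => funext fun j =>
        (hc (f + f') i j).unique ((hc f i j).add (hc f' i j))
      map_smul' := fun a f => funext fun i => funext fun j =>
        (hc (a • f) i j).unique ((hc f i j).smul a) }
  have hT : LinearMap.range T = codeF P g := by
    ext x
    constructor
    · rintro ⟨f, rfl⟩
      exact ⟨f.1, f.2, hc f⟩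
    · rintro ⟨f, hf, hx⟩
      exact ⟨⟨f, hf⟩, funext fun i => funext fun j => (hc ⟨f, hf⟩ i j).unique (hx i j)⟩
  rw [← hT, LinearMap.finrank_range_of_inj, AdelicCode.h0]
  rw [← LinearMap.ker_eq_bot, LinearMap.ker_eq_bot']
  intro f hf
  have h1 (i : Fin n) (j : Fin r) : (P i).HasValue (f.1 j) 0 := by
    have h2 : c f i j = 0 := congrFun (congrFun hf i) j
    rw [← h2]
    exact hc f i j
  have h2 : f.1 ∈ H0 (twistNeg g (pointDivisor P)) := by
    rw [mem_H0]
    intro p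
    rw [mem_sheaf_twistNeg]
    by_cases hp : p ∈ Set.range P
    · obtain ⟨i, rfl⟩ := hp
      rw [(hg.isIntegralAt i).mem_sheaf_iff, pointDivisor_apply_self hP]
      intro j
      rw [Pi.smul_apply, smul_eq_mul, map_mul, map_zpow₀, Place.val_unif, ← WithZero.exp_zsmul]
      calc _ ≤ WithZero.exp 1 * WithZero.exp (-1) :=
            mul_le_mul' le_rfl (Place.hasValue_zero_iff.1 (h1 i j))
        _ = 1 := by rw [← WithZero.exp_add, add_neg_cancel, WithZero.exp_zero]
    · rw [pointDivisor_apply_of_notMem hp, neg_zero, zpow_zero, one_smul]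
      exact mem_H0.1 f.2 p
  rw [h0, Submodule.mem_bot] at h2
  exact Subtype.ext h2

/-- Write f = c + (f - c). The order -1 of ω₀ means that it kills functions vanishing at p_i, and
its value on 1 is normalized. -/
theorem IsSpecial.localComponent_eq {P : Fin n → Place k F} {ω₀ : Module.Dual k (Adele k F)}
    (hω₀ : IsSpecial P ω₀) (i : Fin n) {f : F} {c : k} (h : (P i).HasValue f c) :
    fmul f ω₀ (Adele.single (P i) 1) = c := by
  have h1 : fmul f ω₀ (Adele.single (P i) 1) =
      ω₀ (Adele.single (P i) (algebraMap F (P i).Compl f)) := by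
    change ω₀ (algebraMap F (Adele k F) f * Adele.single (P i) 1) = _
    rw [Adele.mul_single, mul_one]
    rfl
  have h2 : algebraMap F (P i).Compl f = algebraMap F (P i).Compl (f - algebraMap k F c) +
      c • (1 : (P i).Compl) := by
    rw [← Algebra.algebraMap_eq_smul_one, IsScalarTower.algebraMap_apply k F (P i).Compl,
      ← map_add, sub_add_cancel]
  have h3 := (isGreatest_ordDifferential hω₀.2.1 hω₀.1 (P i)).1
    (algebraMap F (P i).Compl (f - algebraMap k F c)) (by
      rw [(hω₀.2.2 i).1, Place.valued_algebraMap]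
      exact lt_one_iff_le_exp.1 h)
  have h4 : ω₀ (Adele.single (P i) 1) = 1 := (hω₀.2.2 i).2
  rw [h1, h2, Adele.single_add, map_add, ← Adele.smul_single, map_smul, h4, smul_eq_mul, mul_one]
  exact (congrArg (· + c) h3).trans (zero_add c)

/-- Elements of Ω(g(-D)) with zero local components at all p_i lie in Ω(g), which is assumed zero.
So the code has the dimension of Ω(g(-D)), which is h¹ by Serre duality. -/
theorem finrank_codeΩ {P : Fin n → Place k F} (hP : Function.Injective P)
    (hP1 : ∀ i, (P i).degree = 1) {ω₀ : Module.Dual k (Adele k F)} (hω₀ : IsSpecial P ω₀)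
    {g : GL (Fin r) (Adele k F)} (hg : IsBalanced P g) (h0 : differentialSpace ω₀ g = ⊥) :
    Module.finrank k (codeΩ P ω₀ g) = h1 (twistNeg g (pointDivisor P)) := by
  have key (ω : Fin r → Module.Dual k (Adele k F))
      (hmem : ω ∈ differentialSpace ω₀ (twistNeg g (pointDivisor P)))
      (hω' : ∀ i j, ω j (Adele.single (P i) 1) = 0) : ω = 0 := by
    obtain ⟨hdiff, f, hf, hloc⟩ := hmem
    have h2 : ω ∈ differentialSpace ω₀ g := by
      refine ⟨hdiff, f, hf, fun p => ?_⟩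
      obtain ⟨y, hy, hfy⟩ := hloc p
      rw [component_twistNeg, Matrix.transpose_smul, Matrix.smul_mulVec] at hfy
      by_cases hp : p ∈ Set.range P
      · obtain ⟨i, rfl⟩ := hp
        have hint := hg.isIntegralAt i
        rw [pointDivisor_apply_self hP, (hω₀.2.2 i).1] at hfy
        have h3 (j : Fin r) : (P i).val (f j) ≤ 1 := by
          have h4 := mul_left_cancel₀ (zpow_ne_zero _ (P i).pi_ne_zero) (hfy j)
          rw [← Place.valued_algebraMap, h4]
          exact hint.transpose_mulVec_mem hy j
        -- The local component at p_i is the value f_j(p_i). Its vanishing supplies the extra factor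
        -- of the local parameter that separates the condition for g from that for g(-D).
        have h4 (j : Fin r) : (P i).HasValue (f j) 0 := by
          obtain ⟨c, hc⟩ := Place.exists_hasValue (hP1 i) (h3 j)
          have h5 := hω₀.localComponent_eq i hc
          rw [← hf, hω'] at h5
          rwa [h5]
        obtain ⟨y', hy', h5⟩ := hint.exists_transpose_mulVec_eq
          (z := fun j => (P i).pi ^ (-1 : ℤ) * algebraMap F (P i).Compl (f j)) fun j => by
            rw [Place.mem_integers, map_mul, Place.valued_pi_zpow, Place.valued_algebraMap]
            calc _ ≤ WithZero.exp (- -1) * WithZero.exp (-1) :=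
                  mul_le_mul' le_rfl (Place.hasValue_zero_iff.1 (h4 j))
              _ = 1 := by rw [← WithZero.exp_add, neg_add_cancel, WithZero.exp_zero]
        refine ⟨y', hy', fun j => ?_⟩
        rw [h5, (hω₀.2.2 i).1]
      · rw [pointDivisor_apply_of_notMem hp, neg_zero, zpow_zero, one_smul] at hfy
        exact ⟨y, hy, hfy⟩
    rwa [h0, Submodule.mem_bot] at h2
  rw [← finrank_differentialSpace hω₀.2.1 hω₀.1, codeΩ, ← LinearMap.range_domRestrict]
  exact LinearMap.finrank_range_of_inj fun a b hab => Subtype.ext <| sub_eq_zero.1 <|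
    key _ (Submodule.sub_mem _ a.2 b.2) fun i j => sub_eq_zero.2 (congrFun (congrFun hab i) j)

end AdelicCode

end

/-! ### The main theorem -/

open AdelicCode
theorem mainTheorem4 {k F : Type*} [Field k] [Finite k] [Field F] [Algebra k F]
    [IsFunctionField k F] {n r : ℕ} (hr : 0 < r)
    (P : Fin n → Place k F) (hP : Function.Injective P) (hP1 : ∀ i, (P i).degree = 1)
    (ω₀ : Module.Dual k (Adele k F)) (hω₀ : IsSpecial P ω₀)
    (g : GL (Fin r) (Adele k F)) (hg : IsBalanced P g) (hss : IsSemistable g) :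
    (AdelicCode.degree g < r * (pointDivisor P).degree →
      Module.Finite k (H0 g) ∧
      Module.finrank k (codeF P g) = h0 g ∧
      (h0 g : ℤ) ≥ AdelicCode.degree g - r * (genus k F - 1)) ∧
    (AdelicCode.degree g > 2 * r * (genus k F - 1) →
      Module.Finite k (H1 (twistNeg g (pointDivisor P))) ∧
      Module.finrank k (codeΩ P ω₀ g) = h1 (twistNeg g (pointDivisor P)) ∧
      (h1 (twistNeg g (pointDivisor P)) : ℤ) ≥
        r * ((pointDivisor P).degree + (genus k F - 1)) - AdelicCode.degree g) ∧
    (r * (pointDivisor P).degree > AdelicCode.degree g ∧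
        AdelicCode.degree g > 2 * r * (genus k F - 1) →
      (Module.finrank k (codeF P g) : ℤ) = AdelicCode.degree g - r * (genus k F - 1) ∧
      (Module.finrank k (codeΩ P ω₀ g) : ℤ) =
        r * ((pointDivisor P).degree + (genus k F - 1)) - AdelicCode.degree g) := by
  have hω := hω₀.1
  have hω0 := hω₀.2.1
  have hH0 := hss.H0_twistNeg_eq_bot hr (E := pointDivisor P)
  have hΩ := hss.differentialSpace_eq_bot hr hω0 hω
  have hrr := h0_sub_h1 g
  have hrr' := h0_sub_h1 (twistNeg g (pointDivisor P))
  rw [degree_twistNeg] at hrr'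
  have hmul : (r : ℤ) * ((pointDivisor P).degree + (genus k F - 1)) =
      r * (pointDivisor P).degree + r * (genus k F - 1) := mul_add _ _ _
  -- The two inequalities are Riemann-Roch for g and for g(-D), with h¹(g) and h⁰(g(-D)) dropped. In
  -- the common range both of these vanish, and equality holds.
  refine ⟨fun h => ⟨inferInstance, finrank_codeF hP hP1 hg (hH0 h), by omega⟩,
    fun h => ⟨inferInstance, finrank_codeΩ hP hP1 hω₀ hg (hΩ h), by omega⟩, fun h => ?_⟩
  have h1g : h1 g = 0 := by
    rw [← finrank_differentialSpace hω0 hω, hΩ h.2, finrank_bot]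
  have h0g : h0 (twistNeg g (pointDivisor P)) = 0 := by
    rw [h0, hH0 h.1, finrank_bot]
  rw [finrank_codeF hP hP1 hg (hH0 h.1), finrank_codeΩ hP hP1 hω₀ hg (hΩ h.2)]
  omega
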